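/- Let $k=\mathbb F_q$ be a finite field and $V$ a non-zero finite-dimensional $k$-vector space. All products are over $k$. **The varieties.** Let $S_V=\mathrm{Sym}\,V$, let $K_V$ be its field of fractions, and let $R_V\subset K_V$ be the $k$-subalgebra generated by all $\frac1v$ with $v\in V\smallsetminus\{0\}$, graded so that the $\frac1v$ have degree $1$. Put $P_V=\mathrm{Proj}\,S_V$ and $Q_V=\mathrm{Proj}\,R_V$. Let $\Omega_V=\mathrm{Spec}\,RS_{V,0}$, where $RS_{V,0}\subset K_V$ is the degree zero part of the subring generated by $R_V$ and $S_V$, i.e. the subalgebra generated by all $\frac vw$ with $v,w\in V$, $w\ne0$. Inverting $\prod_{v\ne0}v$ in $S_V$, resp. $\prod_{v\neq 0}\frac1v$ in $R_V$, gives natural morphisms $\Omega_V\to P_V$ and $\Omega_V\to Q_V$. A morphism $S\to P_{V'}$ corresponds to a subsheaf $\mathcal E_{V'}\subset V'\otimes\mathcal O_S$, the kernel of the surjection from $V'\otimes\mathcal O_S$ to the pullback of $\mathcal O(1)$. So a morphism $S\to\prod_{0\ne V'\subset V}P_{V'}$ corresponds to a tuple $\mathcal E_\bullet=(\mathcal E_{V'})_{0\neq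 V'\subset V}$. Let $B_V\subset\prod_{0\ne V'\subset V}P_{V'}$ be the largest closed subscheme over which $\mathcal E_{V''}\subset\mathcal E_{V'}$ for all $0\ne V''\subset V'\subset V$. **The strata.** A flag of $V$ is a set $\mathcal F$ of subspaces of $V$ that is totally ordered by inclusion and contains $0$ and $V$. For a flag $\mathcal F$ let $B_{\mathcal F}\subset B_V$ be the largest closed subscheme over which $V''\otimes\mathcal O\subset\mathcal E_{V'}$ for all $0\ne V''\subset V'\subset V$ such that there exists $W\in\mathcal F$ with $V''\subset W$ and $V'\not\subset W$. Let $U_{\mathcal F}\subset B_V$ be the largest open subscheme over which $V'\otimes\mathcal O=\mathcal E_{V'}+(V''\otimes\mathcal O)$ for all $0\ne V''\subset V'\subset V$ such that no such $W$ exists. Put $\Omega_{\mathcal F}=B_{\mathcal F}\cap U_{\mathcal F}$. **Theorem.** 1. $B_V$ represents the functor of tuples $\mathcal E_\bullet$ with $\mathcal E_{V''}\subset\mathcal E_{V'}$ for all $0\ne V''\subset V'\subset V$. For every flag $\mathcal F$, the closed subscheme $B_{\mathcal F}$ and the open subscheme $U_{\mathcal F}$ of $B_V$ represent the subfunctors given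 by the respective conditions above. 2. As a set, $B_V$ is the disjoint union of the $\Omega_{\mathcal F}$ for all flags $\mathcal F$ of $V$. 3. $B_V$ is an irreducible smooth projective variety over $k$, that is, it is integral, smooth over $k$, and isomorphic over $k$ to a closed subscheme of some projective space over $k$. 4. $\Omega_V\to P_V$ and $\Omega_V\to Q_V$ are open immersions with dense image. There is an open immersion $j:\Omega_V\hookrightarrow B_V$ over $k$ with image $\Omega_{\{0,V\}}=U_{\{0,V\}}$, and there are morphisms $\pi_P:B_V\to P_V$, $\mathcal E_\bullet\mapsto\mathcal E_V$, and $\pi_Q:B_V\to Q_V$ over $k$ such that $\pi_P\circ j$ and $\pi_Q\circ j$ are the given morphisms $\Omega_V\to P_V$ and $\Omega_V\to Q_V$. 5. $B_V\smallsetminus\Omega_V$ (that is, $B_V\smallsetminus j(\Omega_V)$) is a normal crossings divisor: Zariski locally on $B_V$ there is an étale morphism to an affine space over $k$ under which it is the inverse image of a union of coordinate hyperplanes. 6. $\pi_Q$ is a desingularization of $Q_V$: $B_V$ is smooth over $k$, and $\pi_Q$ is proper and restricts to an isomorphism from a dense open subscheme $\pi_Q^{-1}(U)\subset B_V$ to a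 dense open subscheme $U\subset Q_V$. -/

import Mathlib

open CategoryTheory CategoryTheory.Limits AlgebraicGeometry TensorProduct
universe u
noncomputable section
namespace BV
variable (k V : Type u) [Field k] [AddCommGroup V] [Module k V]

/-- The degree `n` part of `S_V = Sym V`. -/
abbrev symGrading (n : ℕ) : Submodule k (SymmetricAlgebra k V) :=
  LinearMap.range (SymmetricAlgebra.ι k V) ^ n

open scoped DirectSum in
def symGradingι : V →ₗ[k] ⨁ n : ℕ, symGrading k V n :=
  DirectSum.lof k ℕ (fun n => symGrading k V n) 1 ∘ₗ
    (SymmetricAlgebra.ι k V).codRestrict _ fun m => by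
      simpa only [symGrading, pow_one] using LinearMap.mem_range_self _ m

instance : GradedAlgebra (symGrading k V) :=
  GradedAlgebra.ofAlgHom _ (SymmetricAlgebra.lift (symGradingι k V))
    (by
      ext m
      simp [symGradingι, DirectSum.lof_eq_of, DirectSum.coeAlgHom_of])
    fun i x => by
    obtain ⟨x, hx⟩ := x
    dsimp only [Subtype.coe_mk, DirectSum.lof_eq_of]
    induction hx using Submodule.pow_induction_on_left' with
    | algebraMap r =>
      rw [AlgHom.commutes, DirectSum.algebraMap_apply]; rfl
    | add x y i hx hy ihx ihy =>
      rw [map_add, ihx, ihy, ← map_add]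
      rfl
    | mem_mul m hm i x hx ih =>
      obtain ⟨_, rfl⟩ := hm
      rw [map_mul, ih, SymmetricAlgebra.lift_ι_apply]
      simp only [symGradingι, LinearMap.comp_apply, DirectSum.lof_eq_of]
      erw [DirectSum.of_mul_of]
      exact DirectSum.of_eq_of_gradedMonoid_eq (Sigma.subtype_ext (add_comm _ _) rfl)

lemma ι_mem (v : V) : SymmetricAlgebra.ι k V v ∈ symGrading k V 1 := by
  simp [symGrading]

/-- `P_V = Proj S_V`. -/
abbrev P : Scheme.{u} := Proj (symGrading k V)
/-- The structure morphism of `P_V`. -/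
def P.str : P k V ⟶ Spec (.of k) :=
  Proj.toSpecZero (symGrading k V) ≫
    Spec.map (CommRingCat.ofHom (algebraMap k (symGrading k V 0)))

instance [Finite k] [Module.Finite k V] : Finite (Submodule k V) := by
  have := Module.finite_of_finite k (M := V)
  infer_instance


/-- `K_V`, the field of fractions of `S_V`. -/
def K : Type u := FractionRing (SymmetricAlgebra k V)

instance : Field (K k V) := inferInstanceAs (Field (FractionRing (SymmetricAlgebra k V)))
instance : Algebra (SymmetricAlgebra k V) (K k V) :=
  inferInstanceAs (Algebra (SymmetricAlgebra k V) (FractionRing (SymmetricAlgebra k V)))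
instance : IsFractionRing (SymmetricAlgebra k V) (K k V) :=
  inferInstanceAs (IsFractionRing (SymmetricAlgebra k V) (FractionRing (SymmetricAlgebra k V)))
instance : Algebra k (K k V) :=
  inferInstanceAs (Algebra k (FractionRing (SymmetricAlgebra k V)))
instance : IsScalarTower k (SymmetricAlgebra k V) (K k V) :=
  inferInstanceAs (IsScalarTower k (SymmetricAlgebra k V) (FractionRing (SymmetricAlgebra k V)))

/-- The inclusion of `V` into `K_V`. -/
def vec : V →ₗ[k] K k V :=
  (IsScalarTower.toAlgHom k (SymmetricAlgebra k V) (K k V)).toLinearMap ∘ₗ SymmetricAlgebra.ι k V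

lemma ι_injective : Function.Injective (SymmetricAlgebra.ι k V) := by
  rw [injective_iff_map_eq_zero]
  intro v hv
  rw [← Module.forall_dual_apply_eq_zero_iff k v]
  intro f
  rw [← SymmetricAlgebra.lift_ι_apply f v, hv, map_zero]

lemma vec_ne_zero {v : V} (hv : v ≠ 0) : vec k V v ≠ 0 := by
  intro h
  apply hv
  apply ι_injective k V
  apply IsFractionRing.injective (SymmetricAlgebra k V) (K k V)
  rw [map_zero, map_zero]
  exact h

/-- The elements `1 / v` of `K_V`, for `0 ≠ v ∈ V`. -/
def recips : Set (K k V) := {x | ∃ v : V, v ≠ 0 ∧ x = (vec k V v)⁻¹}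

/-- `R_V`, the `k`-subalgebra of `K_V` generated by all `1 / v` for `0 ≠ v ∈ V`. -/
def R : Subalgebra k (K k V) := Algebra.adjoin k (recips k V)

/-- The grading of `R_V` in which the generators `1 / v` have degree `1`. -/
def recipGrading (n : ℕ) : Submodule k (R k V) :=
  (Submodule.span k (recips k V) ^ n).comap (R k V).val.toLinearMap

open Polynomial in
def homogMap : SymmetricAlgebra k V →ₐ[k] (K k V)[X] :=
  SymmetricAlgebra.lift (((LinearMap.lsmul (K k V) (K k V)[X]).flip X).restrictScalars k ∘ₗ vec k V)

open Polynomial in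
lemma homogMap_ι (v : V) : homogMap k V (SymmetricAlgebra.ι k V v) = vec k V v • X := by
  simp [homogMap]

lemma eval_homogMap (s : SymmetricAlgebra k V) :
    (homogMap k V s).eval 1 = algebraMap _ (K k V) s := by
  have : ((Polynomial.aeval (1 : K k V)).restrictScalars k).comp (homogMap k V) =
      IsScalarTower.toAlgHom k (SymmetricAlgebra k V) (K k V) := by
    apply SymmetricAlgebra.algHom_ext
    ext v
    change Polynomial.aeval (1 : K k V) (homogMap k V (SymmetricAlgebra.ι k V v)) = vec k V v
    simp [homogMap_ι]
  have h := DFunLike.congr_fun this s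
  simpa [Polynomial.aeval_def, Polynomial.eval₂_eq_eval_map] using h

lemma homogMap_injective : Function.Injective (homogMap k V) := by
  intro a b h
  apply IsFractionRing.injective (SymmetricAlgebra k V) (K k V)
  rw [← eval_homogMap, ← eval_homogMap, h]

/-- The embedding `K_V → K_V(X)` with `v ↦ v X`; it serves to separate degrees. -/
def scale : K k V →+* RatFunc (K k V) :=
  IsFractionRing.lift (A := SymmetricAlgebra k V)
    (g := (algebraMap (Polynomial (K k V)) (RatFunc (K k V))).comp (homogMap k V).toRingHom)
    ((IsFractionRing.injective (Polynomial (K k V)) (RatFunc (K k V))).comp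
      (homogMap_injective k V))

lemma scale_vec (v : V) : scale k V (vec k V v) = RatFunc.C (vec k V v) * RatFunc.X := by
  have : vec k V v = algebraMap (SymmetricAlgebra k V) (K k V) (SymmetricAlgebra.ι k V v) := rfl
  conv_lhs => rw [this]
  simp only [scale, IsFractionRing.lift_algebraMap]
  simp [homogMap_ι, Polynomial.smul_eq_C_mul]

lemma scale_algebraMap (c : k) :
    scale k V (algebraMap k _ c) = RatFunc.C (algebraMap k (K k V) c) := by
  rw [IsScalarTower.algebraMap_apply k (SymmetricAlgebra k V) (K k V)]
  simp only [scale, IsFractionRing.lift_algebraMap]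
  simp only [AlgHom.toRingHom_eq_coe, RingHom.comp_apply, RingHom.coe_coe, AlgHom.commutes]
  rw [Polynomial.algebraMap_apply, RatFunc.algebraMap_C,
    IsScalarTower.algebraMap_apply k (SymmetricAlgebra k V) (K k V)]

lemma scale_recip {n : ℕ} {x : K k V} (hx : x ∈ Submodule.span k (recips k V) ^ n) :
    scale k V x * RatFunc.X ^ n = RatFunc.C x := by
  induction hx using Submodule.pow_induction_on_left' with
  | algebraMap r => rw [pow_zero, mul_one, scale_algebraMap]
  | add x y i hx hy ihx ihy => rw [map_add, map_add, add_mul, ihx, ihy]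
  | mem_mul m hm i x hx ih =>
    have key : scale k V m * RatFunc.X = RatFunc.C m := by
      induction hm using Submodule.span_induction with
      | mem m hm =>
        obtain ⟨v, hv, rfl⟩ := hm
        rw [map_inv₀, scale_vec, map_inv₀, mul_inv, mul_assoc,
          inv_mul_cancel₀ RatFunc.X_ne_zero, mul_one]
      | zero => simp
      | add a b _ _ ha hb => rw [map_add, map_add, add_mul, ha, hb]
      | smul c a _ ha =>
        rw [Algebra.smul_def, map_mul, map_mul, scale_algebraMap, mul_assoc, ha]
    rw [map_mul, map_mul, ← key, ← ih, Nat.succ_eq_add_one, pow_succ]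
    ring

lemma recipGrading_iSupIndep : iSupIndep (recipGrading k V) := by
  rw [iSupIndep_iff_finsetSum_eq_zero_imp_eq_zero]
  intro s x hx hsum i hi
  have h1 : ∑ j ∈ s, scale k V (x j : K k V) = 0 := by
    rw [← map_sum, ← AddSubmonoidClass.coe_finsetSum, hsum]
    simp
  obtain ⟨N, hN⟩ : ∃ N, ∀ j ∈ s, j ≤ N := ⟨s.sup id, fun j hj => Finset.le_sup (f := id) hj⟩
  have h2 : ∑ j ∈ s, (Polynomial.C (x j : K k V)) * Polynomial.X ^ (N - j) = 0 := by
    apply IsFractionRing.injective (Polynomial (K k V)) (RatFunc (K k V))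
    rw [map_sum, map_zero]
    have : (∑ j ∈ s, scale k V (x j : K k V)) * RatFunc.X ^ N = 0 := by rw [h1, zero_mul]
    rw [Finset.sum_mul] at this
    rw [← this]
    refine Finset.sum_congr rfl fun j hj => ?_
    rw [map_mul, map_pow, RatFunc.algebraMap_C, RatFunc.algebraMap_X, ← scale_recip k V (show (x j : K k V) ∈ _ from hx j hj),
      mul_assoc, ← pow_add, Nat.add_sub_cancel' (hN j hj)]
  have h3 := congrArg (fun p => Polynomial.coeff p (N - i)) h2
  simp only [Polynomial.finsetSum_coeff, Polynomial.coeff_C_mul_X_pow, Polynomial.coeff_zero] at h3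
  rw [Finset.sum_eq_single i] at h3
  · simpa using h3
  · intro j hj hji
    rw [if_neg]
    intro h
    have := hN j hj
    have := hN i hi
    omega
  · exact fun h => absurd hi h

instance : SetLike.GradedMonoid (recipGrading k V) where
  one_mem := by
    change (1 : K k V) ∈ Submodule.span k (recips k V) ^ 0
    rw [pow_zero]
    exact Submodule.one_le.mp le_rfl
  mul_mem i j a b ha hb := by
    change (a : K k V) * b ∈ Submodule.span k (recips k V) ^ (i + j)
    rw [pow_add]
    exact Submodule.mul_mem_mul ha hb

lemma recipGrading_iSup : iSup (recipGrading k V) = ⊤ := by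
  rw [eq_top_iff]
  rintro ⟨x, hx⟩ -
  have hle : ∀ n, recipGrading k V n ≤ iSup (recipGrading k V) := le_iSup _
  unfold R at hx
  induction hx using Algebra.adjoin_induction with
  | mem x hx =>
    refine hle 1 ?_
    change x ∈ Submodule.span k (recips k V) ^ 1
    rw [pow_one]
    exact Submodule.subset_span hx
  | algebraMap r =>
    refine hle 0 ?_
    change algebraMap k (K k V) r ∈ Submodule.span k (recips k V) ^ 0
    rw [pow_zero]
    exact Submodule.algebraMap_mem r
  | add x y hx hy ihx ihy => exact add_mem ihx ihy
  | mul x y hx hy ihx ihy =>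
    have aux : ∀ a b : R k V, a ∈ iSup (recipGrading k V) → b ∈ iSup (recipGrading k V) →
        a * b ∈ iSup (recipGrading k V) := by
      intro a b ha hb
      induction ha using Submodule.iSup_induction' with
      | mem i a ha =>
        induction hb using Submodule.iSup_induction' with
        | mem j b hb => exact hle (i + j) (SetLike.GradedMul.mul_mem ha hb)
        | zero => rw [mul_zero]; exact zero_mem _
        | add b c _ _ hb hc => rw [mul_add]; exact add_mem hb hc
      | zero => rw [zero_mul]; exact zero_mem _
      | add b c _ _ hb hc => rw [add_mul]; exact add_mem hb hc
    exact aux ⟨x, hx⟩ ⟨y, hy⟩ ihx ihy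

instance : GradedAlgebra (recipGrading k V) where
  toDecomposition := (DirectSum.isInternal_submodule_of_iSupIndep_of_iSup_eq_top
    (recipGrading_iSupIndep k V) (recipGrading_iSup k V)).chooseDecomposition

/-- `Q_V = Proj R_V`. -/
def Q : Scheme.{u} := Proj (recipGrading k V)
/-- The structure morphism of `Q_V`. -/
def Q.str : Q k V ⟶ Spec (.of k) :=
  Proj.toSpecZero (recipGrading k V) ≫
    Spec.map (CommRingCat.ofHom (algebraMap k (recipGrading k V 0)))

section Omega

/-- The degree zero part `RS_{V,0}` of the subring of `K_V` generated by `R_V` and `S_V`: it is generated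
by all quotients `v / w` of vectors with `w ≠ 0`. -/
def RSZero : Subalgebra k (K k V) :=
  Algebra.adjoin k {x | ∃ v w : V, w ≠ 0 ∧ x = vec k V v / vec k V w}

lemma mul_mem_RSZero {n : ℕ} {x y : K k V} (hx : x ∈ LinearMap.range (vec k V) ^ n)
    (hy : y ∈ Submodule.span k (recips k V) ^ n) : x * y ∈ RSZero k V := by
  have h1 : LinearMap.range (vec k V) * Submodule.span k (recips k V) ≤
      Subalgebra.toSubmodule (RSZero k V) := by
    rw [Submodule.mul_le]
    rintro _ ⟨v, rfl⟩ y hy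
    induction hy using Submodule.span_induction with
    | mem y hy =>
      obtain ⟨w, hw, rfl⟩ := hy
      exact Algebra.subset_adjoin ⟨v, w, hw, (div_eq_mul_inv _ _).symm⟩
    | zero => rw [mul_zero]; exact zero_mem _
    | add a b _ _ ha hb => rw [mul_add]; exact add_mem ha hb
    | smul c a _ ha => rw [mul_smul_comm]; exact Submodule.smul_mem _ c ha
  have h2 : ∀ m : ℕ, (LinearMap.range (vec k V) * Submodule.span k (recips k V)) ^ m ≤
      Subalgebra.toSubmodule (RSZero k V) := by
    intro m
    induction m with
    | zero => rw [pow_zero, Submodule.one_le]; exact one_mem (RSZero k V)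
    | succ m ih =>
      rw [pow_succ, Submodule.mul_le]
      exact fun a ha b hb => (RSZero k V).mul_mem (ih ha) (h1 hb)
  apply h2 n
  rw [mul_pow]
  exact Submodule.mul_mem_mul hx hy

section Embedding

variable {A : Type u} [CommRing A] [Algebra k A] (𝒜 : ℕ → Submodule k A) [GradedAlgebra 𝒜]

/-- `a / f ^ n ↦ φ a / φ f ^ n` -/
def awayToK (φ : A →ₐ[k] K k V) (f : A) (hf : φ f ≠ 0) :
    HomogeneousLocalization.Away 𝒜 f →+* K k V :=
  (IsLocalization.Away.lift (S := Localization.Away f) f (g := φ.toRingHom)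
    (isUnit_iff_ne_zero.mpr hf)).comp
    (algebraMap (HomogeneousLocalization.Away 𝒜 f) (Localization.Away f))

lemma awayToK_mk (φ : A →ₐ[k] K k V) (f : A) (hf : φ f ≠ 0) {d : ℕ} (hd : f ∈ 𝒜 d) (n : ℕ) (a : A)
    (ha : a ∈ 𝒜 (n • d)) :
    awayToK k V 𝒜 φ f hf (HomogeneousLocalization.Away.mk 𝒜 hd n a ha) = φ a / φ f ^ n := by
  rw [eq_div_iff (pow_ne_zero _ hf)]
  change IsLocalization.Away.lift (S := Localization.Away f) f (g := φ.toRingHom)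
    (isUnit_iff_ne_zero.mpr hf) (Localization.mk a ⟨f ^ n, n, rfl⟩) * _ = _
  have h : Localization.mk a (⟨f ^ n, n, rfl⟩ : Submonoid.powers f) *
      algebraMap A (Localization.Away f) (f ^ n) = algebraMap A (Localization.Away f) a := by
    rw [Localization.mk_eq_mk']
    exact IsLocalization.mk'_spec (M := Submonoid.powers f) _ a ⟨f ^ n, n, rfl⟩
  have h2 := congrArg (IsLocalization.Away.lift (S := Localization.Away f) f (g := φ.toRingHom)
    (isUnit_iff_ne_zero.mpr hf)) h
  rw [map_mul, IsLocalization.Away.lift_eq, IsLocalization.Away.lift_eq, map_pow] at h2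
  exact h2

end Embedding

/-- The element `1 / v` of `R_V`. -/
def recip (v : V) (hv : v ≠ 0) : R k V :=
  ⟨(vec k V v)⁻¹, Algebra.subset_adjoin ⟨v, hv, rfl⟩⟩

lemma recip_mem (v : V) (hv : v ≠ 0) : recip k V v hv ∈ recipGrading k V 1 := by
  change (vec k V v)⁻¹ ∈ Submodule.span k (recips k V) ^ 1
  rw [pow_one]
  exact Submodule.subset_span ⟨v, hv, rfl⟩

lemma vec_mem_pow {n : ℕ} {a : SymmetricAlgebra k V} (ha : a ∈ symGrading k V n) :
    algebraMap (SymmetricAlgebra k V) (K k V) a ∈ LinearMap.range (vec k V) ^ n := by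
  have := Submodule.mem_map_of_mem
    (f := (IsScalarTower.toAlgHom k (SymmetricAlgebra k V) (K k V)).toLinearMap) ha
  rw [Submodule.map_pow, ← LinearMap.range_comp] at this
  exact this

variable [Finite k] [Module.Finite k V]

/-- `V ∖ {0}`. -/
def nonzeroVectors : Finset V :=
  haveI : Finite V := Module.finite_of_finite k
  (Set.toFinite {v : V | v ≠ 0}).toFinset

lemma mem_nonzeroVectors {v : V} : v ∈ nonzeroVectors k V ↔ v ≠ 0 := by
  simp [nonzeroVectors]

/-- The product of all `v ∈ V ∖ {0}` in `S_V`. -/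
def prodVec : SymmetricAlgebra k V := ∏ v ∈ nonzeroVectors k V, SymmetricAlgebra.ι k V v

/-- The product of all `1 / v`, for `v ∈ V ∖ {0}`, in `R_V`. -/
def prodRecip : R k V :=
  ∏ v ∈ (nonzeroVectors k V).attach, recip k V v.1 ((mem_nonzeroVectors k V).mp v.2)

lemma prodVec_mem : prodVec k V ∈ symGrading k V (nonzeroVectors k V).card := by
  have := SetLike.prod_mem_graded (A := symGrading k V) (F := nonzeroVectors k V) (i := fun _ => 1)
    (g := SymmetricAlgebra.ι k V) (fun v _ => ι_mem k V v)
  simpa [prodVec] using this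

lemma prodRecip_mem : prodRecip k V ∈ recipGrading k V (nonzeroVectors k V).card := by
  have := SetLike.prod_mem_graded (A := recipGrading k V) (F := (nonzeroVectors k V).attach)
    (i := fun _ => 1)
    (g := fun v : nonzeroVectors k V => recip k V v.1 ((mem_nonzeroVectors k V).mp v.2))
    (fun v _ => recip_mem k V v.1 _)
  simpa [prodRecip] using this

lemma coe_prodVec : algebraMap (SymmetricAlgebra k V) (K k V) (prodVec k V) =
    ∏ v ∈ nonzeroVectors k V, vec k V v := by
  rw [prodVec, map_prod]
  rfl

lemma coe_prodRecip : (prodRecip k V : K k V) = (∏ v ∈ nonzeroVectors k V, vec k V v)⁻¹ := by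
  rw [prodRecip, ← Subalgebra.coe_val, map_prod, ← Finset.prod_inv_distrib,
    ← Finset.prod_attach (nonzeroVectors k V) (fun v => (vec k V v)⁻¹)]
  rfl

lemma prod_ne_zero : ∏ v ∈ nonzeroVectors k V, vec k V v ≠ 0 :=
  Finset.prod_ne_zero_iff.mpr fun _ hv => vec_ne_zero k V ((mem_nonzeroVectors k V).mp hv)

lemma prod_vec_mem : ∏ v ∈ nonzeroVectors k V, vec k V v ∈
    LinearMap.range (vec k V) ^ (nonzeroVectors k V).card := by
  generalize nonzeroVectors k V = s
  classical
  induction s using Finset.induction_on with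
  | empty => simp
  | insert v s hv ih =>
    rw [Finset.prod_insert hv, Finset.card_insert_of_notMem hv, pow_succ']
    exact Submodule.mul_mem_mul (LinearMap.mem_range_self _ v) ih

/-- The map from the degree zero part of `S_V[1 / ∏ v]` to `RS_{V,0}` inside `K_V`. -/
def toRSZeroOfSym : HomogeneousLocalization.Away (symGrading k V) (prodVec k V) →+* RSZero k V :=
  (awayToK k V (symGrading k V) (IsScalarTower.toAlgHom k (SymmetricAlgebra k V) (K k V))
    (prodVec k V) (by
      rw [IsScalarTower.coe_toAlgHom', coe_prodVec]; exact prod_ne_zero k V)).codRestrict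
    (RSZero k V) fun x => by
      obtain ⟨n, a, ha, rfl⟩ := x.mk_surjective _ (prodVec_mem k V)
      rw [awayToK_mk, div_eq_mul_inv]
      refine mul_mem_RSZero k V (vec_mem_pow k V ha) ?_
      have := Submodule.pow_mem_pow _ (show (prodRecip k V : K k V) ∈ _ from prodRecip_mem k V) n
      rw [coe_prodRecip, ← pow_mul, inv_pow] at this
      rw [IsScalarTower.coe_toAlgHom', coe_prodVec, smul_eq_mul, mul_comm n]
      exact this

/-- The map from the degree zero part of `R_V[1 / ∏ (1 / v)]` to `RS_{V,0}` inside `K_V`. -/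
def toRSZeroOfRecip :
    HomogeneousLocalization.Away (recipGrading k V) (prodRecip k V) →+* RSZero k V :=
  (awayToK k V (recipGrading k V) (R k V).val (prodRecip k V) (by
      rw [Subalgebra.coe_val, coe_prodRecip]; exact inv_ne_zero (prod_ne_zero k V))).codRestrict
    (RSZero k V) fun x => by
      obtain ⟨n, a, ha, rfl⟩ := x.mk_surjective _ (prodRecip_mem k V)
      rw [awayToK_mk, div_eq_mul_inv, mul_comm]
      refine mul_mem_RSZero k V ?_ (show (a : K k V) ∈ _ from ha)
      rw [Subalgebra.coe_val, coe_prodRecip, inv_pow, inv_inv, smul_eq_mul, mul_comm n, pow_mul]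
      exact Submodule.pow_mem_pow _ (prod_vec_mem k V) n

/-- `Ω_V = Spec RS_{V,0}`. -/
def Ω : Scheme.{u} := Spec (.of (RSZero k V))
def Ω.str : Ω k V ⟶ Spec (.of k) := Spec.map (CommRingCat.ofHom (algebraMap k (RSZero k V)))

variable [Nontrivial V]

lemma card_pos : 0 < (nonzeroVectors k V).card := by
  obtain ⟨v, hv⟩ := exists_ne (0 : V)
  exact Finset.card_pos.mpr ⟨v, (mem_nonzeroVectors k V).mpr hv⟩

/-- The inclusion of `Ω_V` into `P_V` as the locus where all `v ∈ V ∖ {0}` are non-zero. -/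
def Ω.toP : Ω k V ⟶ P k V :=
  Spec.map (CommRingCat.ofHom (toRSZeroOfSym k V)) ≫
    Proj.awayι (symGrading k V) (prodVec k V) (prodVec_mem k V) (card_pos k V)

/-- The inclusion of `Ω_V` into `Q_V` as the locus where all `1 / v` are non-zero. -/
def Ω.toQ : Ω k V ⟶ Q k V :=
  Spec.map (CommRingCat.ofHom (toRSZeroOfRecip k V)) ≫
    Proj.awayι (recipGrading k V) (prodRecip k V) (prodRecip_mem k V) (card_pos k V)

end Omega

/-- The open subscheme of `P_V` where `v₀` does not vanish (empty for `v₀ = 0`). -/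
abbrev P.chart (v₀ : V) : (P k V).Opens :=
  Proj.basicOpen (symGrading k V) (SymmetricAlgebra.ι k V v₀)

/-- The fraction `v / v₀` of degree zero. -/
def fracAway (v₀ v : V) :
    HomogeneousLocalization.Away (symGrading k V) (SymmetricAlgebra.ι k V v₀) :=
  HomogeneousLocalization.Away.mk (symGrading k V) (ι_mem k V v₀) 1 (SymmetricAlgebra.ι k V v)
    (by simp)

/-- The function `v / v₀` on the chart of `v₀`. -/
def P.frac (v₀ v : V) : Γ(P k V, P.chart k V v₀) :=
  Proj.awayToSection (symGrading k V) (SymmetricAlgebra.ι k V v₀) (fracAway k V v₀ v)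

lemma P.frac_add (v₀ v w : V) : P.frac k V v₀ (v + w) = P.frac k V v₀ v + P.frac k V v₀ w := by
  have : fracAway k V v₀ (v + w) = fracAway k V v₀ v + fracAway k V v₀ w := by
    apply HomogeneousLocalization.val_injective
    rw [HomogeneousLocalization.val_add]
    simp only [fracAway, HomogeneousLocalization.Away.val_mk, map_add, Localization.add_mk_self]
  rw [P.frac, this]
  exact map_add (Proj.awayToSection (symGrading k V) (SymmetricAlgebra.ι k V v₀)).hom _ _

variable {k} in
/-- The structure map `k → O_S(U)` of a `k`-scheme `S`. -/
def scalars {S : Scheme.{u}} (s : S ⟶ Spec (.of k)) (U : S.Opens) : CommRingCat.of k ⟶ Γ(S, U) :=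
  (Scheme.ΓSpecIso (.of k)).inv ≫ s.appTop ≫ S.presheaf.map (homOfLE le_top).op

variable {k} in
lemma scalars_comp {S T : Scheme.{u}} (g : S ⟶ T) (t : T ⟶ Spec (.of k)) (W : T.Opens) (U : S.Opens)
    (e : U ≤ g ⁻¹ᵁ W) : scalars t W ≫ g.appLE W U e = scalars (g ≫ t) U := by
  simp only [scalars, Category.assoc, Scheme.Hom.map_appLE, Scheme.Hom.comp_appTop]
  rfl

variable {k} in
lemma scalars_res {S : Scheme.{u}} (s : S ⟶ Spec (.of k)) {U U' : S.Opens} (e : U' ≤ U) :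
    scalars s U ≫ S.presheaf.map (homOfLE e).op = scalars s U' := by
  simp only [scalars, Category.assoc, ← Functor.map_comp]
  rfl

lemma P.scalars_str (v₀ : V) : scalars (P.str k V) (P.chart k V v₀) =
    CommRingCat.ofHom (algebraMap k (symGrading k V 0)) ≫
      CommRingCat.ofHom (HomogeneousLocalization.fromZeroRingHom (symGrading k V) _) ≫
      Proj.awayToSection (symGrading k V) (SymmetricAlgebra.ι k V v₀) := by
  have h : (P.chart k V v₀).ι ≫ P.str k V =
      Proj.basicOpenToSpec (symGrading k V) (SymmetricAlgebra.ι k V v₀) ≫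
      Spec.map (CommRingCat.ofHom (algebraMap k (symGrading k V 0)) ≫
      CommRingCat.ofHom (HomogeneousLocalization.fromZeroRingHom (symGrading k V) _)) := by
    rw [Spec.map_comp, ← Proj.awayι_toSpecZero (symGrading k V) _ (ι_mem k V v₀) one_pos,
      Proj.awayι, Category.assoc, Category.assoc, ← Proj.basicOpenIsoSpec_hom _ _ (ι_mem k V v₀)
        one_pos, Iso.hom_inv_id_assoc]
    rfl
  have h3 : ∀ {T : Scheme.{u}} (t : T ⟶ Spec (.of k)) (U : T.Opens),
      scalars (U.ι ≫ t) ⊤ ≫ U.topIso.hom = scalars t U := by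
    intro T t U
    rw [← scalars_comp U.ι t U ⊤ (by simp), Category.assoc]
    have : U.ι.appLE U ⊤ (by simp) ≫ U.topIso.hom = 𝟙 _ := by
      rw [← Iso.eq_comp_inv]
      simp only [Scheme.Hom.appLE, Scheme.Opens.ι_app, Scheme.Opens.topIso_inv,
        eqToHom_op]
      erw [← Functor.map_comp]
      rfl
    rw [this, Category.comp_id]
  rw [← h3, h]
  rw [← scalars_comp _ _ ⊤ ⊤ le_top]
  have h5 : ∀ {A : CommRingCat.{u}} (φ : CommRingCat.of k ⟶ A), scalars (Spec.map φ) ⊤ =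
      φ ≫ (Scheme.ΓSpecIso A).inv := by
    intro A φ
    simp only [scalars, ← Scheme.ΓSpecIso_inv_naturality_assoc]
    have : (Spec A).presheaf.map (homOfLE (le_top (a := (⊤ : (Spec A).Opens)))).op = 𝟙 _ :=
      (Spec A).presheaf.map_id _
    rw [this, Category.comp_id]
  rw [h5]
  have h6 := Proj.basicOpenToSpec_app_top (symGrading k V) (SymmetricAlgebra.ι k V v₀)
  rw [Scheme.Hom.app_eq_appLE] at h6
  erw [h6]
  simp only [Category.assoc, Iso.inv_hom_id_assoc]
  erw [Iso.inv_hom_id]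
  simp

lemma P.frac_smul (v₀ : V) (c : k) (v : V) : P.frac k V v₀ (c • v) =
    scalars (P.str k V) (P.chart k V v₀) c * P.frac k V v₀ v := by
  have : fracAway k V v₀ (c • v) = HomogeneousLocalization.fromZeroRingHom (symGrading k V) _
      (algebraMap k (symGrading k V 0) c) * fracAway k V v₀ v := by
    apply HomogeneousLocalization.val_injective
    rw [HomogeneousLocalization.val_mul, fracAway, fracAway,
      HomogeneousLocalization.Away.val_mk, HomogeneousLocalization.Away.val_mk]
    change _ = Localization.mk _ _ * _
    rw [Localization.mk_mul]
    congr 1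
    · simp [Algebra.smul_def]
    · exact (one_mul _).symm
  rw [P.frac, this, P.scalars_str]
  exact map_mul (Proj.awayToSection (symGrading k V) (SymmetricAlgebra.ι k V v₀)).hom _ _

section Points
variable {k V} {S : Scheme.{u}}

/-- The sections `O_S(U)`, as a `k`-algebra via the structure morphism of `S`. -/
def Sec (_s : S ⟶ Spec (.of k)) (U : S.Opens) : Type u := Γ(S, U)

instance (s : S ⟶ Spec (.of k)) (U : S.Opens) : CommRing (Sec s U) :=
  inferInstanceAs (CommRing Γ(S, U))
instance (s : S ⟶ Spec (.of k)) (U : S.Opens) : Algebra k (Sec s U) :=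
  (scalars s U).hom.toAlgebra

/-- Restriction of sections. -/
def Sec.res (s : S ⟶ Spec (.of k)) {U U' : S.Opens} (e : U' ≤ U) : Sec s U →ₐ[k] Sec s U' where
  __ := (S.presheaf.map (homOfLE e).op).hom
  commutes' c := congrArg (fun φ => φ.hom c) (scalars_res s e)

/-- For `g : S ⟶ P_V` and `U` inside the inverse image of the chart of `v₀`: the map `V → O_S(U)`,
`v ↦ g^*(v / v₀)`. -/
def coordSection (s : S ⟶ Spec (.of k)) (g : S ⟶ P k V) (h : g ≫ P.str k V = s) (v₀ : V)
    {U : S.Opens} (e : U ≤ g ⁻¹ᵁ P.chart k V v₀) : V →ₗ[k] Sec s U where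
  toFun v := (g.appLE (P.chart k V v₀) U e).hom (P.frac k V v₀ v)
  map_add' v w := by rw [P.frac_add, map_add]; rfl
  map_smul' c v := by
    have h1 := congrArg (fun φ => φ.hom c) (scalars_comp g (P.str k V) (P.chart k V v₀) U e)
    rw [h] at h1
    rw [P.frac_smul, map_mul]
    exact congrArg (· * _) h1

/-- The map `O_S ⊗ V → L` from the sheaf `O_S ⊗ V` to the invertible sheaf `L = g^* O(1)`, over the
inverse image of the chart of `v₀`, where `L` is trivialized by `v₀`: `a ⊗ v ↦ a · g^*(v / v₀)`. -/
def evalAt (s : S ⟶ Spec (.of k)) (g : S ⟶ P k V) (h : g ≫ P.str k V = s) (U : S.Opens) (v₀ : V) :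
    Sec s U ⊗[k] V →ₗ[k] Sec s (U ⊓ g ⁻¹ᵁ P.chart k V v₀) :=
  TensorProduct.lift ((LinearMap.mul k (Sec s (U ⊓ g ⁻¹ᵁ P.chart k V v₀))).compl₁₂
    (Sec.res s inf_le_left).toLinearMap (coordSection s g h v₀ inf_le_right))

/-- The sections over `U` of the kernel `E` of the surjection `O_S ⊗ V → L = g^* O(1)` that belongs to
`g : S ⟶ P_V`; the inverse images of the charts of all `v₀` cover `U`. As `V` is finite dimensional,
the sections of the sheaf `O_S ⊗ V` over `U` are `O_S(U) ⊗ V`. -/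
def kernelSheaf (s : S ⟶ Spec (.of k)) (g : S ⟶ P k V) (h : g ≫ P.str k V = s) (U : S.Opens) :
    Submodule k (Sec s U ⊗[k] V) :=
  ⨅ v₀ : V, LinearMap.ker (evalAt s g h U v₀)

end Points

section LinearFunctoriality
variable {k V} {W : Type u} [AddCommGroup W] [Module k W]

/-- The homomorphism of graded algebras `Sym V → Sym W` induced by a linear isomorphism. -/
def symMap (e : V ≃ₗ[k] W) : symGrading k V →+*ᵍ symGrading k W where
  __ := (SymmetricAlgebra.lift (SymmetricAlgebra.ι k W ∘ₗ e.toLinearMap) :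
    SymmetricAlgebra k V →ₐ[k] SymmetricAlgebra k W).toRingHom
  map_mem {i x} hx := by
    have h := Submodule.mem_map_of_mem (f := (SymmetricAlgebra.lift
      (SymmetricAlgebra.ι k W ∘ₗ e.toLinearMap) :
        SymmetricAlgebra k V →ₐ[k] SymmetricAlgebra k W).toLinearMap) hx
    rw [symGrading, Submodule.map_pow, ← LinearMap.range_comp] at h
    refine pow_le_pow_left' (show _ ≤ LinearMap.range (SymmetricAlgebra.ι k W) from ?_) i h
    rintro _ ⟨v, rfl⟩
    exact ⟨e v, by simp⟩

lemma symMap_ι (e : V ≃ₗ[k] W) (v : V) :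
    symMap e (SymmetricAlgebra.ι k V v) = SymmetricAlgebra.ι k W (e v) :=
  SymmetricAlgebra.lift_ι_apply (SymmetricAlgebra.ι k W ∘ₗ e.toLinearMap) v

lemma symMap_symm (e : V ≃ₗ[k] W) (x : SymmetricAlgebra k W) :
    symMap e (symMap e.symm x) = x := by
  have h : ((SymmetricAlgebra.lift (SymmetricAlgebra.ι k W ∘ₗ e.toLinearMap) :
      SymmetricAlgebra k V →ₐ[k] SymmetricAlgebra k W)).comp
      (SymmetricAlgebra.lift (SymmetricAlgebra.ι k V ∘ₗ e.symm.toLinearMap)) = AlgHom.id k _ := by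
    apply SymmetricAlgebra.algHom_ext
    ext w
    simp
  exact DFunLike.congr_fun h x

lemma symMap_irrelevant (e : V ≃ₗ[k] W) :
    HomogeneousIdeal.irrelevant (symGrading k W) ≤
      (HomogeneousIdeal.irrelevant (symGrading k V)).map (symMap e) := by
  rw [HomogeneousIdeal.irrelevant_le]
  intro i hi x hx
  have hx : x ∈ symGrading k W i := hx
  rw [← symMap_symm e x]
  exact Ideal.mem_map_of_mem _
    (HomogeneousIdeal.mem_irrelevant_of_mem _ hi ((symMap e.symm).map_mem hx))

/-- The isomorphism `P_W ≅ P_V` induced by a linear isomorphism `V ≃ W`. -/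
def P.map (e : V ≃ₗ[k] W) : P k W ⟶ P k V :=
  Proj.map (symMap e) (symMap_irrelevant e)

end LinearFunctoriality

section Moduli
variable [Finite k] [Module.Finite k V]

/-- The non-zero subspaces of `V`. -/
abbrev NZ := {W : Submodule k V // W ≠ ⊥}

instance : HasLimitsOfShape (WidePullbackShape (NZ k V)) Scheme.{u} := by
  have := Fintype.ofFinite (NZ k V)
  classical
  exact hasLimitsOfShape_of_hasFiniteLimits _ _

/-- The product over `Spec k` of the `P_W` for all non-zero subspaces `W` of `V`. -/
def prodP : Scheme.{u} :=
  widePullback (Spec (.of k)) (fun W : NZ k V => P k W.1) (fun W => P.str k W.1)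

/-- The structure morphism of the product. -/
def prodP.str : prodP k V ⟶ Spec (.of k) :=
  WidePullback.base fun W : NZ k V => P.str k W.1

/-- The projection to `P_W`. -/
def prodP.π (W : NZ k V) : prodP k V ⟶ P k W.1 :=
  WidePullback.π (fun W : NZ k V => P.str k W.1) W

lemma prodP.π_str (W : NZ k V) : prodP.π k V W ≫ P.str k W.1 = prodP.str k V :=
  WidePullback.π_arrow (fun W : NZ k V => P.str k W.1) W

variable {k V} {S : Scheme.{u}}

/-- `S` as a `k`-scheme, for a point `f : S ⟶ ∏ P_W`. -/
abbrev strOf (f : S ⟶ prodP k V) : S ⟶ Spec (.of k) := f ≫ prodP.str k V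

/-- For an `S`-valued point `f` of `∏ P_W`: the subsheaf `E_W ⊆ O_S ⊗ W` belonging to its component
in `P_W`. -/
def E (f : S ⟶ prodP k V) (W : NZ k V) (U : S.Opens) :
    Submodule k (Sec (strOf f) U ⊗[k] W.1) :=
  kernelSheaf (strOf f) (f ≫ prodP.π k V W) (by rw [Category.assoc, prodP.π_str]) U

/-- For `W'' ⊆ W'`: the map `O_S(U) ⊗ W'' → O_S(U) ⊗ W'`. -/
abbrev incl (f : S ⟶ prodP k V) {W'' W' : NZ k V} (h : W''.1 ≤ W'.1) (U : S.Opens) :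
    Sec (strOf f) U ⊗[k] W''.1 →ₗ[k] Sec (strOf f) U ⊗[k] W'.1 :=
  LinearMap.lTensor _ (Submodule.inclusion h)

/-- `E_{W''} ⊆ E_{W'}` for all `0 ≠ W'' ⊆ W' ⊆ V`. -/
def Incidence (f : S ⟶ prodP k V) : Prop :=
  ∀ (W'' W' : NZ k V) (h : W''.1 ≤ W'.1) (U : S.Opens),
    (E f W'' U).map (incl f h U) ≤ E f W' U

/-- A flag: a set of subspaces totally ordered by inclusion and containing `0` and `V`. -/
def IsFlag (F : Set (Submodule k V)) : Prop :=
  IsChain (· ≤ ·) F ∧ ⊥ ∈ F ∧ ⊤ ∈ F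

/-- There is a member `W` of `F` with `W'' ⊆ W` and `W' ⊈ W`. -/
def Separates (F : Set (Submodule k V)) (W'' W' : Submodule k V) : Prop :=
  ∃ W ∈ F, W'' ≤ W ∧ ¬ W' ≤ W

/-- `O_S ⊗ W'' ⊆ E_{W'}` for all `0 ≠ W'' ⊆ W' ⊆ V` that are separated by `F`. -/
def ClosedCond (F : Set (Submodule k V)) (f : S ⟶ prodP k V) : Prop :=
  ∀ (W'' W' : NZ k V) (h : W''.1 ≤ W'.1), Separates F W''.1 W'.1 →
    ∀ U : S.Opens, LinearMap.range (incl f h U) ≤ E f W' U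

/-- `O_S ⊗ W' = E_{W'} + O_S ⊗ W''` (an equality of sheaves, hence required locally) for all
`0 ≠ W'' ⊆ W' ⊆ V` that are not separated by `F`. -/
def OpenCond (F : Set (Submodule k V)) (f : S ⟶ prodP k V) : Prop :=
  ∀ (W'' W' : NZ k V) (h : W''.1 ≤ W'.1), ¬ Separates F W''.1 W'.1 →
    ∀ x : S, ∃ U : S.Opens, x ∈ U ∧ E f W' U ⊔ LinearMap.range (incl f h U) = ⊤

variable (k V)

/-- The ideal of `B_V`, the largest closed subscheme of `∏ P_W` on which the incidence condition holds (that is,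
the one with the smallest ideal sheaf). -/
def B.ideal : (prodP k V).IdealSheafData :=
  sInf {I | Incidence I.subschemeι}

/-- The closed subscheme `B_V` of `∏ P_W`. -/
def B : Scheme.{u} := (B.ideal k V).subscheme

/-- The closed immersion of `B_V` into `∏ P_W`. -/
def B.ι : B k V ⟶ prodP k V := (B.ideal k V).subschemeι

/-- The structure morphism of `B_V`. -/
def B.str : B k V ⟶ Spec (.of k) := B.ι k V ≫ prodP.str k V

variable {k V}

/-- The ideal of `B_F`, the largest closed subscheme of `B_V` on which the closed condition for `F` holds. -/
def BF.ideal (F : Set (Submodule k V)) : (B k V).IdealSheafData :=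
  sInf {I | ClosedCond F (I.subschemeι ≫ B.ι k V)}

/-- The closed subscheme `B_F` of `B_V`. -/
def BF (F : Set (Submodule k V)) : Scheme.{u} := (BF.ideal F).subscheme

/-- The closed immersion of `B_F` into `B_V`. -/
def BF.ι (F : Set (Submodule k V)) : BF F ⟶ B k V := (BF.ideal F).subschemeι

/-- `U_F`: the largest open subscheme of `B_V` on which the open condition for `F` holds. -/
def UF (F : Set (Submodule k V)) : (B k V).Opens :=
  sSup {U | OpenCond F (U.ι ≫ B.ι k V)}

/-- The set of points of the stratum `Ω_F = B_F ∩ U_F`. -/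
def stratum (F : Set (Submodule k V)) : Set (B k V) :=
  Set.range (BF.ι F) ∩ UF F

variable (k V)

/-- The trivial flag `{0, V}`. -/
def trivialFlag : Set (Submodule k V) := {⊥, ⊤}

/-- The morphism `B_V ⟶ P_V` that sends `E_•` to `E_V`. -/
def B.toP [Nontrivial V] : B k V ⟶ P k V :=
  B.ι k V ≫ prodP.π k V ⟨⊤, top_ne_bot⟩ ≫ P.map Submodule.topEquiv.symm

end Moduli

section Geometry
variable {k} {X Y : Scheme.{u}}

/-- `X` is projective over `k`: it has a closed immersion into some `ℙⁿ` over `k`. -/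
def IsProjectiveOver (s : X ⟶ Spec (.of k)) : Prop :=
  ∃ (n : ℕ) (i : X ⟶ P k (Fin (n + 1) → k)), IsClosedImmersion i ∧ i ≫ P.str k _ = s

/-- The closed subset `Z` of the `k`-scheme `X`, with its reduced structure, is a normal crossings
divisor: Zariski locally on `X` there is an étale morphism to an affine space over `k` such that
`Z` is the inverse image of the union of some of the coordinate hyperplanes. -/
def IsNormalCrossingsDivisor (s : X ⟶ Spec (.of k)) (Z : Set X) : Prop :=
  IsClosed Z ∧ ∀ x : X, ∃ U : X.Opens, x ∈ U ∧
    ∃ (n : Type u) (_ : Finite n) (φ : U.toScheme ⟶ 𝔸(n; Spec (.of k))) (I : Set n),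
      Etale φ ∧ φ ≫ (𝔸(n; Spec (.of k)) ↘ Spec (.of k)) = U.ι ≫ s ∧
      ∀ y : U.toScheme, U.ι y ∈ Z ↔
        ∃ i ∈ I, φ y ∉ (𝔸(n; Spec (.of k))).basicOpen (AffineSpace.coord (Spec (.of k)) i)

/-- `π : X ⟶ Y` is a desingularization of the `k`-scheme `Y`, where `s : X ⟶ Spec k` is the
structure morphism of `X`: `X` is smooth over `k`, and `π` is proper and birational. -/
def IsDesingularization (s : X ⟶ Spec (.of k)) (π : X ⟶ Y) : Prop :=
  Smooth s ∧ IsProper π ∧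
    ∃ U : Y.Opens, Dense (U : Set Y) ∧ Dense (π ⁻¹ᵁ U : Set X) ∧ IsIso (π ∣_ U)

end Geometry

end BV

end

/-!
The proof covers `B_V` by explicit affine charts. A basis `b 0, …, b n` of `V` has a complete flag,
whose step `i` is spanned by the `b j` with `j ≥ i`, and every non-zero vector has a leading index.
The *chart ring* of `b` is the subring of `K_V` generated by all `v / w` for which the leading index
of `w` is at most that of `v`. It is the localization of the polynomial ring in the ratios
`b (l + 1) / b l` at finitely many polynomials (`isLocalization_chartRing`), so it is smooth, and it
has a universal property (`exists_chartRing_hom`): it classifies compatible systems of linear forms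
on the steps of the flag that are invertible on all vectors with the right leading index.

A tuple `E_•` is given locally by linear forms on the subspaces `W`, normalized at a vector of `W`.
In these terms `E_{W''} ⊆ E_{W'}` says that the form on `W'` restricts to a multiple of the form
on `W''` (`incidence_iff`), the closed condition says that it restricts to zero
(`closedCond_iff`), and the open condition says that at no point it restricts to zero
(`openCond_iff`). So the spectrum of the chart ring represents the incident tuples for which each
form is invertible on the vectors of `W` of minimal leading index (`exists_comp_chartMap`,
`mono_chartMap`). At a point of an incident tuple, the subspaces `N W ⊊ W` on which the forms vanish
satisfy `N W = N W' ⊓ W` for `W ≤ W'` with `¬ W ≤ N W'` (`vanishing_eq_inf`); a basis that is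
adapted to a complete flag refining `N` gives a chart containing the point
(`exists_mem_chartLocus`). A general lemma (`exists_lift_sInf_iff`) then shows that the largest
closed subscheme with the incidence condition represents it, and that the charts are open in it;
the same lemma applies to `B_F`. The flag of the stratum of a point consists of all `W` with
`W ≤ N W'` for all `W' > W` (`existsUnique_stratum`).

The ring `RS_{V,0}` is the localization of each chart ring at the product of its coordinates, which
is `b n / b 0` (`isLocalization_RSZero`). Hence `Ω_V` is open and dense in `B_V`, the scheme `B_V` is
integral, and the complement of `Ω_V` is given in each chart by coordinate hyperplanes.

Morphisms from `B_V` to a separated scheme can be glued from morphisms on the charts that agree on the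
dense `Ω_V` (`chart_overlap_ext`). The morphism to `Q_V` is given on the chart of `b` by
`1 / v ↦ b n / v`, and the inverse image of `Ω_V` under it is `Ω_V` (`B.toQ_preimage`). The
restriction of the Segre embedding of `∏ P_W` is obtained in the same way; it is proper and a
monomorphism, and therefore a closed immersion in a projective space (`isProjectiveOver_B`).
-/

noncomputable section
namespace BV
set_option linter.unusedSectionVars false

/-! ### Fractions of degree zero on the charts of `P_V` -/

section Coord
variable {k V : Type u} [Field k] [AddCommGroup V] [Module k V]

lemma fracAway_self (v₀ : V) : fracAway k V v₀ v₀ = 1 := by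
  apply HomogeneousLocalization.val_injective
  rw [fracAway, HomogeneousLocalization.Away.val_mk, HomogeneousLocalization.val_one]
  rw [Localization.mk_eq_mk', IsLocalization.mk'_eq_iff_eq_mul]
  simp

lemma P.frac_self (v₀ : V) : P.frac k V v₀ v₀ = 1 := by
  rw [P.frac, fracAway_self]
  exact map_one (Proj.awayToSection (symGrading k V) (SymmetricAlgebra.ι k V v₀)).hom

lemma P.chart_zero : P.chart k V 0 = ⊥ := by
  rw [P.chart, map_zero, Proj.basicOpen_zero]

lemma awayMap_fracAway (v₀ v₁ v : V) :
    HomogeneousLocalization.awayMap (symGrading k V) (ι_mem k V v₁) rfl (fracAway k V v₀ v) =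
    HomogeneousLocalization.awayMap (symGrading k V) (ι_mem k V v₁) rfl (fracAway k V v₀ v₁) *
    HomogeneousLocalization.awayMap (symGrading k V) (ι_mem k V v₀) (mul_comm _ _)
      (fracAway k V v₁ v) := by
  apply HomogeneousLocalization.val_injective
  rw [HomogeneousLocalization.val_mul]
  simp only [fracAway, HomogeneousLocalization.awayMap_mk,
    HomogeneousLocalization.Away.val_mk, Localization.mk_mul]
  rw [Localization.mk_eq_mk_iff, Localization.r_iff_exists]
  refine ⟨1, ?_⟩
  simp
  ring

/-- Change of charts: `v / v₀ = (v₁ / v₀) (v / v₁)`. -/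
lemma P.frac_res (v₀ v₁ v : V) (U : (P k V).Opens) (h₀ : U ≤ P.chart k V v₀)
    (h₁ : U ≤ P.chart k V v₁) :
    ((P k V).presheaf.map (homOfLE h₀).op).hom (P.frac k V v₀ v) =
    ((P k V).presheaf.map (homOfLE h₀).op).hom (P.frac k V v₀ v₁) *
    ((P k V).presheaf.map (homOfLE h₁).op).hom (P.frac k V v₁ v) := by
  have e : U ≤ Proj.basicOpen (symGrading k V)
      (SymmetricAlgebra.ι k V v₀ * SymmetricAlgebra.ι k V v₁) := by
    rw [Proj.basicOpen_mul]; exact le_inf h₀ h₁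
  have key : ∀ (a b w : V) (ha : U ≤ P.chart k V a)
      (hx : SymmetricAlgebra.ι k V v₀ * SymmetricAlgebra.ι k V v₁ =
        SymmetricAlgebra.ι k V a * SymmetricAlgebra.ι k V b),
      ((P k V).presheaf.map (homOfLE ha).op).hom (P.frac k V a w) =
      ((P k V).presheaf.map (homOfLE e).op).hom ((Proj.awayToSection (symGrading k V) _).hom
        (HomogeneousLocalization.awayMap (symGrading k V) (ι_mem k V b) hx
          (fracAway k V a w))) := by
    intro a b w ha hx
    have := Proj.awayMap_awayToSection (symGrading k V) (ι_mem k V b) hx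
    have h2 := congrArg (fun φ => ((P k V).presheaf.map (homOfLE e).op).hom
      (φ.hom (fracAway k V a w))) this
    simp only [CommRingCat.hom_comp, RingHom.comp_apply, CommRingCat.hom_ofHom] at h2
    rw [h2, ← CommRingCat.comp_apply, ← Functor.map_comp]
    rfl
  rw [key v₀ v₁ v h₀ rfl, key v₀ v₁ v₁ h₀ rfl, key v₁ v₀ v h₁ (mul_comm _ _), awayMap_fracAway,
    map_mul, map_mul]

section Away
variable {A : Type u} [CommRing A] [Algebra k A] (𝒜 : ℕ → Submodule k A) [GradedAlgebra 𝒜]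

lemma awayι_appLE {f : A} {m : ℕ} (hf : f ∈ 𝒜 m) (hm : 0 < m)
    (e : ⊤ ≤ Proj.awayι 𝒜 f hf hm ⁻¹ᵁ Proj.basicOpen 𝒜 f) :
    Proj.awayToSection 𝒜 f ≫ (Proj.awayι 𝒜 f hf hm).appLE (Proj.basicOpen 𝒜 f) ⊤ e =
      (Scheme.ΓSpecIso _).inv := by
  have h1 : Proj.basicOpenToSpec 𝒜 f ≫ Proj.awayι 𝒜 f hf hm = (Proj.basicOpen 𝒜 f).ι := by
    rw [← Proj.basicOpenIsoSpec_hom 𝒜 f hf hm, Proj.awayι, Iso.hom_inv_id_assoc]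
  have h2 := Proj.basicOpenToSpec_app_top 𝒜 f
  have : IsIso (Proj.basicOpenToSpec 𝒜 f) := by
    rw [← Proj.basicOpenIsoSpec_hom 𝒜 f hf hm]; infer_instance
  have h4 : Proj.awayToSection 𝒜 f ≫ (Proj.awayι 𝒜 f hf hm).appLE (Proj.basicOpen 𝒜 f) ⊤ e ≫
      (Proj.basicOpenToSpec 𝒜 f).app ⊤ = Proj.awayToSection 𝒜 f ≫
        (Proj.basicOpen 𝒜 f).topIso.inv := by
    congr 1
    rw [Scheme.Hom.app_eq_appLE, Scheme.Hom.appLE_comp_appLE]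
    have h3 : (Proj.basicOpenToSpec 𝒜 f ≫ Proj.awayι 𝒜 f hf hm).appLE (Proj.basicOpen 𝒜 f) ⊤
        (by rw [h1]; simp) = (Proj.basicOpen 𝒜 f).ι.appLE (Proj.basicOpen 𝒜 f) ⊤ (by simp) := by
      congr 1
    refine h3.trans ?_
    simp only [Scheme.Hom.appLE, Scheme.Opens.ι_app, Scheme.Opens.topIso_inv,
        eqToHom_op]
    erw [← Functor.map_comp]
    rfl
  rw [← cancel_mono ((Proj.basicOpenToSpec 𝒜 f).app ⊤), Category.assoc, h4, h2]
  exact (Iso.inv_hom_id_assoc _ _).symm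

end Away

lemma P.basicOpen_frac (v₀ v : V) :
    (P k V).basicOpen (P.frac k V v₀ v) = P.chart k V v₀ ⊓ P.chart k V v := by
  have hr : (Proj.awayι (symGrading k V) _ (ι_mem k V v₀) one_pos).opensRange =
      P.chart k V v₀ := Proj.opensRange_awayι (symGrading k V) _ (ι_mem k V v₀) one_pos
  have e : ⊤ ≤ Proj.awayι (symGrading k V) _ (ι_mem k V v₀) one_pos ⁻¹ᵁ P.chart k V v₀ := by
    rw [← hr]; simp
  have h1 : Proj.awayι (symGrading k V) _ (ι_mem k V v₀) one_pos ⁻¹ᵁ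
      (P k V).basicOpen (P.frac k V v₀ v) = Proj.awayι (symGrading k V) _ (ι_mem k V v₀) one_pos ⁻¹ᵁ
        P.chart k V v := by
    rw [Proj.awayι_preimage_basicOpen (symGrading k V) (ι_mem k V v₀) one_pos
      (ι_mem k V v) one_pos]
    have h2 := congrArg (fun φ => φ.hom (fracAway k V v₀ v))
      (awayι_appLE (symGrading k V) (ι_mem k V v₀) one_pos e)
    simp only [CommRingCat.hom_comp, RingHom.comp_apply] at h2
    have h3 := Scheme.basicOpen_appLE (Proj.awayι (symGrading k V) _ (ι_mem k V v₀) one_pos)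
      ⊤ (P.chart k V v₀) e (P.frac k V v₀ v)
    rw [top_inf_eq] at h3
    rw [← h3, P.frac, h2]
    have h4 : fracAway k V v₀ v = HomogeneousLocalization.Away.isLocalizationElem (ι_mem k V v₀)
      (ι_mem k V v) := by
      apply HomogeneousLocalization.val_injective
      simp [fracAway]
    rw [h4]
    exact basicOpen_eq_of_affine _
  have h5 : ∀ x ∈ P.chart k V v₀, (x ∈ (P k V).basicOpen (P.frac k V v₀ v) ↔ x ∈ P.chart k V v) := by
    intro x hx
    rw [← hr] at hx
    obtain ⟨y, rfl⟩ := hx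
    exact Iff.of_eq (congrArg (y ∈ ·) h1)
  ext x
  exact ⟨fun hx => ⟨(P k V).basicOpen_le _ hx, (h5 x ((P k V).basicOpen_le _ hx)).mp hx⟩,
    fun hx => (h5 x hx.1).mpr hx.2⟩

/-- The standard charts cover `P_V`: the vectors generate the irrelevant ideal. -/
lemma P.iSup_chart (x : P k V) : ∃ v : V, x ∈ P.chart k V v := by
  by_contra! H
  simp only [Proj.mem_basicOpen, not_not] at H
  apply x.not_irrelevant_le
  rw [HomogeneousIdeal.irrelevant_le]
  intro i hi a ha
  obtain ⟨i, rfl⟩ := Nat.exists_eq_succ_of_ne_zero hi.ne'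
  replace ha : a ∈ LinearMap.range (SymmetricAlgebra.ι k V) ^ (i + 1) := ha
  rw [pow_succ'] at ha
  induction ha using Submodule.mul_induction_on' with
  | mem_mul_mem m hm n hn =>
    obtain ⟨v, rfl⟩ := hm
    exact Ideal.mul_mem_right _ _ (H v)
  | add a _ b _ ha hb => exact Ideal.add_mem _ ha hb

end Coord

/-! ### Coordinates of morphisms to `P_V` -/

section Coord
variable {k V : Type u} [Field k] [AddCommGroup V] [Module k V]

lemma hom_ext_of_locally {X Y : Scheme.{u}} {f g : X ⟶ Y}
    (h : ∀ x : X, ∃ U : X.Opens, x ∈ U ∧ U.ι ≫ f = U.ι ≫ g) : f = g := by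
  choose U hx hU using h
  refine (X.openCoverOfIsOpenCover U ?_).hom_ext _ _ hU
  exact top_le_iff.mp fun x _ => TopologicalSpace.Opens.mem_iSup.mpr ⟨x, hx x⟩

lemma section_ext_of_locally {X : Scheme.{u}} {W : X.Opens} {a b : Γ(X, W)}
    (h : ∀ x ∈ W, ∃ (U : X.Opens) (e : U ≤ W), x ∈ U ∧
      (X.presheaf.map (homOfLE e).op).hom a = (X.presheaf.map (homOfLE e).op).hom b) : a = b := by
  choose U e hx hU using h
  refine X.IsSheaf.section_ext fun x hxW => ⟨U x hxW, e x hxW, hx x hxW, hU x hxW⟩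

/-- The function `g^*(v / v₀)` on an open subset of the inverse image of the chart of `v₀`,
without the `k`-linear structure of `coordSection`. -/
def coord {S : Scheme.{u}} (g : S ⟶ P k V) (v₀ : V) {U : S.Opens} (e : U ≤ g ⁻¹ᵁ P.chart k V v₀)
    (v : V) : Γ(S, U) :=
  (g.appLE (P.chart k V v₀) U e).hom (P.frac k V v₀ v)

section
variable {S T : Scheme.{u}} (g : S ⟶ P k V) (v₀ v₁ v : V) {U : S.Opens}
  (e : U ≤ g ⁻¹ᵁ P.chart k V v₀)

lemma coord_self : coord g v₀ e v₀ = 1 := by rw [coord, P.frac_self, map_one]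

lemma coord_res {U' : S.Opens} (h : U' ≤ U) :
    (S.presheaf.map (homOfLE h).op).hom (coord g v₀ e v) = coord g v₀ (h.trans e) v := by
  rw [coord, ← CommRingCat.comp_apply, Scheme.Hom.appLE_map]
  rfl

lemma coord_comp (f : T ⟶ S) {U' : T.Opens} (h : U' ≤ f ⁻¹ᵁ U)
    (e' : U' ≤ (f ≫ g) ⁻¹ᵁ P.chart k V v₀) :
    (f.appLE U U' h).hom (coord g v₀ e v) = coord (f ≫ g) v₀ e' v := by
  rw [coord, ← CommRingCat.comp_apply, Scheme.Hom.appLE_comp_appLE]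
  rfl

/-- Change of charts in coordinates. -/
lemma coord_trans (e₁ : U ≤ g ⁻¹ᵁ P.chart k V v₁) :
    coord g v₀ e v = coord g v₀ e v₁ * coord g v₁ e₁ v := by
  have h := congrArg (g.appLE (P.chart k V v₀ ⊓ P.chart k V v₁) U (le_inf e e₁)).hom
    (P.frac_res v₀ v₁ v (P.chart k V v₀ ⊓ P.chart k V v₁) inf_le_left inf_le_right)
  rw [map_mul] at h
  have m : ∀ (a w : V) (ha : P.chart k V v₀ ⊓ P.chart k V v₁ ≤ P.chart k V a)
      (ea : U ≤ g ⁻¹ᵁ P.chart k V a),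
      (g.appLE (P.chart k V v₀ ⊓ P.chart k V v₁) U (le_inf e e₁)).hom
        (((P k V).presheaf.map (homOfLE ha).op).hom (P.frac k V a w)) = coord g a ea w :=
    fun a w ha ea => congrArg (fun φ => φ.hom (P.frac k V a w))
      (g.map_appLE (le_inf e e₁) (homOfLE ha).op)
  rwa [m v₀ v _ e, m v₀ v₁ _ e, m v₁ v _ e₁] at h

/-- The function `g^*(v / v₀)` is invertible exactly on the inverse image of the chart of `v`. -/
lemma basicOpen_coord : S.basicOpen (coord g v₀ e v) = U ⊓ g ⁻¹ᵁ P.chart k V v := by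
  rw [coord, Scheme.basicOpen_appLE, P.basicOpen_frac, Scheme.Hom.preimage_inf, ← inf_assoc,
    inf_eq_left.mpr e]

lemma isUnit_coord (e' : U ≤ g ⁻¹ᵁ P.chart k V v) : IsUnit (coord g v₀ e v) :=
  IsUnit.of_mul_eq_one _ ((coord_trans g v₀ v v₀ e e').symm.trans (coord_self g v₀ e))

end

/-- Ring homomorphisms from the coordinate ring of a standard chart of `P_V` are determined by
their values on scalars and on the fractions `v / v₀`. -/
lemma away_hom_ext (v₀ : V) {A : Type*} [CommRing A]
    {φ ψ : HomogeneousLocalization.Away (symGrading k V) (SymmetricAlgebra.ι k V v₀) →+* A}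
    (h1 : ∀ v, φ (fracAway k V v₀ v) = ψ (fracAway k V v₀ v))
    (h2 : ∀ c : k, φ (HomogeneousLocalization.fromZeroRingHom (symGrading k V) _
      (algebraMap k (symGrading k V 0) c)) = ψ (HomogeneousLocalization.fromZeroRingHom
        (symGrading k V) _ (algebraMap k (symGrading k V 0) c))) : φ = ψ := by
  have key : ∀ (n : ℕ) (a : SymmetricAlgebra k V) (ha : a ∈ LinearMap.range (SymmetricAlgebra.ι k V) ^ n),
      ∃ ha' : a ∈ symGrading k V (n • 1),
      φ (HomogeneousLocalization.Away.mk (symGrading k V) (ι_mem k V v₀) n a ha') =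
      ψ (HomogeneousLocalization.Away.mk (symGrading k V) (ι_mem k V v₀) n a ha') := by
    intro n a ha
    refine ⟨by simpa using ha, ?_⟩
    induction ha using Submodule.pow_induction_on_left' with
    | algebraMap r =>
      convert h2 r using 2 <;>
      · apply HomogeneousLocalization.val_injective
        rw [HomogeneousLocalization.Away.val_mk]
        change _ = Localization.mk _ _
        congr 1
        ext1
        exact pow_zero _
    | add x y i hx hy ihx ihy =>
      have hx' : x ∈ symGrading k V (i • 1) := by simpa using hx
      have hy' : y ∈ symGrading k V (i • 1) := by simpa using hy
      have : HomogeneousLocalization.Away.mk (symGrading k V) (ι_mem k V v₀) i (x + y)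
          (add_mem hx' hy') = HomogeneousLocalization.Away.mk (symGrading k V) (ι_mem k V v₀) i x hx' +
          HomogeneousLocalization.Away.mk (symGrading k V) (ι_mem k V v₀) i y hy' := by
        apply HomogeneousLocalization.val_injective
        simp only [HomogeneousLocalization.val_add, HomogeneousLocalization.Away.val_mk,
          Localization.add_mk_self]
      rw [this, map_add, map_add, ihx, ihy]
    | mem_mul m hm i x hx ih =>
      obtain ⟨v, rfl⟩ := hm
      have hx' : x ∈ symGrading k V (i • 1) := by simpa using hx
      have : HomogeneousLocalization.Away.mk (symGrading k V) (ι_mem k V v₀) (i + 1)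
          (SymmetricAlgebra.ι k V v * x) (by
            rw [smul_eq_mul, mul_one, add_comm]
            exact SetLike.mul_mem_graded (ι_mem k V v) (by simpa using hx)) = fracAway k V v₀ v *
          HomogeneousLocalization.Away.mk (symGrading k V) (ι_mem k V v₀) i x hx' := by
        apply HomogeneousLocalization.val_injective
        simp only [HomogeneousLocalization.val_mul, HomogeneousLocalization.Away.val_mk, fracAway,
          Localization.mk_mul]
        congr 1
        ext1
        simp [pow_succ']
      simp only [Nat.succ_eq_add_one]
      rw [this, map_mul, map_mul, ih, h1]
  ext x
  obtain ⟨n, a, ha, rfl⟩ := x.mk_surjective _ (ι_mem k V v₀)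
  exact (key n a (by simpa using ha)).2

lemma appLE_top_top {X Y : Scheme.{u}} (f : X ⟶ Y) (h : ⊤ ≤ f ⁻¹ᵁ ⊤) :
    f.appLE ⊤ ⊤ h = f.appTop := by
  simp [Scheme.Hom.appTop, Scheme.Hom.app_eq_appLE]

/-- The open immersion of the affine chart of `v₀` into `P_V`. -/
abbrev P.chartι (v₀ : V) : Spec (.of (HomogeneousLocalization.Away (symGrading k V)
    (SymmetricAlgebra.ι k V v₀))) ⟶ P k V :=
  Proj.awayι (symGrading k V) _ (ι_mem k V v₀) one_pos

lemma P.opensRange_chartι (v₀ : V) : (P.chartι (k := k) v₀).opensRange = P.chart k V v₀ :=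
  Proj.opensRange_awayι (symGrading k V) _ (ι_mem k V v₀) one_pos

lemma P.preimage_chartι (v₀ : V) : P.chartι (k := k) v₀ ⁻¹ᵁ P.chart k V v₀ = ⊤ := by
  rw [← P.opensRange_chartι]; simp

lemma P.chartι_str (v₀ : V) : P.chartι v₀ ≫ P.str k V = Spec.map
    (CommRingCat.ofHom (algebraMap k (symGrading k V 0)) ≫
      CommRingCat.ofHom (HomogeneousLocalization.fromZeroRingHom (symGrading k V) _)) := by
  rw [P.str, Proj.awayι_toSpecZero_assoc, ← Spec.map_comp]

lemma P.coord_comp_chartι {S : Scheme.{u}} (v₀ v : V) (δ : S ⟶ _)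
    (e : ⊤ ≤ (δ ≫ P.chartι (k := k) v₀) ⁻¹ᵁ P.chart k V v₀) :
    coord (δ ≫ P.chartι v₀) v₀ e v =
      δ.appTop.hom ((Scheme.ΓSpecIso _).inv.hom (fracAway k V v₀ v)) := by
  have h0 := congrArg (fun φ => φ.hom (fracAway k V v₀ v))
    (awayι_appLE (symGrading k V) (ι_mem k V v₀) one_pos (P.preimage_chartι v₀).ge)
  rw [← coord_comp (P.chartι v₀) v₀ v (P.preimage_chartι v₀).ge δ le_top e]
  refine (congrArg (fun φ => φ.hom (coord (P.chartι (k := k) v₀) v₀ (P.preimage_chartι v₀).ge v))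
    (appLE_top_top δ le_top)).trans ?_
  exact congrArg δ.appTop.hom h0

/-- Two morphisms over `k` into the chart of `v₀` agree if their coordinates agree. -/
lemma P.hom_ext_of_coord {S : Scheme.{u}} {g g' : S ⟶ P k V} (hs : g ≫ P.str k V = g' ≫ P.str k V)
    (v₀ : V) (e : ⊤ ≤ g ⁻¹ᵁ P.chart k V v₀) (e' : ⊤ ≤ g' ⁻¹ᵁ P.chart k V v₀)
    (h : ∀ v, coord g v₀ e v = coord g' v₀ e' v) : g = g' := by
  have lift : ∀ f : S ⟶ P k V, ⊤ ≤ f ⁻¹ᵁ P.chart k V v₀ → ∃ γ, γ ≫ P.chartι v₀ = f := by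
    intro f hf
    have : Set.range f ⊆ Set.range (P.chartι (k := k) v₀) := by
      rintro _ ⟨x, rfl⟩
      have : f x ∈ (P.chartι (k := k) v₀).opensRange := by
        rw [P.opensRange_chartι]; exact hf trivial
      exact this
    exact ⟨IsOpenImmersion.lift _ f this, IsOpenImmersion.lift_fac _ _ _⟩
  obtain ⟨γ, rfl⟩ := lift g e
  obtain ⟨γ', rfl⟩ := lift g' e'
  congr 1
  rw [Category.assoc, Category.assoc, P.chartι_str] at hs
  apply ext_of_isAffine
  rw [← cancel_epi (Scheme.ΓSpecIso _).inv]
  ext1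
  apply away_hom_ext v₀
  · intro v
    have := h v
    rw [P.coord_comp_chartι, P.coord_comp_chartι] at this
    exact this
  · intro c
    have h3 := congrArg (fun φ => (Scheme.ΓSpecIso (.of k)).inv ≫ φ.appTop) hs
    have nat := fun δ : S ⟶ Spec (.of (HomogeneousLocalization.Away (symGrading k V)
        (SymmetricAlgebra.ι k V v₀))) => Scheme.ΓSpecIso_inv_naturality_assoc
      (CommRingCat.ofHom (algebraMap k (symGrading k V 0)) ≫
        CommRingCat.ofHom (HomogeneousLocalization.fromZeroRingHom (symGrading k V) _)) δ.appTop
    exact congrArg (fun φ => φ.hom c) ((nat γ).trans (h3.trans (nat γ').symm))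

section ofLinear
variable {A : Type u} [CommRing A] [Algebra k A] (l : V →ₗ[k] A) (v₀ : V) (h : l v₀ = 1)

/-- The homomorphism from the coordinate ring of the chart of `v₀` with `v / v₀ ↦ l v`, for a linear
map `l` with `l v₀ = 1`. -/
def awayHomOfLinear : HomogeneousLocalization.Away (symGrading k V) (SymmetricAlgebra.ι k V v₀) →+* A :=
  (IsLocalization.Away.lift (S := Localization.Away (SymmetricAlgebra.ι k V v₀))
    (SymmetricAlgebra.ι k V v₀) (g := (SymmetricAlgebra.lift l : SymmetricAlgebra k V →ₐ[k] A).toRingHom)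
    (by simp [h])).comp
    (algebraMap (HomogeneousLocalization.Away (symGrading k V) (SymmetricAlgebra.ι k V v₀)) _)

lemma awayHomOfLinear_apply (x : HomogeneousLocalization.Away (symGrading k V)
    (SymmetricAlgebra.ι k V v₀)) (a : SymmetricAlgebra k V)
    (n : Submonoid.powers (SymmetricAlgebra.ι k V v₀)) (hx : x.val = Localization.mk a n) :
    awayHomOfLinear l v₀ h x = SymmetricAlgebra.lift l a := by
  have h1 : x.val * algebraMap _ (Localization.Away (SymmetricAlgebra.ι k V v₀)) (n : SymmetricAlgebra k V) =
      algebraMap _ _ a := by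
    rw [hx, Localization.mk_eq_mk']
    exact IsLocalization.mk'_spec (M := Submonoid.powers (SymmetricAlgebra.ι k V v₀)) _ a n
  have h2 := congrArg (IsLocalization.Away.lift (S := Localization.Away (SymmetricAlgebra.ι k V v₀))
    (SymmetricAlgebra.ι k V v₀) (g := (SymmetricAlgebra.lift l : SymmetricAlgebra k V →ₐ[k] A).toRingHom)
    (by simp [h])) h1
  rw [map_mul, IsLocalization.Away.lift_eq, IsLocalization.Away.lift_eq] at h2
  obtain ⟨_, m, rfl⟩ := n
  refine Eq.trans ?_ h2
  simp only [map_pow, AlgHom.toRingHom_eq_coe, RingHom.coe_coe, SymmetricAlgebra.lift_ι_apply, h,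
    one_pow, mul_one]
  rfl

lemma awayHomOfLinear_frac (v : V) : awayHomOfLinear l v₀ h (fracAway k V v₀ v) = l v := by
  refine (awayHomOfLinear_apply l v₀ h _ _ _ (HomogeneousLocalization.Away.val_mk ..)).trans ?_
  simp

lemma awayHomOfLinear_algebraMap (c : k) : awayHomOfLinear l v₀ h
    (HomogeneousLocalization.fromZeroRingHom (symGrading k V) _
      (algebraMap k (symGrading k V 0) c)) = algebraMap k A c := by
  rw [awayHomOfLinear_apply l v₀ h _ (algebraMap k (SymmetricAlgebra k V) c) 1 rfl]
  simp

/-- The `A`-valued point of `P_V` given by a linear map `l : V → A` with `l v₀ = 1`. -/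
def P.ofLinear : Spec (.of A) ⟶ P k V :=
  Spec.map (CommRingCat.ofHom (awayHomOfLinear l v₀ h)) ≫ P.chartι v₀

lemma P.ofLinear_str : P.ofLinear l v₀ h ≫ P.str k V =
    Spec.map (CommRingCat.ofHom (algebraMap k A)) := by
  rw [P.ofLinear, Category.assoc, P.chartι_str, ← Spec.map_comp]
  congr 1
  ext c
  exact awayHomOfLinear_algebraMap l v₀ h c

lemma P.ofLinear_preimage : P.ofLinear l v₀ h ⁻¹ᵁ P.chart k V v₀ = ⊤ := by
  rw [P.ofLinear, Scheme.Hom.comp_preimage, P.preimage_chartι]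
  simp

lemma P.coord_ofLinear (v : V) (e : ⊤ ≤ P.ofLinear l v₀ h ⁻¹ᵁ P.chart k V v₀) :
    coord (P.ofLinear l v₀ h) v₀ e v = (Scheme.ΓSpecIso (.of A)).inv.hom (l v) := by
  rw [← awayHomOfLinear_frac l v₀ h v]
  refine (P.coord_comp_chartι v₀ v _ e).trans ?_
  exact (congrArg (fun φ => φ.hom (fracAway k V v₀ v))
    (Scheme.ΓSpecIso_inv_naturality (CommRingCat.ofHom (awayHomOfLinear l v₀ h)))).symm

end ofLinear

end Coord

/-! ### The incidence, closed and open conditions in coordinates -/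

section Conditions
variable {k V : Type u} [Field k] [AddCommGroup V] [Module k V]

section
variable {S : Scheme.{u}} (s : S ⟶ Spec (.of k)) (g : S ⟶ P k V) (h : g ≫ P.str k V = s)

lemma map_map_apply (S : Scheme.{u}) {U U' U'' : S.Opens} (h : U' ≤ U) (h' : U'' ≤ U') (a : Γ(S, U)) :
    (S.presheaf.map (homOfLE h').op).hom ((S.presheaf.map (homOfLE h).op).hom a) =
      (S.presheaf.map (homOfLE (h'.trans h)).op).hom a := by
  rw [← CommRingCat.comp_apply, ← Functor.map_comp]
  rfl

lemma map_self_apply (S : Scheme.{u}) {U : S.Opens} (h : U ≤ U) (a : Γ(S, U)) :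
    (S.presheaf.map (homOfLE h).op).hom a = a := by
  have : (homOfLE h).op = 𝟙 _ := rfl
  rw [this, S.presheaf.map_id]
  rfl

/-- The identity map from sections of the structure sheaf to the type synonym `Sec`. -/
def Sec.mk {U : S.Opens} (a : Γ(S, U)) : Sec s U := a

lemma Sec.exists_mk {U : S.Opens} (a : Sec s U) : ∃ b, Sec.mk s b = a := ⟨a, rfl⟩

/-- The map `O_S(U) ⊗ V → L(U')` from sections of `O_S ⊗ V` to sections of the invertible
sheaf `L = g^* O(1)`, trivialized by `v₀` on `U'`. -/
def ev {U : S.Opens} (v₀ : V) {U' : S.Opens} (h₁ : U' ≤ U) (h₂ : U' ≤ g ⁻¹ᵁ P.chart k V v₀) :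
    Sec s U ⊗[k] V →+ Γ(S, U') :=
  (S.presheaf.map (homOfLE (le_inf h₁ h₂)).op).hom.toAddMonoidHom.comp
    (evalAt s g h U v₀).toAddMonoidHom

lemma ev_tmul {U : S.Opens} (v₀ : V) {U' : S.Opens} (h₁ : U' ≤ U)
    (h₂ : U' ≤ g ⁻¹ᵁ P.chart k V v₀) (a : Γ(S, U)) (v : V) :
    ev s g h v₀ h₁ h₂ (Sec.mk s a ⊗ₜ v) =
      (S.presheaf.map (homOfLE h₁).op).hom a * coord g v₀ h₂ v := by
  have h3 : ev s g h v₀ h₁ h₂ (Sec.mk s a ⊗ₜ v) =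
    (S.presheaf.map (homOfLE (le_inf h₁ h₂)).op).hom
      ((S.presheaf.map (homOfLE inf_le_left).op).hom a *
      coord g v₀ (U := U ⊓ g ⁻¹ᵁ P.chart k V v₀) inf_le_right v) := rfl
  rw [h3, map_mul, map_map_apply, coord_res]

lemma map_ev {U : S.Opens} (v₀ : V) {U' U'' : S.Opens} (h₁ : U' ≤ U)
    (h₂ : U' ≤ g ⁻¹ᵁ P.chart k V v₀) (h₃ : U'' ≤ U') (t : Sec s U ⊗[k] V) :
    (S.presheaf.map (homOfLE h₃).op).hom (ev s g h v₀ h₁ h₂ t) =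
      ev s g h v₀ (h₃.trans h₁) (h₃.trans h₂) t :=
  map_map_apply S _ _ _

lemma mem_kernelSheaf {U : S.Opens} {t : Sec s U ⊗[k] V} :
    t ∈ kernelSheaf s g h U ↔ ∀ (v₀ : V) (U' : S.Opens) (h₁ : U' ≤ U)
      (h₂ : U' ≤ g ⁻¹ᵁ P.chart k V v₀), ev s g h v₀ h₁ h₂ t = 0 := by
  simp only [kernelSheaf, Submodule.mem_iInf, LinearMap.mem_ker]
  constructor
  · intro H v₀ U' h₁ h₂
    exact (congrArg (S.presheaf.map (homOfLE (le_inf h₁ h₂)).op).hom (H v₀)).trans (map_zero _)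
  · intro H v₀
    have := H v₀ (U ⊓ g ⁻¹ᵁ P.chart k V v₀) inf_le_left inf_le_right
    exact (map_self_apply S _ _).symm.trans this

/-- On the chart of `v₀` the kernel `E` contains `a ⊗ v - a (v / v₀) ⊗ v₀`. -/
lemma tmul_sub_mem_kernelSheaf {U : S.Opens} (v₀ : V) (e : U ≤ g ⁻¹ᵁ P.chart k V v₀)
    (a : Γ(S, U)) (v : V) :
    Sec.mk s a ⊗ₜ v - Sec.mk s (a * coord g v₀ e v) ⊗ₜ v₀ ∈ kernelSheaf s g h U := by
  rw [mem_kernelSheaf]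
  intro v₁ U' h₁ h₂
  rw [map_sub, ev_tmul, ev_tmul, sub_eq_zero, map_mul, coord_res, mul_assoc,
    mul_comm (coord g v₀ _ v), ← coord_trans]

end

variable [Finite k] [Module.Finite k V]
variable {S : Scheme.{u}} (f : S ⟶ prodP k V)

/-- The component of a point of `∏ P_W` in `P_W`. -/
abbrev comp (W : NZ k V) : S ⟶ P k W.1 := f ≫ prodP.π k V W

lemma comp_str (W : NZ k V) : comp f W ≫ P.str k W.1 = strOf f := by
  rw [Category.assoc, prodP.π_str]

/-- The locus where the component in `P_W` lies in the chart of `w`. -/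
abbrev locus (W : NZ k V) (w : W.1) : S.Opens := comp f W ⁻¹ᵁ P.chart k W.1 w

variable {f} in
lemma mem_E {W : NZ k V} {U : S.Opens} {t : Sec (strOf f) U ⊗[k] W.1} :
    t ∈ E f W U ↔ ∀ (w₀ : W.1) (U' : S.Opens) (h₁ : U' ≤ U) (h₂ : U' ≤ locus f W w₀),
      ev (strOf f) (comp f W) (comp_str f W) w₀ h₁ h₂ t = 0 :=
  mem_kernelSheaf _ _ _

/-- The incidence condition in coordinates: where the components in `P_{W'}` and `P_{W''}` are
given by linear forms normalized at `w'` and `w''`, the first restricts to a multiple of the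
second. -/
lemma incidence_iff : Incidence f ↔ ∀ (W'' W' : NZ k V) (h : W''.1 ≤ W'.1) (w' : W'.1) (w'' v : W''.1)
    (U : S.Opens) (e' : U ≤ locus f W' w') (e'' : U ≤ locus f W'' w''),
    coord (comp f W') w' e' (Submodule.inclusion h v) =
      coord (comp f W') w' e' (Submodule.inclusion h w'') * coord (comp f W'') w'' e'' v := by
  constructor
  · intro H W'' W' h w' w'' v U e' e''
    have h1 := tmul_sub_mem_kernelSheaf (strOf f) (comp f W'') (comp_str f W'') w'' e'' 1 v
    have h2 := mem_E.mp (H W'' W' h U (Submodule.mem_map_of_mem h1)) w' U le_rfl e'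
    rwa [map_sub, map_sub, sub_eq_zero, LinearMap.lTensor_tmul, LinearMap.lTensor_tmul,
      ev_tmul, ev_tmul, map_self_apply, map_self_apply, one_mul, one_mul, mul_comm] at h2
  · intro H W'' W' h U
    rintro _ ⟨t, ht, rfl⟩
    rw [mem_E]
    intro w' U' h₁ h₂
    refine section_ext_of_locally fun x hx => ?_
    obtain ⟨w'', hw''⟩ := P.iSup_chart (comp f W'' x)
    let U₂ : S.Opens := U' ⊓ locus f W'' w''
    refine ⟨U₂, inf_le_left, ⟨hx, hw''⟩, ?_⟩
    have key : ∀ t : Sec (strOf f) U ⊗[k] W''.1,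
        ev (strOf f) (comp f W') (comp_str f W') w' (U' := U₂) (inf_le_left.trans h₁)
          (inf_le_left.trans h₂) (incl f h U t) =
        coord (comp f W') w' (U := U₂) (inf_le_left.trans h₂) (Submodule.inclusion h w'') *
          ev (strOf f) (comp f W'') (comp_str f W'') w'' (inf_le_left.trans h₁) inf_le_right t := by
      intro t
      induction t with
      | zero => simp only [map_zero, mul_zero]
      | tmul a v =>
        obtain ⟨a, rfl⟩ := Sec.exists_mk _ a
        rw [LinearMap.lTensor_tmul, ev_tmul, ev_tmul,
          H W'' W' h w' w'' v U₂ (inf_le_left.trans h₂) inf_le_right]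
        ring
      | add a b ha hb => rw [map_add, map_add, map_add, ha, hb, mul_add]
    rw [map_ev, map_zero]
    rw [key t, mem_E.mp ht w'', mul_zero]

lemma closedCond_iff (F : Set (Submodule k V)) : ClosedCond F f ↔
    ∀ (W'' W' : NZ k V) (h : W''.1 ≤ W'.1), Separates F W''.1 W'.1 → ∀ (w' : W'.1) (v : W''.1)
      (U : S.Opens) (e' : U ≤ locus f W' w'),
      coord (comp f W') w' e' (Submodule.inclusion h v) = 0 := by
  constructor
  · intro H W'' W' h hs w' v U e'
    have h2 := mem_E.mp (H W'' W' h hs U ⟨Sec.mk _ 1 ⊗ₜ v, rfl⟩) w' U le_rfl e'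
    rwa [LinearMap.lTensor_tmul, ev_tmul, map_one, one_mul] at h2
  · intro H W'' W' h hs U
    rintro _ ⟨t, rfl⟩
    rw [mem_E]
    intro w' U' h₁ h₂
    induction t with
    | zero => rw [map_zero, map_zero]
    | tmul a v =>
      obtain ⟨a, rfl⟩ := Sec.exists_mk _ a
      rw [LinearMap.lTensor_tmul, ev_tmul, H W'' W' h hs, mul_zero]
    | add a b ha hb => rw [map_add, map_add, ha, hb, add_zero]

/-- The open condition is a condition on points: a linear form on `W'` restricts to a non-zero
form on `W''` at `x`. -/
lemma openCond_iff (F : Set (Submodule k V)) : OpenCond F f ↔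
    ∀ (W'' W' : NZ k V) (h : W''.1 ≤ W'.1), ¬ Separates F W''.1 W'.1 →
      ∀ x : S, ∃ v : W''.1, x ∈ locus f W' (Submodule.inclusion h v) := by
  refine forall_congr' fun W'' => forall_congr' fun W' => forall_congr' fun h =>
    forall_congr' fun _ => forall_congr' fun x => ?_
  constructor
  · rintro ⟨U, hxU, hU⟩
    by_contra! H
    obtain ⟨w', hw'⟩ := P.iSup_chart (comp f W' x)
    have hx : x ∈ U ⊓ locus f W' w' := ⟨hxU, hw'⟩
    let φ : Γ(S, U ⊓ locus f W' w') →+* S.residueField x :=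
      (S.presheaf.germ _ x hx ≫ S.residue x).hom
    have hφ : ∀ v : W''.1, φ (coord (comp f W') w' inf_le_right (Submodule.inclusion h v)) = 0 := by
      intro v
      by_contra hne
      refine H v ?_
      have h1 : x ∈ S.basicOpen (coord (comp f W') w' (U := U ⊓ locus f W' w') inf_le_right
          (Submodule.inclusion h v)) := by
        rw [Scheme.mem_basicOpen _ _ _ hx]
        exact (IsLocalRing.residue_ne_zero_iff_isUnit _).mp hne
      rw [basicOpen_coord] at h1
      exact h1.2
    have h1 : Sec.mk (strOf f) (U := U) 1 ⊗ₜ[k] w' ∈ E f W' U ⊔ LinearMap.range (incl f h U) :=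
      hU ▸ Submodule.mem_top
    obtain ⟨y, hy, _, ⟨z, rfl⟩, hyz⟩ := Submodule.mem_sup.mp h1
    have h2 := congrArg (fun t => φ (ev (strOf f) (comp f W') (comp_str f W') w' inf_le_left
      inf_le_right t)) hyz
    simp only [map_add] at h2
    rw [mem_E.mp hy w', ev_tmul, coord_self, mul_one, map_zero, zero_add, map_one, map_one] at h2
    have h3 : ∀ z, φ (ev (strOf f) (comp f W') (comp_str f W') w' inf_le_left
      inf_le_right (incl f h U z)) = 0 := by
      intro z
      induction z with
      | zero => rw [map_zero, map_zero, map_zero]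
      | tmul a v =>
        obtain ⟨a, rfl⟩ := Sec.exists_mk _ a
        rw [LinearMap.lTensor_tmul, ev_tmul, map_mul, hφ, mul_zero]
      | add a b ha hb => rw [map_add, map_add, map_add, ha, hb, add_zero]
    rw [h3] at h2
    exact zero_ne_one h2
  · rintro ⟨v, hv⟩
    refine ⟨_, hv, ?_⟩
    rw [eq_top_iff]
    rintro t -
    induction t with
    | zero => exact zero_mem _
    | tmul a w =>
      obtain ⟨a, rfl⟩ := Sec.exists_mk _ a
      have h1 := tmul_sub_mem_kernelSheaf (strOf f) (comp f W') (comp_str f W')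
        (Submodule.inclusion h v) (U := locus f W' (Submodule.inclusion h v)) le_rfl a w
      refine (Submodule.mem_sup.mpr ⟨_, h1, _, ⟨Sec.mk (strOf f)
        (a * coord (comp f W') (Submodule.inclusion h v) le_rfl w) ⊗ₜ v, rfl⟩, ?_⟩)
      rw [LinearMap.lTensor_tmul, sub_add_cancel]
    | add a b ha hb => exact add_mem ha hb

end Conditions

/-! ### The chart ring of a basis as a subring of `K_V` -/

section ChartRing
variable {n : ℕ} {R R' : Type*} [CommRing R] [CommRing R']

/-- The product of the `γ l` for `i ≤ l < j`, where `γ l` is thought of as the ratio of the terms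
`l + 1` and `l` of a sequence indexed by `Fin (n + 1)`. -/
def ratioProd (γ : Fin n → R) (i j : Fin (n + 1)) : R :=
  ∏ l ∈ Finset.univ.filter (fun l : Fin n => i ≤ l.castSucc ∧ l.castSucc < j), γ l

lemma ratioProd_self (γ : Fin n → R) (i : Fin (n + 1)) : ratioProd γ i i = 1 := by
  rw [ratioProd, Finset.prod_eq_one]
  intro l hl
  simp only [Finset.mem_filter] at hl
  exact absurd (hl.2.1.trans_lt hl.2.2) (lt_irrefl _)

lemma ratioProd_succ (γ : Fin n → R) (i : Fin (n + 1)) (j : Fin n) (h : i ≤ j.castSucc) :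
    ratioProd γ i j.succ = ratioProd γ i j.castSucc * γ j := by
  have : Finset.univ.filter (fun l : Fin n => i ≤ l.castSucc ∧ l.castSucc < j.succ) =
      insert j (Finset.univ.filter (fun l : Fin n => i ≤ l.castSucc ∧ l.castSucc < j.castSucc)) := by
    ext l
    simp only [Finset.mem_filter, Finset.mem_univ, true_and, Finset.mem_insert,
      Fin.le_def, Fin.lt_def, Fin.val_castSucc, Fin.val_succ, Fin.ext_iff] at h ⊢
    omega
  rw [ratioProd, this, Finset.prod_insert (by simp), mul_comm]
  rfl

/-- A sequence with ratios `γ l` from the index `i` on is determined by its value at `i`. -/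
lemma telescope (γ : Fin n → R) (δ : Fin (n + 1) → R) (i j : Fin (n + 1)) (hij : i ≤ j)
    (h : ∀ l : Fin n, i ≤ l.castSucc → δ l.succ = δ l.castSucc * γ l) :
    δ j = δ i * ratioProd γ i j := by
  induction j using Fin.induction with
  | zero =>
    obtain rfl : i = 0 := le_antisymm hij (Fin.zero_le _)
    rw [ratioProd_self, mul_one]
  | succ j ih =>
    rcases hij.lt_or_eq with hlt | rfl
    · have h1 : i ≤ j.castSucc := by
        simp only [Fin.le_def, Fin.lt_def, Fin.val_castSucc, Fin.val_succ] at hlt ⊢; omega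
      rw [h j h1, ih h1, ratioProd_succ _ _ _ h1, mul_assoc]
    · rw [ratioProd_self, mul_one]

lemma map_ratioProd (φ : R →+* R') (γ : Fin n → R) (i j : Fin (n + 1)) :
    φ (ratioProd γ i j) = ratioProd (fun l => φ (γ l)) i j := map_prod _ _ _

variable {k V : Type u} [Field k] [AddCommGroup V] [Module k V] (b : Module.Basis (Fin (n + 1)) k V)

/-- The step of the complete flag of a basis spanned by the basis vectors with index at least `i`. -/
def filt (i : Fin (n + 1)) : Submodule k V where
  carrier := {v | ∀ j < i, b.repr v j = 0}
  add_mem' hv hw j hj := by simp [hv j hj, hw j hj]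
  zero_mem' j _ := by simp
  smul_mem' c v hv j hj := by simp [hv j hj]

lemma mem_filt {i : Fin (n + 1)} {v : V} : v ∈ filt b i ↔ ∀ j < i, b.repr v j = 0 := Iff.rfl

lemma filt_anti {i j : Fin (n + 1)} (h : i ≤ j) : filt b j ≤ filt b i :=
  fun _ hv l hl => hv l (hl.trans_le h)

lemma basis_mem_filt {i j : Fin (n + 1)} (h : i ≤ j) : b j ∈ filt b i := fun l hl => by
  rw [b.repr_self, Finsupp.single_eq_of_ne]
  exact (hl.trans_le h).ne

/-- `i` is the leading index of `w`. -/
def Lead (i : Fin (n + 1)) (w : V) : Prop := w ∈ filt b i ∧ b.repr w i ≠ 0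

lemma lead_basis (i : Fin (n + 1)) : Lead b i (b i) := ⟨basis_mem_filt b le_rfl, by simp⟩

variable {b} in
lemma Lead.ne_zero {i : Fin (n + 1)} {w : V} (h : Lead b i w) : w ≠ 0 := by
  rintro rfl
  exact h.2 (by simp)

/-- Every non-zero subspace lies in a step of the flag in which it has a vector with that
leading index. -/
lemma exists_lead (W : Submodule k V) (hW : W ≠ ⊥) :
    ∃ i, W ≤ filt b i ∧ ∃ w ∈ W, Lead b i w := by
  classical
  obtain ⟨w, hw, hw0⟩ := W.exists_mem_ne_zero_of_ne_bot hW
  have h1 : ∃ i, ∃ w ∈ W, b.repr w i ≠ 0 := by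
    by_contra! H
    exact hw0 (b.repr.map_eq_zero_iff.mp (Finsupp.ext fun i => H i w hw))
  obtain ⟨i, ⟨w, hwW, hwi⟩, hmin⟩ := WellFounded.has_min (wellFounded_lt (α := Fin (n + 1)))
    {i | ∃ w ∈ W, b.repr w i ≠ 0} h1
  have h2 : W ≤ filt b i := fun v hv j hj => by
    by_contra hne
    exact hmin j ⟨v, hv, hne⟩ hj
  exact ⟨i, h2, w, hwW, h2 hwW, hwi⟩

section form
variable [Algebra k R] [Algebra k R']

/-- The linear form on `filt b i` with `b j ↦ γ i ⋯ γ (j - 1)`, extended by zero. -/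
def form (γ : Fin n → R) (i : Fin (n + 1)) (v : V) : R :=
  ∑ j ∈ Finset.univ.filter (i ≤ ·), algebraMap k R (b.repr v j) * ratioProd γ i j

lemma map_form (φ : R →ₐ[k] R') (γ : Fin n → R) (i : Fin (n + 1)) (v : V) :
    φ (form b γ i v) = form b (fun l => φ (γ l)) i v := by
  simp only [form, map_sum, map_mul, AlgHom.commutes]
  refine Finset.sum_congr rfl fun j _ => ?_
  congr 1
  exact map_ratioProd φ.toRingHom γ i j

/-- A linear map on a step of the flag is determined up to its value at the first basis vector by
the ratios of its values at consecutive basis vectors. -/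
lemma eq_form (γ : Fin n → R) (i : Fin (n + 1)) (μ : filt b i →ₗ[k] R)
    (h : ∀ (l : Fin n) (hl : i ≤ l.castSucc), μ ⟨b l.succ, basis_mem_filt b (hl.trans l.castSucc_le_succ)⟩ =
      μ ⟨b l.castSucc, basis_mem_filt b hl⟩ * γ l) (v : filt b i) :
    μ v = μ ⟨b i, basis_mem_filt b le_rfl⟩ * form b γ i v := by
  have h1 : ∀ j (hj : i ≤ j), μ ⟨b j, basis_mem_filt b hj⟩ =
      μ ⟨b i, basis_mem_filt b le_rfl⟩ * ratioProd γ i j := by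
    intro j hj
    have := telescope γ (fun j => if hj : i ≤ j then μ ⟨b j, basis_mem_filt b hj⟩ else 0) i j hj
      (fun l hl => by
        simp only [dif_pos hl, dif_pos (hl.trans l.castSucc_le_succ)]; exact h l hl)
    simpa [hj] using this
  have h2 : v = ∑ j ∈ (Finset.univ.filter (i ≤ ·)).attach, b.repr v.1 j.1 •
      (⟨b j.1, basis_mem_filt b (Finset.mem_filter.mp j.2).2⟩ : filt b i) := by
    apply Subtype.ext
    rw [AddSubmonoidClass.coe_finsetSum]
    conv_lhs => rw [← b.sum_repr v.1]
    rw [← Finset.sum_filter_add_sum_filter_not Finset.univ (i ≤ ·)]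
    rw [Finset.sum_eq_zero (s := Finset.univ.filter (¬ i ≤ ·)), add_zero]
    · exact (Finset.sum_attach (Finset.univ.filter (i ≤ ·)) (fun j => b.repr v.1 j • b j)).symm
    · intro j hj
      rw [v.2 j (not_le.mp (Finset.mem_filter.mp hj).2), zero_smul]
  conv_lhs => rw [h2]
  rw [map_sum, form, Finset.mul_sum, ← Finset.sum_attach (Finset.univ.filter (i ≤ ·))]
  refine Finset.sum_congr rfl fun j _ => ?_
  rw [map_smul, h1 j.1 (Finset.mem_filter.mp j.2).2, Algebra.smul_def]
  ring

end form

/-- The coordinate ring of the affine chart of `B_V` that belongs to the basis `b`, as a subring of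
`K_V`: it is generated by the fractions `v / w` for which `w` has a leading index at most that of
`v`. -/
def chartRing : Subalgebra k (K k V) :=
  Algebra.adjoin k {x | ∃ i, ∃ v ∈ filt b i, ∃ w, Lead b i w ∧ x = vec k V v / vec k V w}

variable {b} in
/-- The element `v / w` of the chart ring. -/
def chartFrac {i : Fin (n + 1)} {v w : V} (hv : v ∈ filt b i) (hw : Lead b i w) : chartRing b :=
  ⟨vec k V v / vec k V w, Algebra.subset_adjoin ⟨i, v, hv, w, hw, rfl⟩⟩

variable {b} in
lemma Lead.vec_ne_zero {i : Fin (n + 1)} {w : V} (h : Lead b i w) : vec k V w ≠ 0 :=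
  BV.vec_ne_zero k V h.ne_zero

lemma chartRing_induction {p : chartRing b → Prop} (halg : ∀ c : k, p (algebraMap k _ c))
    (hfrac : ∀ (i : Fin (n + 1)) (v w : V) (hv : v ∈ filt b i) (hw : Lead b i w),
      p (chartFrac hv hw))
    (hadd : ∀ x y, p x → p y → p (x + y)) (hmul : ∀ x y, p x → p y → p (x * y))
    (x : chartRing b) : p x := by
  obtain ⟨x, hx⟩ := x
  refine Algebra.adjoin_induction (R := k) (p := fun x hx => p ⟨x, hx⟩) ?_ ?_ ?_ ?_ hx
  · rintro _ ⟨i, v, hv, w, hw, rfl⟩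
    exact hfrac i v w hv hw
  · exact halg
  · intro x y hx hy h1 h2
    exact hadd _ _ h1 h2
  · intro x y hx hy h1 h2
    exact hmul _ _ h1 h2

lemma chartRing_hom_ext {φ ψ : chartRing b →+* R}
    (halg : ∀ c : k, φ (algebraMap k _ c) = ψ (algebraMap k _ c))
    (hfrac : ∀ (i : Fin (n + 1)) (v w : V) (hv : v ∈ filt b i) (hw : Lead b i w),
      φ (chartFrac hv hw) = ψ (chartFrac hv hw)) : φ = ψ := by
  ext x
  refine chartRing_induction b (p := fun x => φ x = ψ x) halg hfrac ?_ ?_ x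
  · intro x y h1 h2
    rw [map_add, map_add, h1, h2]
  · intro x y h1 h2
    rw [map_mul, map_mul, h1, h2]

/-- The ratio `b (l + 1) / b l`; these are the coordinates on the chart. -/
def chartCoord (l : Fin n) : chartRing b :=
  chartFrac (basis_mem_filt b l.castSucc_le_succ) (lead_basis b l.castSucc)

/-- The homomorphism from the polynomial ring to the chart ring given by the coordinates. -/
def polyMap : MvPolynomial (Fin n) k →ₐ[k] chartRing b := MvPolynomial.aeval (chartCoord b)

/-- The fraction `v / b i` is a polynomial in the coordinates of the chart. -/
lemma polyMap_form (i : Fin (n + 1)) (v : V) (hv : v ∈ filt b i) :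
    polyMap b (form b MvPolynomial.X i v) = chartFrac hv (lead_basis b i) := by
  rw [map_form]
  apply Subtype.ext
  rw [← Subalgebra.coe_val, map_form]
  have := eq_form b (fun l => (chartRing b).val (polyMap b (MvPolynomial.X l))) i
    (vec k V ∘ₗ (filt b i).subtype) (fun l hl => by
      have := (lead_basis b l.castSucc).vec_ne_zero
      simp [polyMap, chartCoord, chartFrac]
      field_simp) ⟨v, hv⟩
  have h0 := (lead_basis b i).vec_ne_zero
  change _ = vec k V v / vec k V (b i)
  rw [eq_div_iff h0, mul_comm]
  exact this.symm

/-- The coordinates of a chart are algebraically independent. Once denominators are cleared, a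
polynomial in them is recovered from its value, an element of `Sym V`, by the homomorphism that
sends `b j` to the product of the variables `X l` for `l < j`. -/
lemma polyMap_injective : Function.Injective (polyMap b) := by
  classical
  rw [injective_iff_map_eq_zero]
  let σ : SymmetricAlgebra k V →ₐ[k] MvPolynomial (Fin n) k :=
    SymmetricAlgebra.lift (b.constr k (fun j => ratioProd MvPolynomial.X 0 j))
  have hσ : ∀ j, σ (SymmetricAlgebra.ι k V (b j)) = ratioProd MvPolynomial.X 0 j := by
    intro j; simp [σ]
  let Δ : SymmetricAlgebra k V := ∏ j, SymmetricAlgebra.ι k V (b j)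
  let a : SymmetricAlgebra k V → K k V := algebraMap _ _
  -- multiplication by a power of `∏ b j` clears the denominators of `polyMap b p`
  have key : ∀ p : MvPolynomial (Fin n) k, ∃ (N : ℕ) (s : SymmetricAlgebra k V),
      algebraMap _ (K k V) s = (polyMap b p : K k V) * algebraMap _ (K k V) Δ ^ N ∧
      σ s = p * σ Δ ^ N := by
    intro p
    induction p using MvPolynomial.induction_on with
    | C c =>
      refine ⟨0, algebraMap k _ c, ?_, ?_⟩
      · rw [pow_zero, mul_one, ← MvPolynomial.algebraMap_eq, AlgHom.commutes,
          ← IsScalarTower.algebraMap_apply]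
        rfl
      · rw [AlgHom.commutes, pow_zero, mul_one, MvPolynomial.algebraMap_eq]
    | add p q hp hq =>
      obtain ⟨N, s, h1, h2⟩ := hp
      obtain ⟨N', s', h1', h2'⟩ := hq
      refine ⟨N + N', s * Δ ^ N' + s' * Δ ^ N, ?_, ?_⟩
      · rw [map_add, map_mul, map_mul, h1, h1', map_pow, map_pow, map_add, Subalgebra.coe_add]
        ring
      · rw [map_add, map_mul, map_mul, h2, h2', map_pow, map_pow]
        ring
    | mul_X p l hp =>
      obtain ⟨N, s, h1, h2⟩ := hp
      have hΔ : Δ = SymmetricAlgebra.ι k V (b l.castSucc) *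
          ∏ j ∈ Finset.univ.erase l.castSucc, SymmetricAlgebra.ι k V (b j) :=
        (Finset.mul_prod_erase _ _ (Finset.mem_univ _)).symm
      refine ⟨N + 1, s * (SymmetricAlgebra.ι k V (b l.succ) *
        ∏ j ∈ Finset.univ.erase l.castSucc, SymmetricAlgebra.ι k V (b j)), ?_, ?_⟩
      · have h3 : ((polyMap b (MvPolynomial.X l) : chartRing b) : K k V) *
            algebraMap (SymmetricAlgebra k V) (K k V) (SymmetricAlgebra.ι k V (b l.castSucc)) =
            algebraMap (SymmetricAlgebra k V) (K k V) (SymmetricAlgebra.ι k V (b l.succ)) := by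
          have := (lead_basis b l.castSucc).vec_ne_zero
          simp only [polyMap, MvPolynomial.aeval_X]
          exact div_mul_cancel₀ _ this
        rw [map_mul, map_mul, h1, ← h3, map_mul, Subalgebra.coe_mul, pow_succ]
        nth_rw 3 [hΔ]
        rw [map_mul]
        ring
      · rw [map_mul, map_mul, h2, pow_succ]
        nth_rw 3 [hΔ]
        rw [map_mul, hσ, hσ, ratioProd_succ _ _ _ (Fin.zero_le _)]
        ring
  intro p hp
  obtain ⟨N, s, h1, h2⟩ := key p
  rw [hp, Subalgebra.coe_zero, zero_mul] at h1
  rw [(map_eq_zero_iff _ (IsFractionRing.injective (SymmetricAlgebra k V) (K k V))).mp h1,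
    map_zero] at h2
  refine (mul_eq_zero.mp h2.symm).resolve_right (pow_ne_zero _ ?_)
  rw [map_prod]
  refine Finset.prod_ne_zero_iff.mpr fun j _ => ?_
  rw [hσ, ratioProd]
  exact Finset.prod_ne_zero_iff.mpr fun l _ => MvPolynomial.X_ne_zero l

end ChartRing

/-! ### The chart ring as a localization of a polynomial ring, and `RS_{V,0}` as a localization of it -/

section ChartRing
variable {n : ℕ} {k V : Type u} [Field k] [AddCommGroup V] [Module k V]
  (b : Module.Basis (Fin (n + 1)) k V)

lemma coe_chartFrac {i : Fin (n + 1)} {v w : V} (hv : v ∈ filt b i) (hw : Lead b i w) :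
    (chartFrac hv hw : K k V) = vec k V v / vec k V w := rfl

lemma chartFrac_mul_chartFrac {i : Fin (n + 1)} {v w u : V} (hv : v ∈ filt b i) (hw : Lead b i w)
    (hu : Lead b i u) : chartFrac hv hw * chartFrac hw.1 hu = chartFrac hv hu := by
  apply Subtype.ext
  rw [Subalgebra.coe_mul, coe_chartFrac, coe_chartFrac, coe_chartFrac, div_mul_div_cancel₀ hw.vec_ne_zero]

lemma chartFrac_self {i : Fin (n + 1)} {w : V} (hw : Lead b i w) : chartFrac hw.1 hw = 1 := by
  apply Subtype.ext
  exact div_self hw.vec_ne_zero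

lemma isUnit_chartFrac {i : Fin (n + 1)} {v w : V} (hv : Lead b i v) (hw : Lead b i w) :
    IsUnit (chartFrac hv.1 hw) :=
  IsUnit.of_mul_eq_one (chartFrac hw.1 hv) (by rw [chartFrac_mul_chartFrac, chartFrac_self])

section
variable [Finite k] [Module.Finite k V]

/-- The pairs of an index and a vector with that leading index. -/
def leadPairs : Finset (Fin (n + 1) × V) :=
  haveI : Finite V := Module.finite_of_finite k
  (Set.toFinite {p : Fin (n + 1) × V | Lead b p.1 p.2}).toFinset

lemma mem_leadPairs {p : Fin (n + 1) × V} : p ∈ leadPairs b ↔ Lead b p.1 p.2 := by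
  simp [leadPairs]

/-- The polynomial that is inverted in the chart ring. -/
def chartDenom : MvPolynomial (Fin n) k :=
  ∏ p ∈ leadPairs b, form b MvPolynomial.X p.1 p.2

lemma form_dvd_chartDenom {i : Fin (n + 1)} {w : V} (hw : Lead b i w) :
    form b MvPolynomial.X i w ∣ chartDenom b := by
  classical
  have hmem : (i, w) ∈ leadPairs b := by rw [mem_leadPairs]; exact hw
  rw [chartDenom, ← Finset.mul_prod_erase _ _ hmem]
  exact dvd_mul_right _ _

lemma isUnit_polyMap_chartDenom : IsUnit (polyMap b (chartDenom b)) := by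
  rw [chartDenom, map_prod, IsUnit.prod_iff]
  intro p hp
  rw [mem_leadPairs] at hp
  rw [polyMap_form b p.1 p.2 hp.1]
  exact isUnit_chartFrac b hp (lead_basis b p.1)

/-- The chart ring is a localization of the polynomial ring in the coordinates. -/
lemma isLocalization_chartRing :
    letI := (polyMap b).toRingHom.toAlgebra
    IsLocalization.Away (chartDenom b) (chartRing b) := by
  let := (polyMap b).toRingHom.toAlgebra
  have hmap : ∀ p, algebraMap (MvPolynomial (Fin n) k) (chartRing b) p = polyMap b p := fun _ => rfl
  refine ⟨?_, ?_, ?_⟩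
  · rintro ⟨_, m, rfl⟩
    rw [hmap, map_pow]
    exact (isUnit_polyMap_chartDenom b).pow m
  · have key : ∀ z : chartRing b, ∃ (N : ℕ) (p : MvPolynomial (Fin n) k),
        z * polyMap b (chartDenom b) ^ N = polyMap b p := by
      intro z
      induction z using chartRing_induction with
      | halg c => exact ⟨0, algebraMap k _ c, by rw [pow_zero, mul_one, AlgHom.commutes]⟩
      | hfrac i v w hv hw =>
        obtain ⟨q, hq⟩ := form_dvd_chartDenom b hw
        refine ⟨1, form b MvPolynomial.X i v * q, ?_⟩
        rw [pow_one, hq, map_mul, map_mul, polyMap_form b i v hv, polyMap_form b i w hw.1, ← mul_assoc,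
          chartFrac_mul_chartFrac]
      | hadd x y hx hy =>
        obtain ⟨N, p, h⟩ := hx
        obtain ⟨N', p', h'⟩ := hy
        refine ⟨N + N', p * chartDenom b ^ N' + p' * chartDenom b ^ N, ?_⟩
        rw [map_add, map_mul, map_mul, ← h, ← h', map_pow, map_pow]
        ring
      | hmul x y hx hy =>
        obtain ⟨N, p, h⟩ := hx
        obtain ⟨N', p', h'⟩ := hy
        refine ⟨N + N', p * p', ?_⟩
        rw [map_mul, ← h, ← h']
        ring
    intro z
    obtain ⟨N, p, h⟩ := key z
    refine ⟨⟨p, ⟨_, N, rfl⟩⟩, ?_⟩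
    dsimp only
    rw [hmap, hmap, map_pow, h]
  · intro x y hxy
    exact ⟨1, by rw [polyMap_injective b hxy]⟩

variable {A : Type*} [CommRing A] [Algebra k A]

/-- The universal property of the chart ring: it classifies compatible systems of linear forms
on the steps of the flag which are normalized at the basis vectors and invertible on all vectors of
the right leading index. -/
lemma exists_chartRing_hom (μ : ∀ i, filt b i →ₗ[k] A)
    (h1 : ∀ i, μ i ⟨b i, basis_mem_filt b le_rfl⟩ = 1)
    (h2 : ∀ (i l : Fin (n + 1)) (hil : i ≤ l) (v : filt b l), μ i ⟨v.1, filt_anti b hil v.2⟩ =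
      μ i ⟨b l, basis_mem_filt b hil⟩ * μ l v)
    (h3 : ∀ i w (hw : Lead b i w), IsUnit (μ i ⟨w, hw.1⟩)) :
    ∃ φ : chartRing b →+* A, (∀ c : k, φ (algebraMap k _ c) = algebraMap k A c) ∧
      ∀ (i : Fin (n + 1)) (v w : V) (hv : v ∈ filt b i) (hw : Lead b i w),
        φ (chartFrac hv hw) * μ i ⟨w, hw.1⟩ = μ i ⟨v, hv⟩ := by
  let γ : Fin n → A := fun l => μ l.castSucc ⟨b l.succ, basis_mem_filt b l.castSucc_le_succ⟩
  let ψ : MvPolynomial (Fin n) k →ₐ[k] A := MvPolynomial.aeval γ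
  have hψ : ∀ i (v : filt b i), ψ (form b MvPolynomial.X i v) = μ i v := by
    intro i v
    rw [map_form, eq_form b (fun l => ψ (MvPolynomial.X l)) i (μ i) ?_ v, h1, one_mul]
    intro l hl
    rw [h2 i l.castSucc hl ⟨b l.succ, basis_mem_filt b l.castSucc_le_succ⟩]
    simp [ψ, γ]
  let := (polyMap b).toRingHom.toAlgebra
  have := isLocalization_chartRing b
  have hu : IsUnit (ψ.toRingHom (chartDenom b)) := by
    change IsUnit (ψ (chartDenom b))
    rw [chartDenom, map_prod, IsUnit.prod_iff]
    intro p hp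
    rw [mem_leadPairs] at hp
    rw [hψ p.1 ⟨p.2, hp.1⟩]
    exact h3 _ _ hp
  have hφ : ∀ p, IsLocalization.Away.lift (S := chartRing b) (chartDenom b) hu (polyMap b p) = ψ p :=
    IsLocalization.Away.lift_eq (S := chartRing b) (chartDenom b) hu
  refine ⟨IsLocalization.Away.lift (S := chartRing b) (chartDenom b) hu, ?_, ?_⟩
  · intro c
    rw [← AlgHom.commutes (polyMap b), hφ, AlgHom.commutes]
  · intro i v w hv hw
    rw [← hψ i ⟨w, hw.1⟩, ← hψ i ⟨v, hv⟩, ← hφ, ← map_mul, ← hφ, polyMap_form b i v hv,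
      polyMap_form b i w hw.1, chartFrac_mul_chartFrac]

end

lemma chartRing_le_RSZero : chartRing b ≤ RSZero k V := by
  refine Algebra.adjoin_mono ?_
  rintro _ ⟨i, v, hv, w, hw, rfl⟩
  exact ⟨v, w, hw.ne_zero, rfl⟩

/-- The product of all coordinates of the chart, the ratio of the last and the first basis
vector. -/
def chartBoundary : chartRing b :=
  chartFrac (basis_mem_filt b (Fin.zero_le (Fin.last n))) (lead_basis b 0)

lemma chartBoundary_eq : chartBoundary b = ∏ l, chartCoord b l := by
  have h := telescope (chartCoord b) (fun j => chartFrac (basis_mem_filt b (Fin.zero_le j))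
    (lead_basis b 0)) 0 (Fin.last n) (Fin.zero_le _) (fun l _ => by
      apply Subtype.ext
      have := (lead_basis b l.castSucc).vec_ne_zero
      change _ / _ = _ / _ * (_ / _)
      field_simp)
  rw [chartFrac_self, one_mul, ratioProd, Finset.filter_true_of_mem] at h
  · exact h
  · intro l _
    exact ⟨Fin.zero_le _, Fin.castSucc_lt_last l⟩

/-- The quotient of the last basis vector by a vector with a leading index; it lies in the chart
ring because every leading index is at most the last one. -/
def lastFrac {i : Fin (n + 1)} {w : V} (hw : Lead b i w) : chartRing b :=
  chartFrac (basis_mem_filt b (Fin.le_last i)) hw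

lemma exists_lead_vector {w : V} (hw : w ≠ 0) : ∃ i, Lead b i w := by
  obtain ⟨i, hi, v, hv, hvi⟩ := exists_lead b (k ∙ w) (by simpa using hw)
  obtain ⟨c, rfl⟩ := Submodule.mem_span_singleton.mp hv
  refine ⟨i, hi (Submodule.mem_span_singleton_self w), fun h0 => hvi.2 (by simp [h0])⟩

lemma coe_chartBoundary :
    (chartBoundary b : K k V) = vec k V (b (Fin.last n)) / vec k V (b 0) := rfl

variable (k V) in
/-- The element `v / w` of `RS_{V,0}`. -/
def ratio (v w : V) (hw : w ≠ 0) : RSZero k V :=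
  ⟨vec k V v / vec k V w, Algebra.subset_adjoin ⟨v, w, hw, rfl⟩⟩

variable (k V) in
lemma coe_ratio (v w : V) (hw : w ≠ 0) : (ratio k V v w hw : K k V) = vec k V v / vec k V w := rfl

/-- The inclusion of a chart ring in `RS_{V,0}`. -/
def chartIncl : chartRing b →ₐ[k] RSZero k V := Subalgebra.inclusion (chartRing_le_RSZero b)

lemma coe_chartIncl (x : chartRing b) : (chartIncl b x : K k V) = x :=
  Subalgebra.coe_inclusion (chartRing_le_RSZero b) x

lemma isUnit_chartIncl_chartBoundary : IsUnit (chartIncl b (chartBoundary b)) := by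
  have h0 := (lead_basis b 0).vec_ne_zero
  have hl := (lead_basis b (Fin.last n)).vec_ne_zero
  refine IsUnit.of_mul_eq_one (ratio k V (b 0) _ (lead_basis b (Fin.last n)).ne_zero)
    (Subtype.ext ?_)
  rw [Subalgebra.coe_mul, coe_ratio, coe_chartIncl, coe_chartBoundary, Subalgebra.coe_one]
  field_simp

/-- Multiplication by a power of the product of the coordinates moves `RS_{V,0}` into the chart ring,
as `v / w = (v / b 0) (b n / w) (b 0 / b n)`. -/
lemma exists_mul_chartBoundary_pow (z : K k V) (hz : z ∈ RSZero k V) :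
    ∃ (N : ℕ) (p : chartRing b), z * (chartBoundary b : K k V) ^ N = p := by
  have h0 := (lead_basis b 0).vec_ne_zero
  have hl := (lead_basis b (Fin.last n)).vec_ne_zero
  induction hz using Algebra.adjoin_induction with
  | mem z hz =>
    obtain ⟨v, w, hw, rfl⟩ := hz
    obtain ⟨i, hi⟩ := exists_lead_vector b hw
    have hv : v ∈ filt b 0 := fun j hj => absurd hj (Fin.not_lt_zero j)
    refine ⟨1, chartFrac hv
      (lead_basis b 0) * lastFrac b hi, ?_⟩
    have := hi.vec_ne_zero
    rw [pow_one, Subalgebra.coe_mul, lastFrac, coe_chartFrac, coe_chartFrac, coe_chartBoundary]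
    field_simp
  | algebraMap c =>
    exact ⟨0, algebraMap k _ c, by rw [pow_zero, mul_one, Subalgebra.coe_algebraMap]⟩
  | add x y _ _ hx hy =>
    obtain ⟨N, p, h⟩ := hx
    obtain ⟨N', p', h'⟩ := hy
    refine ⟨N + N', p * chartBoundary b ^ N' + p' * chartBoundary b ^ N, ?_⟩
    rw [Subalgebra.coe_add, Subalgebra.coe_mul, Subalgebra.coe_mul, ← h, ← h',
      Subalgebra.coe_pow, Subalgebra.coe_pow]
    ring
  | mul x y _ _ hx hy =>
    obtain ⟨N, p, h⟩ := hx
    obtain ⟨N', p', h'⟩ := hy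
    refine ⟨N + N', p * p', ?_⟩
    rw [Subalgebra.coe_mul, ← h, ← h']
    ring

lemma chartIncl_injective : Function.Injective (chartIncl b) := by
  intro x y hxy
  have h := congrArg Subtype.val hxy
  rw [coe_chartIncl, coe_chartIncl] at h
  exact Subtype.ext h

/-- On the chart, `Ω_V` is the complement of the coordinate hyperplanes. -/
lemma isLocalization_RSZero :
    letI := (chartIncl b).toRingHom.toAlgebra
    IsLocalization.Away (chartBoundary b) (RSZero k V) := by
  let := (chartIncl b).toRingHom.toAlgebra
  have hmap : ∀ p, algebraMap (chartRing b) (RSZero k V) p = chartIncl b p := fun p => by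
    rw [RingHom.algebraMap_toAlgebra, AlgHom.toRingHom_eq_coe, RingHom.coe_coe]
  refine ⟨?_, ?_, ?_⟩
  · rintro ⟨_, m, rfl⟩
    rw [hmap, map_pow]
    exact (isUnit_chartIncl_chartBoundary b).pow m
  · rintro ⟨z, hz⟩
    obtain ⟨N, p, h⟩ := exists_mul_chartBoundary_pow b z hz
    refine ⟨⟨p, ⟨_, N, rfl⟩⟩, Subtype.ext ?_⟩
    rw [hmap, hmap, map_pow, Subalgebra.coe_mul, Subalgebra.coe_pow, coe_chartIncl, coe_chartIncl, h]
  · intro x y hxy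
    rw [hmap, hmap] at hxy
    exact ⟨1, by rw [chartIncl_injective b hxy]⟩

end ChartRing

/-! ### Representability by the largest closed subscheme, and properness of `∏ P_W` -/

section Representability

lemma toImage_app_injective {X Y : Scheme.{u}} (f : X ⟶ Y) [QuasiCompact f] (U : f.image.Opens) :
    Function.Injective (f.toImage.app U) :=
  TopCat.Presheaf.app_injective_of_stalkFunctor_map_injective (F := f.image.sheaf) f.toImage.c U
    fun x _ => f.stalkFunctor_toImage_injective x

/-- A morphism that factors locally through `τ` maps to the scheme-theoretic image of `τ`. -/
lemma ker_le_ker_of_locally {X Y T : Scheme.{u}} (f : X ⟶ Y) (τ : T ⟶ Y)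
    (h : ∀ x : X, ∃ U : X.Opens, x ∈ U ∧ ∃ g : U.toScheme ⟶ T, g ≫ τ = U.ι ≫ f) :
    τ.ker ≤ f.ker := by
  refine Scheme.IdealSheafData.le_ofIdeals_iff.mpr fun V s hs => ?_
  have hs := τ.ideal_ker_le V hs
  rw [RingHom.mem_ker] at hs ⊢
  refine section_ext_of_locally fun x hx => ?_
  obtain ⟨U, hxU, g, hg⟩ := h x
  refine ⟨U.ι ''ᵁ U.ι ⁻¹ᵁ f ⁻¹ᵁ V, U.ι.image_preimage_le _, ⟨⟨x, hxU⟩, hx, rfl⟩, ?_⟩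
  have h1 : ((U.ι ≫ f).app V).hom s = 0 := by
    rw [← hg]
    exact (congrArg (g.app _).hom hs).trans (map_zero _)
  exact h1.trans (map_zero _).symm

/-- If a property of morphisms to `X` is stable under precomposition and descends along
scheme-theoretically dominant morphisms, and if it is locally classified by a quasi-compact `τ`, then
it is represented by the largest closed subscheme of `X` that has it. -/
lemma exists_lift_sInf_iff {X : Scheme.{u}} (p : ∀ {T : Scheme.{u}}, (T ⟶ X) → Prop)
    (hcomp : ∀ {S T : Scheme.{u}} (f : S ⟶ T) (g : T ⟶ X), p g → p (f ≫ g))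
    (hdom : ∀ {S T : Scheme.{u}} (f : S ⟶ T) (g : T ⟶ X), (∀ U, Function.Injective (f.app U)) →
      p (f ≫ g) → p g)
    {T : Scheme.{u}} (τ : T ⟶ X) [QuasiCompact τ] (hτ : p τ)
    (huniv : ∀ {S : Scheme.{u}} (f : S ⟶ X), p f → ∀ x : S, ∃ U : S.Opens, x ∈ U ∧
      ∃ g : U.toScheme ⟶ T, g ≫ τ = U.ι ≫ f) {S : Scheme.{u}} (f : S ⟶ X) :
    (∃ g : S ⟶ (sInf {I : X.IdealSheafData | p I.subschemeι}).subscheme,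
      g ≫ (sInf {I : X.IdealSheafData | p I.subschemeι}).subschemeι = f) ↔ p f := by
  have h1 : p τ.ker.subschemeι := hdom τ.toImage _ (toImage_app_injective τ)
    (by rw [Scheme.Hom.toImage_imageι]; exact hτ)
  have h2 : sInf {I : X.IdealSheafData | p I.subschemeι} = τ.ker := by
    refine le_antisymm (sInf_le h1) (le_sInf fun I hI => ?_)
    rw [← I.ker_subschemeι]
    exact ker_le_ker_of_locally _ _ (huniv _ hI)
  rw [h2]
  constructor
  · rintro ⟨g, rfl⟩
    exact hcomp _ _ h1
  · intro hf
    have h3 : τ.ker.subschemeι.ker ≤ f.ker := by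
      rw [Scheme.IdealSheafData.ker_subschemeι]
      exact ker_le_ker_of_locally _ _ (huniv _ hf)
    exact ⟨IsClosedImmersion.lift _ _ h3, IsClosedImmersion.lift_fac _ _ _⟩

end Representability

section Proper

/-- Finite products of proper schemes over `S` exist and are proper, by induction on the number of
factors. -/
lemma exists_proper_product (ι : Type u) [Finite ι] (S : Scheme.{u}) : ∀ (X : ι → Scheme.{u})
    (f : ∀ i, X i ⟶ S) [∀ i, IsProper (f i)], ∃ (T : Scheme.{u}) (t : T ⟶ S) (p : ∀ i, T ⟶ X i),
      IsProper t ∧ (∀ i, p i ≫ f i = t) ∧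
      (∀ (Y : Scheme.{u}) (y : Y ⟶ S) (q : ∀ i, Y ⟶ X i), (∀ i, q i ≫ f i = y) →
        ∃! r : Y ⟶ T, r ≫ t = y ∧ ∀ i, r ≫ p i = q i) := by
  induction ι using Finite.induction_empty_option with
  | of_equiv e ih =>
    intro X f _
    obtain ⟨T, t, p, ht, hp, hu⟩ := ih (fun i => X (e i)) (fun i => f (e i))
    obtain ⟨p', rfl⟩ : ∃ p' : ∀ i, T ⟶ X i, p = fun i => p' (e i) :=
      ⟨Equiv.piCongrLeft (fun i => T ⟶ X i) e p, funext fun i =>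
        (Equiv.piCongrLeft_apply_apply (fun i => T ⟶ X i) e p i).symm⟩
    refine ⟨T, t, p', ht, fun i => ?_, fun Y y q hq => ?_⟩
    · obtain ⟨i, rfl⟩ := e.surjective i
      exact hp i
    · obtain ⟨r, ⟨h1, h2⟩, h3⟩ := hu Y y (fun i => q (e i)) (fun i => hq _)
      refine ⟨r, ⟨h1, e.surjective.forall.mpr h2⟩, fun r' h => h3 r' ⟨h.1, fun i => h.2 _⟩⟩
  | h_empty =>
    intro X f _
    exact ⟨S, 𝟙 S, fun i => i.elim, inferInstance, fun i => i.elim, fun Y y q hq =>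
      ⟨y, ⟨Category.comp_id _, fun i => i.elim⟩, fun r h => (Category.comp_id r).symm.trans h.1⟩⟩
  | h_option ih =>
    intro X f _
    obtain ⟨T, t, p, ht, hp, hu⟩ := ih (fun i => X (some i)) (fun i => f (some i))
    refine ⟨pullback t (f none), pullback.fst _ _ ≫ t, fun i => match i with
      | none => pullback.snd _ _
      | some i => pullback.fst _ _ ≫ p i, inferInstance, ?_, ?_⟩
    · rintro (_ | i)
      · exact pullback.condition.symm
      · rw [Category.assoc, hp]
    · intro Y y q hq
      obtain ⟨r, ⟨h1, h2⟩, h3⟩ := hu Y y (fun i => q (some i)) (fun i => hq _)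
      refine ⟨pullback.lift r (q none) (by rw [h1, hq]), ⟨by rw [pullback.lift_fst_assoc, h1], ?_⟩, ?_⟩
      · rintro (_ | i)
        · exact pullback.lift_snd _ _ _
        · exact (pullback.lift_fst_assoc _ _ _ _).trans (h2 i)
      · rintro r' ⟨h4, h5⟩
        refine pullback.hom_ext ?_ ?_
        · rw [pullback.lift_fst]
          exact h3 _ ⟨(Category.assoc _ _ _).trans h4, fun i => (Category.assoc _ _ _).trans (h5 (some i))⟩
        · rw [pullback.lift_snd]
          exact h5 none

/-- A finite wide pullback of proper morphisms is proper. -/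
lemma isProper_widePullback_base {ι : Type u} [Finite ι] (S : Scheme.{u}) (X : ι → Scheme.{u})
    (f : ∀ i, X i ⟶ S) [∀ i, IsProper (f i)] [HasWidePullback S X f] :
    IsProper (WidePullback.base f) := by
  obtain ⟨T, t, p, ht, hp, hu⟩ := exists_proper_product ι S X f
  obtain ⟨r, ⟨h1, h2⟩, -⟩ := hu _ (WidePullback.base f) (WidePullback.π f) (WidePullback.π_arrow f)
  have h3 : WidePullback.lift t p hp ≫ r = 𝟙 T :=
    (hu T t p hp).unique ⟨by rw [Category.assoc, h1, WidePullback.lift_base],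
      fun i => by rw [Category.assoc, h2, WidePullback.lift_π]⟩
      ⟨Category.id_comp _, fun i => Category.id_comp _⟩
  have h4 : r ≫ WidePullback.lift t p hp = 𝟙 _ :=
    WidePullback.hom_ext _ _ _
      (fun i => by rw [Category.assoc, WidePullback.lift_π, h2, Category.id_comp])
      (by rw [Category.assoc, WidePullback.lift_base, h1, Category.id_comp])
  have : IsIso r := ⟨_, h4, h3⟩
  rw [← h1]
  infer_instance

variable {k V : Type u} [Field k] [AddCommGroup V] [Module k V]

lemma algebraMap_zero_surjective :
    Function.Surjective (algebraMap k (symGrading k V 0)) := by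
  rintro ⟨x, hx⟩
  rw [symGrading, pow_zero] at hx
  obtain ⟨c, rfl⟩ := Submodule.mem_one.mp hx
  exact ⟨c, Subtype.ext (by simp [SetLike.GradeZero.coe_algebraMap])⟩

variable [Module.Finite k V]

instance : Algebra.FiniteType k (SymmetricAlgebra k V) :=
  .equiv inferInstance (SymmetricAlgebra.equivMvPolynomial (Module.finBasis k V)).symm

instance : IsProper (P.str k V) := by
  have : Algebra.FiniteType (symGrading k V 0) (SymmetricAlgebra k V) :=
    have : IsScalarTower k (symGrading k V 0) (SymmetricAlgebra k V) :=
      .of_algebraMap_eq (R := k) (S := symGrading k V 0) fun _ => rfl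
    .of_restrictScalars_finiteType k _ _
  have : IsClosedImmersion (Spec.map (CommRingCat.ofHom (algebraMap k (symGrading k V 0)))) :=
    IsClosedImmersion.spec_of_surjective _ algebraMap_zero_surjective
  unfold P.str
  infer_instance

instance [Finite k] : IsProper (prodP.str k V) :=
  isProper_widePullback_base _ _ _

end Proper

/-! ### The morphisms from the charts to `∏ P_W` -/

section Functoriality
variable {k V : Type u} [Field k] [AddCommGroup V] [Module k V] [Finite k] [Module.Finite k V]

lemma coord_congr {S : Scheme.{u}} {g g' : S ⟶ P k V} (h : g = g') (v₀ v : V) {U : S.Opens}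
    (e : U ≤ g ⁻¹ᵁ P.chart k V v₀) (e' : U ≤ g' ⁻¹ᵁ P.chart k V v₀) :
    coord g v₀ e v = coord g' v₀ e' v := by
  subst h; rfl

lemma locus_comp {S T : Scheme.{u}} (f : S ⟶ T) (g : T ⟶ prodP k V) (W : NZ k V) (w : W.1) :
    locus (f ≫ g) W w = f ⁻¹ᵁ locus g W w := by
  simp only [locus, comp, Category.assoc, Scheme.Hom.comp_preimage]

lemma appLE_coord {S T : Scheme.{u}} (f : S ⟶ T) (g : T ⟶ prodP k V) (W : NZ k V) (w v : W.1)
    {U : T.Opens} (e : U ≤ locus g W w) {U' : S.Opens} (h : U' ≤ f ⁻¹ᵁ U)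
    (e' : U' ≤ locus (f ≫ g) W w) :
    (f.appLE U U' h).hom (coord (comp g W) w e v) = coord (comp (f ≫ g) W) w e' v :=
  (coord_comp (comp g W) w v e f h (h.trans (f.preimage_mono e))).trans
    (coord_congr (Category.assoc _ _ _).symm _ _ _ _)

lemma Incidence.precomp {S T : Scheme.{u}} (f : S ⟶ T) (g : T ⟶ prodP k V) (H : Incidence g) :
    Incidence (f ≫ g) := by
  rw [incidence_iff] at H ⊢
  intro W'' W' h w' w'' v U e' e''
  have hU : U ≤ f ⁻¹ᵁ (locus g W' w' ⊓ locus g W'' w'') := by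
    rw [Scheme.Hom.preimage_inf, ← locus_comp, ← locus_comp]
    exact le_inf e' e''
  rw [← appLE_coord f g W' w' _ (U := locus g W' w' ⊓ locus g W'' w'') inf_le_left hU,
    ← appLE_coord f g W' w' _ (U := locus g W' w' ⊓ locus g W'' w'') inf_le_left hU,
    ← appLE_coord f g W'' w'' _ (U := locus g W' w' ⊓ locus g W'' w'') inf_le_right hU,
    ← map_mul, H W'' W' h w' w'' v _ inf_le_left inf_le_right]

/-- The incidence condition descends along scheme-theoretically dominant morphisms. -/
lemma Incidence.of_comp {S T : Scheme.{u}} (f : S ⟶ T) (g : T ⟶ prodP k V)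
    (hf : ∀ U, Function.Injective (f.app U)) (H : Incidence (f ≫ g)) : Incidence g := by
  rw [incidence_iff] at H ⊢
  intro W'' W' h w' w'' v U e' e''
  have h1 := H W'' W' h w' w'' v (f ⁻¹ᵁ U) (by rw [locus_comp]; exact f.preimage_mono e')
    (by rw [locus_comp]; exact f.preimage_mono e'')
  rw [← appLE_coord f g W' w' _ e' le_rfl, ← appLE_coord f g W' w' _ e' le_rfl,
    ← appLE_coord f g W'' w'' _ e'' le_rfl, ← map_mul, ← Scheme.Hom.app_eq_appLE] at h1
  exact hf U h1

lemma ClosedCond.precomp {F : Set (Submodule k V)} {S T : Scheme.{u}} (f : S ⟶ T)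
    (g : T ⟶ prodP k V) (H : ClosedCond F g) : ClosedCond F (f ≫ g) := by
  rw [closedCond_iff] at H ⊢
  intro W'' W' h hs w' v U e'
  rw [← appLE_coord f g W' w' _ le_rfl (by rw [← locus_comp]; exact e'), H W'' W' h hs, map_zero]

/-- The closed condition descends along scheme-theoretically dominant morphisms. -/
lemma ClosedCond.of_comp {F : Set (Submodule k V)} {S T : Scheme.{u}} (f : S ⟶ T)
    (g : T ⟶ prodP k V) (hf : ∀ U, Function.Injective (f.app U)) (H : ClosedCond F (f ≫ g)) :
    ClosedCond F g := by
  rw [closedCond_iff] at H ⊢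
  intro W'' W' h hs w' v U e'
  have h1 := H W'' W' h hs w' v (f ⁻¹ᵁ U) (by rw [locus_comp]; exact f.preimage_mono e')
  rw [← appLE_coord f g W' w' _ e' le_rfl, ← Scheme.Hom.app_eq_appLE] at h1
  exact hf U (h1.trans (map_zero _).symm)

/-- The incidence relation in coordinates can be checked for one normalization. -/
lemma incidence_coord_of {S : Scheme.{u}} {f : S ⟶ prodP k V} {W'' W' : NZ k V} (h : W''.1 ≤ W'.1)
    {U₀ : S.Opens} {a' : W'.1} {a'' : W''.1} (h' : U₀ ≤ locus f W' a') (h'' : U₀ ≤ locus f W'' a'')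
    (H : ∀ v, coord (comp f W') a' h' (Submodule.inclusion h v) =
      coord (comp f W') a' h' (Submodule.inclusion h a'') * coord (comp f W'') a'' h'' v)
    (w' : W'.1) (w'' v : W''.1) {U : S.Opens} (hU : U ≤ U₀) (e' : U ≤ locus f W' w')
    (e'' : U ≤ locus f W'' w'') :
    coord (comp f W') w' e' (Submodule.inclusion h v) =
      coord (comp f W') w' e' (Submodule.inclusion h w'') * coord (comp f W'') w'' e'' v := by
  have h1 : ∀ v, coord (comp f W') w' e' (Submodule.inclusion h v) =
      coord (comp f W') w' e' (Submodule.inclusion h a'') *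
        coord (comp f W'') a'' (hU.trans h'') v := by
    intro v
    have h2 := congrArg (S.presheaf.map (homOfLE hU).op).hom (H v)
    rw [map_mul, coord_res, coord_res, coord_res] at h2
    rw [coord_trans (comp f W') w' a' _ e' (hU.trans h'), h2,
      coord_trans (comp f W') w' a' (Submodule.inclusion h a'') e' (hU.trans h'), mul_assoc]
  rw [h1, h1 w'', coord_trans (comp f W'') a'' w'' _ (hU.trans h'') e'', mul_assoc]

end Functoriality

section Lift
variable {k V : Type u} [Field k] [AddCommGroup V] [Module k V] [Finite k] [Module.Finite k V]
  {S : Scheme.{u}}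

/-- The morphism to `∏ P_W` with given components. -/
def prodP.lift (s : S ⟶ Spec (.of k)) (g : ∀ W : NZ k V, S ⟶ P k W.1)
    (h : ∀ W, g W ≫ P.str k W.1 = s) : S ⟶ prodP k V :=
  WidePullback.lift s g h

variable (s : S ⟶ Spec (.of k)) (g : ∀ W : NZ k V, S ⟶ P k W.1) (h : ∀ W, g W ≫ P.str k W.1 = s)

lemma prodP.comp_lift (W : NZ k V) : comp (prodP.lift s g h) W = g W :=
  WidePullback.lift_π (fun W : NZ k V => P.str k W.1) s g h W

lemma prodP.lift_str : prodP.lift s g h ≫ prodP.str k V = s :=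
  WidePullback.lift_base (fun W : NZ k V => P.str k W.1) s g h

lemma prodP.hom_ext {f f' : S ⟶ prodP k V} (h0 : f ≫ prodP.str k V = f' ≫ prodP.str k V)
    (h : ∀ W, comp f W = comp f' W) : f = f' :=
  WidePullback.hom_ext (fun W : NZ k V => P.str k W.1) _ _ h h0

end Lift

section ChartMap
variable {n : ℕ} {k V : Type u} [Field k] [AddCommGroup V] [Module k V] [Finite k]
  [Module.Finite k V] (b : Module.Basis (Fin (n + 1)) k V)

/-- `v ↦ v / w` on a subspace contained in the step of index `i`, where `w` has leading
index `i`. -/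
def fracMap {i : Fin (n + 1)} {W : Submodule k V} (hW : W ≤ filt b i) {w : V} (hw : Lead b i w) :
    W →ₗ[k] chartRing b where
  toFun v := chartFrac (hW v.2) hw
  map_add' v v' := Subtype.ext (by
    rw [Subalgebra.coe_add, coe_chartFrac, coe_chartFrac, coe_chartFrac, Submodule.coe_add, map_add,
      add_div])
  map_smul' c v := Subtype.ext (by
    rw [RingHom.id_apply, Subalgebra.coe_smul, coe_chartFrac, coe_chartFrac, Submodule.coe_smul,
      map_smul, smul_div_assoc])

/-- The spectrum of the chart ring. -/
abbrev chart : Scheme.{u} := Spec (.of (chartRing b))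

/-- The index of a non-zero subspace with respect to the flag of a basis. -/
def leadIndex (W : NZ k V) : Fin (n + 1) := (exists_lead b W.1 W.2).choose

lemma le_filt_leadIndex (W : NZ k V) : W.1 ≤ filt b (leadIndex b W) :=
  (exists_lead b W.1 W.2).choose_spec.1

/-- A vector of a non-zero subspace `W` with the same leading index as `W`. -/
def leadVec (W : NZ k V) : W.1 :=
  ⟨(exists_lead b W.1 W.2).choose_spec.2.choose, (exists_lead b W.1 W.2).choose_spec.2.choose_spec.1⟩

lemma lead_leadVec (W : NZ k V) : Lead b (leadIndex b W) (leadVec b W : V) :=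
  (exists_lead b W.1 W.2).choose_spec.2.choose_spec.2

/-- The component in `P_W` of the morphism from the chart to `∏ P_W`. -/
def chartComp (W : NZ k V) : chart b ⟶ P k W.1 :=
  P.ofLinear (fracMap b (le_filt_leadIndex b W) (lead_leadVec b W)) (leadVec b W)
    (chartFrac_self b (lead_leadVec b W))

/-- The morphism from the chart to `∏ P_W` whose component in `P_W` is given by `v ↦ v / w` for a
vector `w` of `W` with minimal leading index. -/
def chartMap : chart b ⟶ prodP k V :=
  prodP.lift (Spec.map (CommRingCat.ofHom (algebraMap k (chartRing b)))) (chartComp b)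
    fun _ => P.ofLinear_str _ _ _

lemma comp_chartMap (W : NZ k V) : comp (chartMap b) W = chartComp b W :=
  prodP.comp_lift _ _ _ _

lemma chartMap_str : chartMap b ≫ prodP.str k V =
    Spec.map (CommRingCat.ofHom (algebraMap k (chartRing b))) :=
  prodP.lift_str _ _ _

lemma top_le_locus_leadVec (W : NZ k V) : ⊤ ≤ locus (chartMap b) W (leadVec b W) := by
  rw [locus, comp_chartMap]
  exact (P.ofLinear_preimage _ _ _).ge

lemma coord_leadVec (W : NZ k V) (v : W.1) :
    coord (comp (chartMap b) W) (leadVec b W) (top_le_locus_leadVec b W) v =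
      (Scheme.ΓSpecIso (.of (chartRing b))).inv.hom
        (chartFrac (le_filt_leadIndex b W v.2) (lead_leadVec b W)) := by
  rw [coord_congr (comp_chartMap b W) _ _ _ (P.ofLinear_preimage _ _ _).ge]
  exact P.coord_ofLinear _ _ _ _ _

variable {b} in
lemma top_le_locus_chartMap {W : NZ k V} {i : Fin (n + 1)} (hW : W.1 ≤ filt b i) {w : W.1}
    (hw : Lead b i (w : V)) : ⊤ ≤ locus (chartMap b) W w := by
  have h1 := basicOpen_coord (comp (chartMap b) W) (leadVec b W) w (top_le_locus_leadVec b W)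
  have h2 : IsUnit (coord (comp (chartMap b) W) (leadVec b W) (top_le_locus_leadVec b W) w) := by
    rw [coord_leadVec]
    refine IsUnit.map _ (IsUnit.of_mul_eq_one (chartFrac (hW (leadVec b W).2) hw) (Subtype.ext ?_))
    rw [Subalgebra.coe_mul, coe_chartFrac, coe_chartFrac, div_mul_div_cancel₀'
      hw.vec_ne_zero, div_self (lead_leadVec b W).vec_ne_zero, Subalgebra.coe_one]
  rw [(Scheme.basicOpen_of_isUnit _ h2), top_inf_eq] at h1
  exact h1.le

variable {b} in
/-- The coordinates of the chart can be computed with any vector of minimal leading index. -/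
lemma coord_chartMap {W : NZ k V} {i : Fin (n + 1)} (hW : W.1 ≤ filt b i) {w : W.1}
    (hw : Lead b i (w : V)) (v : W.1) :
    coord (comp (chartMap b) W) w (top_le_locus_chartMap hW hw) v =
      (Scheme.ΓSpecIso (.of (chartRing b))).inv.hom (chartFrac (hW v.2) hw) := by
  have h1 := coord_trans _ (leadVec b W) w v (top_le_locus_leadVec b W)
    (top_le_locus_chartMap hW hw)
  rw [coord_leadVec, coord_leadVec] at h1
  have h2 := congrArg ((Scheme.ΓSpecIso (.of (chartRing b))).inv.hom
    (chartFrac (hW (leadVec b W).2) hw) * ·) h1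
  simp only [← mul_assoc, ← map_mul] at h2
  have h3 : chartFrac (hW (leadVec b W).2) hw *
      chartFrac (le_filt_leadIndex b W w.2) (lead_leadVec b W) = 1 := by
    refine Subtype.ext ?_
    rw [Subalgebra.coe_mul, coe_chartFrac, coe_chartFrac, div_mul_div_cancel₀'
      (lead_leadVec b W).vec_ne_zero, div_self hw.vec_ne_zero, Subalgebra.coe_one]
  have h4 : chartFrac (hW (leadVec b W).2) hw *
      chartFrac (le_filt_leadIndex b W v.2) (lead_leadVec b W) = chartFrac (hW v.2) hw := by
    refine Subtype.ext ?_
    rw [Subalgebra.coe_mul, coe_chartFrac, coe_chartFrac, coe_chartFrac, mul_comm,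
      div_mul_div_cancel₀ (lead_leadVec b W).vec_ne_zero]
  rw [h3, h4, map_one, one_mul] at h2
  exact h2.symm

lemma incidence_chartMap : Incidence (chartMap b) := by
  rw [incidence_iff]
  intro W'' W' h w' w'' v U e' e''
  refine incidence_coord_of h (top_le_locus_leadVec b W') (top_le_locus_leadVec b W'') ?_ _ _ _
    le_top _ _
  intro v
  simp only [coord_leadVec, ← map_mul]
  congr 1
  refine Subtype.ext ?_
  rw [Subalgebra.coe_mul, coe_chartFrac, coe_chartFrac, coe_chartFrac, Submodule.coe_inclusion,
    Submodule.coe_inclusion]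
  have h1 := (lead_leadVec b W').vec_ne_zero
  have h2 := (lead_leadVec b W'').vec_ne_zero
  field_simp

end ChartMap

/-! ### The universal property of a chart -/

section ChartMap
variable {n : ℕ} {k V : Type u} [Field k] [AddCommGroup V] [Module k V] [Finite k]
  [Module.Finite k V] (b : Module.Basis (Fin (n + 1)) k V) {S : Scheme.{u}}

lemma toSpecΓ_comp_appTop {A : CommRingCat.{u}} (φ : A ⟶ Γ(S, ⊤)) :
    (Scheme.ΓSpecIso A).inv ≫ (S.toSpecΓ ≫ Spec.map φ).appTop = φ := by
  rw [Scheme.Hom.comp_appTop, ← Scheme.ΓSpecIso_inv_naturality_assoc, Scheme.toSpecΓ_appTop,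
    Iso.inv_hom_id, Category.comp_id]

lemma appLE_top_top_apply {X Y : Scheme.{u}} (f : X ⟶ Y) (h : ⊤ ≤ f ⁻¹ᵁ ⊤) (a : Γ(Y, ⊤)) :
    (f.appLE ⊤ ⊤ h).hom a = f.appTop.hom a :=
  congrArg (fun φ => φ.hom a) (appLE_top_top f h)

lemma scalars_top (s : S ⟶ Spec (.of k)) :
    scalars s ⊤ = (Scheme.ΓSpecIso (.of k)).inv ≫ s.appTop := by
  have : S.presheaf.map (homOfLE (le_top (a := (⊤ : S.Opens)))).op = 𝟙 _ :=
    S.presheaf.map_id _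
  rw [scalars, this, Category.comp_id]

lemma hom_Spec_ext {A : CommRingCat.{u}} {f g : S ⟶ Spec A}
    (h : ∀ a, f.appTop.hom ((Scheme.ΓSpecIso A).inv.hom a) =
      g.appTop.hom ((Scheme.ΓSpecIso A).inv.hom a)) : f = g := by
  apply ext_of_isAffine
  rw [← cancel_epi (Scheme.ΓSpecIso _).inv]
  ext a
  exact h a

/-- The non-zero step of the flag of a basis. -/
def step (i : Fin (n + 1)) : NZ k V :=
  ⟨filt b i, (Submodule.ne_bot_iff _).mpr ⟨b i, basis_mem_filt b le_rfl, b.ne_zero i⟩⟩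

/-- The morphism `f` to `∏ P_W` maps to the chart of `b`: for all non-zero subspaces `W`, it
maps to the charts of `P_W` belonging to the vectors of minimal leading index. -/
def InChart (f : S ⟶ prodP k V) : Prop :=
  ∀ (W : NZ k V) (i : Fin (n + 1)), W.1 ≤ filt b i → ∀ w : W.1, Lead b i (w : V) →
    ⊤ ≤ locus f W w

lemma inChart_chartMap : InChart b (chartMap b) := fun _ _ hW _ hw => top_le_locus_chartMap hW hw

/-- An incident tuple whose components lie in the charts prescribed by `b` factors through the chart
of `b`: its normalized linear forms on the steps of the flag define a homomorphism on the chart ring. -/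
lemma exists_comp_chartMap {f : S ⟶ prodP k V} (hf : Incidence f) (hb : InChart b f) :
    ∃ g : S ⟶ chart b, g ≫ chartMap b = f := by
  rw [incidence_iff] at hf
  let s := strOf f
  have e : ∀ i, ⊤ ≤ locus f (step b i) ⟨b i, basis_mem_filt b le_rfl⟩ := fun i =>
    hb _ i le_rfl _ (lead_basis b i)
  let μ : ∀ i, filt b i →ₗ[k] Sec s ⊤ := fun i =>
    coordSection s (comp f (step b i)) (comp_str f _) ⟨b i, basis_mem_filt b le_rfl⟩ (e i)
  have hμ : ∀ i v, μ i v = coord (comp f (step b i)) _ (e i) v := fun _ _ => rfl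
  have hunit : ∀ i w (hw : Lead b i w), IsUnit (μ i ⟨w, hw.1⟩) := fun i w hw =>
    isUnit_coord _ _ _ _ (hb (step b i) i le_rfl ⟨w, hw.1⟩ hw)
  obtain ⟨φ, hφ1, hφ2⟩ := exists_chartRing_hom b μ (fun i => coord_self _ _ _)
    (fun i l hil v => hf (step b l) (step b i) (filt_anti b hil) _ ⟨b l, basis_mem_filt b le_rfl⟩
      v ⊤ (e i) (e l)) hunit
  let φ' : CommRingCat.of (chartRing b) ⟶ Γ(S, ⊤) := CommRingCat.ofHom φ
  have hstr : strOf ((S.toSpecΓ ≫ Spec.map φ') ≫ chartMap b) = strOf f := by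
    rw [strOf, Category.assoc, chartMap_str, Category.assoc, ← Spec.map_comp]
    refine hom_Spec_ext fun c => ?_
    have h1 := congrArg (fun ψ => ψ.hom c) (toSpecΓ_comp_appTop
      (CommRingCat.ofHom (algebraMap k (chartRing b)) ≫ φ'))
    have h2 := congrArg (fun ψ => ψ.hom c) (scalars_top (strOf f))
    exact h1.trans ((hφ1 c).trans h2)
  refine ⟨S.toSpecΓ ≫ Spec.map φ', prodP.hom_ext hstr fun W => ?_⟩
  · have eW := inChart_chartMap b W (leadIndex b W) (le_filt_leadIndex b W) (leadVec b W)
      (lead_leadVec b W)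
    have eW' := hb W (leadIndex b W) (le_filt_leadIndex b W) (leadVec b W) (lead_leadVec b W)
    have eg : ⊤ ≤ locus ((S.toSpecΓ ≫ Spec.map φ') ≫ chartMap b) W (leadVec b W) := by
      rw [locus_comp]
      exact Scheme.Hom.preimage_mono _ eW
    refine P.hom_ext_of_coord ?_ _ eg eW' fun v => ?_
    · rw [comp_str, comp_str, hstr]
    · rw [← appLE_coord _ _ W _ v eW le_top eg, coord_leadVec]
      have h1 := congrArg (fun ψ => ψ.hom
        (chartFrac (le_filt_leadIndex b W v.2) (lead_leadVec b W))) (toSpecΓ_comp_appTop φ')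
      refine (appLE_top_top_apply _ le_top _).trans (h1.trans ?_)
      refine (hunit _ _ (lead_leadVec b W)).mul_left_cancel ?_
      refine (mul_comm _ _).trans ((hφ2 _ _ _ (le_filt_leadIndex b W v.2)
        (lead_leadVec b W)).trans ?_)
      exact hf W (step b (leadIndex b W)) (le_filt_leadIndex b W) _ (leadVec b W) v ⊤ (e _) eW'

/-- The functions `v / w` generate the chart ring, and they are coordinates of the tuple. -/
lemma mono_chartMap : Mono (chartMap b) := by
  refine ⟨fun {S} g g' h => hom_Spec_ext fun a => ?_⟩
  refine DFunLike.congr_fun (chartRing_hom_ext b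
    (φ := (((Scheme.ΓSpecIso (.of (chartRing b))).inv ≫ g.appTop).hom))
    (ψ := (((Scheme.ΓSpecIso (.of (chartRing b))).inv ≫ g'.appTop).hom)) ?_ ?_) a
  · intro c
    have h1 := congrArg (· ≫ prodP.str k V) h
    simp only [Category.assoc, chartMap_str] at h1
    have h2 := congrArg (fun ψ => ((Scheme.ΓSpecIso (.of k)).inv ≫ ψ.appTop).hom c) h1
    simp only [Scheme.Hom.comp_appTop, ← Scheme.ΓSpecIso_inv_naturality_assoc] at h2
    exact h2
  · intro i v w hv hw
    have eW := inChart_chartMap b (step b i) i le_rfl ⟨w, hw.1⟩ hw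
    have key : ∀ (g : S ⟶ chart b) (eg : ⊤ ≤ locus (g ≫ chartMap b) (step b i) ⟨w, hw.1⟩),
        g.appTop.hom ((Scheme.ΓSpecIso (.of (chartRing b))).inv.hom (chartFrac hv hw)) =
        coord (comp (g ≫ chartMap b) (step b i)) ⟨w, hw.1⟩ eg ⟨v, hv⟩ := by
      intro g eg
      rw [← appLE_coord g _ (step b i) _ _ eW le_top eg, coord_chartMap (b := b) (W := step b i) le_rfl hw]
      exact (appLE_top_top_apply g le_top _).symm
    have eg : ∀ g : S ⟶ chart b, ⊤ ≤ locus (g ≫ chartMap b) (step b i) ⟨w, hw.1⟩ := fun g => by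
      rw [locus_comp]; exact g.preimage_mono eW
    exact (key g (eg g)).trans ((coord_congr (by rw [h]) _ _ _ _).trans (key g' (eg g')).symm)

end ChartMap

/-! ### Every point of an incident tuple lies in a chart -/

section LinearAlgebra
variable {k V : Type u} [Field k] [AddCommGroup V] [Module k V] [Module.Finite k V]

/-- A linearly independent family spanning `U` whose complete flag refines `N`. -/
lemma exists_adapted_family (N : Submodule k V → Submodule k V) (hN : ∀ W, W ≠ ⊥ → N W < W)
    (n : ℕ) : ∀ U : Submodule k V, Module.finrank k U = n → ∃ v : Fin n → V,
      LinearIndependent k v ∧ Submodule.span k (Set.range v) = U ∧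
      ∀ i, N (Submodule.span k (v '' Set.Ici i)) ≤ Submodule.span k (v '' Set.Ioi i) := by
  induction n with
  | zero =>
    intro U hU
    refine ⟨Fin.elim0, linearIndependent_empty_type, ?_, fun i => i.elim0⟩
    rw [Submodule.finrank_eq_zero.mp hU, Set.range_eq_empty, Submodule.span_empty]
  | succ n ih =>
    intro U hU
    have hU0 : U ≠ ⊥ := by
      rintro rfl
      simp at hU
    have h1 : (N U).comap U.subtype < ⊤ := by
      rw [lt_top_iff_ne_top]
      intro h
      refine (hN U hU0).not_ge fun u hu => ?_
      have : (⟨u, hu⟩ : U) ∈ (N U).comap U.subtype := h ▸ Submodule.mem_top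
      exact this
    obtain ⟨φ, hφ0, hφ⟩ := Submodule.exists_le_ker_of_lt_top _ h1
    have h2 : Module.finrank k ((LinearMap.ker φ).map U.subtype) = n := by
      have h3 := Module.Dual.finrank_ker_add_one_of_ne_zero hφ0
      rw [hU] at h3
      rw [Submodule.finrank_map_subtype_eq]
      omega
    obtain ⟨v, hv1, hv2, hv3⟩ := ih _ h2
    obtain ⟨y, hy⟩ : ∃ y, φ y ≠ 0 := by
      by_contra! H
      exact hφ0 (LinearMap.ext H)
    have hyv : (y : V) ∉ Submodule.span k (Set.range v) := by
      rw [hv2]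
      rintro ⟨z, hz, hzy⟩
      obtain rfl : z = y := Subtype.ext hzy
      exact hy hz
    have hli : LinearIndependent k (Fin.cons (y : V) v : Fin (n + 1) → V) :=
      linearIndependent_finCons.mpr ⟨hv1, hyv⟩
    have hspan : Submodule.span k (Set.range (Fin.cons (y : V) v : Fin (n + 1) → V)) = U := by
      refine Submodule.eq_of_le_of_finrank_eq ?_ ?_
      · rw [Submodule.span_le, Fin.range_cons, Set.insert_subset_iff]
        refine ⟨y.2, ?_⟩
        rw [← Submodule.span_le, hv2]
        exact Submodule.map_subtype_le _ _
      · rw [finrank_span_eq_card hli, hU, Fintype.card_fin]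
    have hIoi : (Fin.cons (y : V) v : Fin (n + 1) → V) '' Set.Ioi 0 = Set.range v := by
      ext x
      constructor
      · rintro ⟨j, hj, rfl⟩
        obtain ⟨j, rfl⟩ := Fin.exists_succ_eq.mpr (Fin.pos_iff_ne_zero.mp hj)
        exact ⟨j, rfl⟩
      · rintro ⟨j, rfl⟩
        exact ⟨j.succ, Fin.succ_pos j, rfl⟩
    have hs : ∀ (s : Set (Fin n)) (t : Set (Fin (n + 1))), Fin.succ '' s = t →
        (Fin.cons (y : V) v : Fin (n + 1) → V) '' t = v '' s := by
      rintro s _ rfl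
      rw [Set.image_image]
      rfl
    refine ⟨_, hli, hspan, fun i => ?_⟩
    induction i using Fin.cases with
    | zero =>
      rw [hIoi, hv2, show Set.Ici (0 : Fin (n + 1)) = Set.univ from Set.Ici_bot, Set.image_univ, hspan]
      exact fun u hu => ⟨⟨u, (hN U hU0).le hu⟩, hφ hu, rfl⟩
    | succ i =>
      rw [hs (Set.Ici i) _ (Fin.image_succ_Ici i), hs (Set.Ioi i) _ (Fin.image_succ_Ioi i)]
      exact hv3 i

/-- A basis such that no vector of a subspace `W` with minimal leading index lies in `N W`. -/
lemma exists_adapted_basis {n : ℕ} (hn : Module.finrank k V = n + 1)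
    (N : Submodule k V → Submodule k V) (hN : ∀ W, W ≠ ⊥ → N W < W)
    (hN2 : ∀ W W', W ≤ W' → ¬ W ≤ N W' → N W = N W' ⊓ W) :
    ∃ b : Module.Basis (Fin (n + 1)) k V, ∀ (W : Submodule k V) (i : Fin (n + 1)),
      W ≤ filt b i → ∀ w ∈ W, Lead b i w → w ∉ N W := by
  obtain ⟨v, hv1, hv2, hv3⟩ := exists_adapted_family N hN (n + 1) ⊤ (by rw [finrank_top, hn])
  let b := Module.Basis.mk hv1 hv2.ge
  have hb : ⇑b = v := Module.Basis.coe_mk hv1 hv2.ge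
  have hspan : ∀ i, Submodule.span k (v '' Set.Ici i) = filt b i := by
    intro i
    ext x
    rw [← hb, b.mem_span_image, mem_filt]
    constructor
    · intro h j hj
      by_contra hne
      exact absurd (h (Finsupp.mem_support_iff.mpr hne)) (not_le.mpr hj)
    · intro h j hj
      by_contra hne
      exact Finsupp.mem_support_iff.mp hj (h j (not_le.mp hne))
  refine ⟨b, fun W i hW w hw hlead hwN => ?_⟩
  have h1 : w ∉ N (filt b i) := by
    intro h
    have h2 := hv3 i (by rwa [hspan])
    rw [← hb, b.mem_span_image] at h2
    exact lt_irrefl i (h2 (Finsupp.mem_support_iff.mpr hlead.2))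
  rw [hN2 W (filt b i) hW fun h => h1 (h hw)] at hwN
  exact h1 hwN.1

end LinearAlgebra

section Vanishing
variable {k V : Type u} [Field k] [AddCommGroup V] [Module k V]

/-- The subspace of the vectors that vanish at a point of `P_V`. -/
def P.vanishing (y : P k V) : Submodule k V where
  carrier := {v | y ∉ P.chart k V v}
  add_mem' {v w} hv hw := by
    simp only [Proj.mem_basicOpen, not_not, Set.mem_ofPred_eq, map_add] at hv hw ⊢
    exact Ideal.add_mem _ hv hw
  zero_mem' := by
    simp only [Set.mem_ofPred_eq, P.chart_zero]
    exact id
  smul_mem' c v hv := by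
    simp only [Proj.mem_basicOpen, not_not, Set.mem_ofPred_eq, map_smul, Algebra.smul_def] at hv ⊢
    exact Ideal.mul_mem_left _ _ hv

variable [Finite k] [Module.Finite k V] {S : Scheme.{u}}

/-- The subspace of the vectors of `W` that vanish at the component in `P_W` of a point of `∏ P_W`. -/
def vanishing (f : S ⟶ prodP k V) (x : S) (W : Submodule k V) : Submodule k V :=
  open Classical in
  if h : W ≠ ⊥ then (P.vanishing (comp f ⟨W, h⟩ x)).map W.subtype else ⊥

variable (f : S ⟶ prodP k V) (x : S)

lemma mem_vanishing (W : NZ k V) (w : W.1) : (w : V) ∈ vanishing f x W.1 ↔ x ∉ locus f W w := by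
  rw [vanishing, dif_pos W.2]
  constructor
  · rintro ⟨w', hw', h⟩
    obtain rfl := Subtype.ext h
    exact hw'
  · intro h
    exact ⟨w, h, rfl⟩

lemma vanishing_le (W : Submodule k V) : vanishing f x W ≤ W := by
  rw [vanishing]
  split_ifs with h
  · exact Submodule.map_subtype_le _ _
  · exact bot_le

lemma vanishing_lt {W : Submodule k V} (hW : W ≠ ⊥) : vanishing f x W < W := by
  refine lt_of_le_not_ge (vanishing_le f x W) fun h => ?_
  obtain ⟨w, hw⟩ := P.iSup_chart (comp f ⟨W, hW⟩ x)
  exact (mem_vanishing f x ⟨W, hW⟩ w).mp (h w.2) hw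

variable {f}

/-- For an incident tuple, the form on `W'` at a point restricts to a multiple of the form on `W`; if
this restriction is not zero, then both have the same kernel in `W`. -/
lemma vanishing_eq_inf (hf : Incidence f) {W W' : Submodule k V} (h : W ≤ W')
    (h' : ¬ W ≤ vanishing f x W') : vanishing f x W = vanishing f x W' ⊓ W := by
  have hW : W ≠ ⊥ := by
    rintro rfl; exact h' bot_le
  have hW' : W' ≠ ⊥ := by
    rintro rfl; exact hW (le_bot_iff.mp h)
  rw [incidence_iff] at hf
  obtain ⟨w, hw, hwN⟩ := SetLike.not_le_iff_exists.mp h'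
  obtain ⟨a, ha⟩ := P.iSup_chart (comp f ⟨W, hW⟩ x)
  have hwx : x ∈ locus f ⟨W', hW'⟩ ⟨w, h hw⟩ := by
    by_contra hx
    exact hwN ((mem_vanishing f x ⟨W', hW'⟩ ⟨w, h hw⟩).mpr hx)
  -- on this neighbourhood of `x` the form on `W` is a unit multiple of the form on `W'`
  let U : S.Opens := locus f ⟨W', hW'⟩ ⟨w, h hw⟩ ⊓ locus f ⟨W, hW⟩ a
  have key : ∀ v : W, _ := fun v => hf ⟨W, hW⟩ ⟨W', hW'⟩ h ⟨w, h hw⟩ a v U inf_le_left inf_le_right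
  have hu : IsUnit (coord (comp f ⟨W', hW'⟩) ⟨w, h hw⟩ (U := U) inf_le_left (Submodule.inclusion h a)) := by
    have := key ⟨w, hw⟩
    exact IsUnit.of_mul_eq_one _ (this.symm.trans (coord_self _ _ _))
  have hx : x ∈ U := ⟨hwx, ha⟩
  ext v
  rw [Submodule.mem_inf]
  by_cases hv : v ∈ W
  · have h1 := congrArg S.basicOpen (key ⟨v, hv⟩)
    rw [Scheme.basicOpen_mul, Scheme.basicOpen_of_isUnit _ hu, basicOpen_coord, basicOpen_coord] at h1
    have h2 := congrArg (x ∈ ·) h1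
    rw [mem_vanishing f x ⟨W, hW⟩ ⟨v, hv⟩, mem_vanishing f x ⟨W', hW'⟩ ⟨v, h hv⟩]
    simp only [eq_iff_iff] at h2
    have h3 : x ∈ locus f ⟨W', hW'⟩ ⟨v, h hv⟩ ↔ x ∈ locus f ⟨W, hW⟩ ⟨v, hv⟩ :=
      ⟨fun h => (h2.mp ⟨hx, h⟩).2.2, fun h => (h2.mpr ⟨hx, hx, h⟩).2⟩
    rw [h3]
    exact (and_iff_left hv).symm
  · exact ⟨fun h => absurd (vanishing_le f x W h) hv, fun h => absurd h.2 hv⟩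

variable {n : ℕ} (b : Module.Basis (Fin (n + 1)) k V) (f)

/-- The open locus in `S` on which a point of `∏ P_W` lies in the chart of the basis `b`. -/
def chartLocus : S.Opens where
  carrier := {x | ∀ (W : NZ k V) (i : Fin (n + 1)), W.1 ≤ filt b i → ∀ w : W.1,
    Lead b i (w : V) → x ∈ locus f W w}
  is_open' := by
    have : Finite V := Module.finite_of_finite k
    simp only [Set.ofPred_forall]
    exact isOpen_iInter_of_finite fun W => isOpen_iInter_of_finite fun i =>
      isOpen_iInter_of_finite fun _ => isOpen_iInter_of_finite fun w =>
      isOpen_iInter_of_finite fun _ => (locus f W w).isOpen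

lemma inChart_iff : InChart b f ↔ chartLocus f b = ⊤ :=
  ⟨fun h => top_le_iff.mp fun _ hx W i hW w hw => h W i hW w hw hx,
    fun h W i hW w hw _ hx => h.ge hx W i hW w hw⟩

lemma chartLocus_comp {T : Scheme.{u}} (g : T ⟶ S) :
    chartLocus (g ≫ f) b = g ⁻¹ᵁ chartLocus f b := by
  ext x
  change (∀ W i, _ → _) ↔ (∀ W i, _ → _)
  simp only [locus_comp]
  rfl

lemma inChart_ι : InChart b ((chartLocus f b).ι ≫ f) := by
  rw [inChart_iff, chartLocus_comp]
  simp

variable {f} in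
/-- A basis adapted to the vanishing subspaces at a point gives a chart that contains it. -/
lemma exists_mem_chartLocus (hn : Module.finrank k V = n + 1) (hf : Incidence f) (x : S) :
    ∃ b : Module.Basis (Fin (n + 1)) k V, x ∈ chartLocus f b := by
  obtain ⟨b, hb⟩ := exists_adapted_basis hn (vanishing f x) (fun W hW => vanishing_lt f x hW)
    (fun W W' h h' => vanishing_eq_inf x hf h h')
  refine ⟨b, fun W i hW w hw => ?_⟩
  by_contra hx
  exact hb W.1 i hW w w.2 hw ((mem_vanishing f x W w).mpr hx)

end Vanishing

/-! ### The functor of points of `B_V`, and its open charts -/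

section Representability
variable {k V : Type u} [Field k] [AddCommGroup V] [Module k V] [Finite k] [Module.Finite k V]
  {n : ℕ}

lemma Incidence.of_cover {S : Scheme.{u}} (f : S ⟶ prodP k V) (𝒰 : S.OpenCover)
    (h : ∀ i, Incidence (𝒰.f i ≫ f)) : Incidence f := by
  rw [incidence_iff]
  intro W'' W' hW w' w'' v U e' e''
  refine 𝒰.ext_elem _ _ fun i => ?_
  have h1 := (incidence_iff _).mp (h i) W'' W' hW w' w'' v (𝒰.f i ⁻¹ᵁ U)
    (by rw [locus_comp]; exact Scheme.Hom.preimage_mono _ e')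
    (by rw [locus_comp]; exact Scheme.Hom.preimage_mono _ e'')
  rwa [← appLE_coord _ f W' w' _ e' le_rfl, ← appLE_coord _ f W' w' _ e' le_rfl,
    ← appLE_coord _ f W'' w'' _ e'' le_rfl, ← map_mul, ← Scheme.Hom.app_eq_appLE] at h1

lemma ClosedCond.of_cover {F : Set (Submodule k V)} {S : Scheme.{u}} (f : S ⟶ prodP k V)
    (𝒰 : S.OpenCover) (h : ∀ i, ClosedCond F (𝒰.f i ≫ f)) : ClosedCond F f := by
  rw [closedCond_iff]
  intro W'' W' hW hs w' v U e'
  refine 𝒰.ext_elem _ _ fun i => ?_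
  have h1 := (closedCond_iff _ _).mp (h i) W'' W' hW hs w' v (𝒰.f i ⁻¹ᵁ U)
    (by rw [locus_comp]; exact Scheme.Hom.preimage_mono _ e')
  rw [← appLE_coord _ f W' w' _ e' le_rfl, ← Scheme.Hom.app_eq_appLE] at h1
  exact h1.trans (map_zero _).symm

instance : Finite (Module.Basis (Fin (n + 1)) k V) := by
  have : Finite V := Module.finite_of_finite k
  exact Finite.of_injective _ (DFunLike.coe_injective (F := Module.Basis (Fin (n + 1)) k V))

instance : Scheme.IsSeparated (prodP k V) :=
  ⟨by rw [← terminal.comp_from (prodP.str k V)]; infer_instance⟩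

variable [Nontrivial V]

/-- `B_V` represents the incident tuples. -/
theorem exists_lift_B_iff {S : Scheme.{u}} (f : S ⟶ prodP k V) :
    (∃ g : S ⟶ B k V, g ≫ B.ι k V = f) ↔ Incidence f := by
  obtain ⟨n, hn⟩ : ∃ n, Module.finrank k V = n + 1 :=
    Nat.exists_eq_succ_of_ne_zero Module.finrank_pos.ne'
  let X : Module.Basis (Fin (n + 1)) k V → Scheme.{u} := chart
  let τ : ∐ X ⟶ prodP k V := Sigma.desc chartMap
  have hτ : ∀ b, Sigma.ι X b ≫ τ = chartMap b := fun b => Sigma.ι_desc _ _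
  refine exists_lift_sInf_iff (fun f => Incidence f) Incidence.precomp Incidence.of_comp τ ?_ ?_ f
  · refine Incidence.of_cover _ (sigmaOpenCover X) fun b => ?_
    exact (hτ b).symm ▸ incidence_chartMap b
  · intro S f hf x
    obtain ⟨b, hb⟩ := exists_mem_chartLocus hn hf x
    obtain ⟨g, hg⟩ := exists_comp_chartMap b (hf.precomp (chartLocus f b).ι) (inChart_ι f b)
    exact ⟨_, hb, g ≫ Sigma.ι X b, by rw [Category.assoc, hτ, hg]⟩

lemma incidence_B : Incidence (B.ι k V) :=
  (exists_lift_B_iff _).mp ⟨𝟙 _, Category.id_comp _⟩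

instance : IsClosedImmersion (B.ι k V) :=
  inferInstanceAs (IsClosedImmersion (B.ideal k V).subschemeι)

section Charts
variable (b : Module.Basis (Fin (n + 1)) k V)

/-- The chart of `B_V` belonging to the basis `b`. -/
def B.chart : chart b ⟶ B k V := ((exists_lift_B_iff _).mpr (incidence_chartMap b)).choose

lemma B.chart_ι : B.chart b ≫ B.ι k V = chartMap b :=
  ((exists_lift_B_iff _).mpr (incidence_chartMap b)).choose_spec

/-- The chart of `b` has an inverse on its locus in `B_V`, as both represent the same functor. -/
lemma B.exists_comp_chart : ∃ g : (chartLocus (B.ι k V) b).toScheme ⟶ BV.chart b,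
    g ≫ B.chart b = (chartLocus (B.ι k V) b).ι := by
  obtain ⟨g, hg⟩ := exists_comp_chartMap b (incidence_B.precomp (chartLocus (B.ι k V) b).ι)
    (inChart_ι _ b)
  refine ⟨g, ?_⟩
  rw [← cancel_mono (B.ι k V), Category.assoc, B.chart_ι, hg]

lemma B.range_chart_subset : Set.range (B.chart b) ⊆ chartLocus (B.ι k V) b := by
  rintro _ ⟨y, rfl⟩
  have h1 := (inChart_iff _ b).mp (inChart_chartMap b)
  rw [← B.chart_ι, chartLocus_comp] at h1
  exact h1.ge (Set.mem_univ y)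

instance : Mono (B.chart b) := by
  have := mono_chartMap b
  rw [← B.chart_ι] at this
  exact mono_of_mono _ (B.ι k V)

instance : IsOpenImmersion (B.chart b) := by
  obtain ⟨g, hg⟩ := B.exists_comp_chart b
  let c := IsOpenImmersion.lift (chartLocus (B.ι k V) b).ι (B.chart b)
    (by rw [Scheme.Opens.range_ι]; exact B.range_chart_subset b)
  have hc : c ≫ (chartLocus (B.ι k V) b).ι = B.chart b := IsOpenImmersion.lift_fac _ _ _
  have h1 : c ≫ g = 𝟙 _ := by
    rw [← cancel_mono (B.chart b), Category.assoc, hg, hc, Category.id_comp]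
  have h2 : g ≫ c = 𝟙 _ := by
    rw [← cancel_mono (chartLocus (B.ι k V) b).ι, Category.assoc, hc, hg, Category.id_comp]
  have : IsIso c := ⟨g, h1, h2⟩
  rw [← hc]
  infer_instance

lemma B.opensRange_chart : (B.chart b).opensRange = chartLocus (B.ι k V) b := by
  refine le_antisymm (B.range_chart_subset b) fun x hx => ?_
  obtain ⟨g, hg⟩ := B.exists_comp_chart b
  exact ⟨g ⟨x, hx⟩, congrArg (fun φ : (chartLocus (B.ι k V) b).toScheme ⟶ B k V => φ ⟨x, hx⟩) hg⟩

lemma B.exists_mem_chart (hn : Module.finrank k V = n + 1) (x : B k V) :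
    ∃ b : Module.Basis (Fin (n + 1)) k V, ∃ y, B.chart b y = x := by
  obtain ⟨b, hb⟩ := exists_mem_chartLocus hn incidence_B x
  rw [← B.opensRange_chart] at hb
  exact ⟨b, hb⟩

lemma B.chart_str : B.chart b ≫ B.str k V =
    Spec.map (CommRingCat.ofHom (algebraMap k (chartRing b))) := by
  rw [B.str, ← Category.assoc, B.chart_ι, chartMap_str]

end Charts

end Representability

/-! ### The strata -/

section Strata
variable {k V : Type u} [Field k] [AddCommGroup V] [Module k V] [Finite k] [Module.Finite k V]

instance [Nontrivial V] : IsProper (B.str k V) := by unfold B.str; infer_instance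

instance [Nontrivial V] : Scheme.IsSeparated (B k V) :=
  ⟨by rw [← terminal.comp_from (B.str k V)]; infer_instance⟩

section ClosedStrata
variable {n : ℕ} (b : Module.Basis (Fin (n + 1)) k V) (F : Set (Submodule k V))

/-- The ideal of the intersection of a chart with `B_F`. -/
def flagIdeal : Ideal (chartRing b) :=
  Ideal.span {a | ∃ (W'' W' : NZ k V) (h : W''.1 ≤ W'.1), Separates F W''.1 W'.1 ∧ ∃ v : W''.1,
    a = chartFrac (le_filt_leadIndex b W' (h v.2)) (lead_leadVec b W')}

/-- In a chart the closed condition means that the functions in `flagIdeal` vanish. -/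
lemma closedCond_comp_chartMap {S : Scheme.{u}} (g : S ⟶ chart b) :
    ClosedCond F (g ≫ chartMap b) ↔ flagIdeal b F ≤
      RingHom.ker ((Scheme.ΓSpecIso (.of (chartRing b))).inv ≫ g.appTop).hom := by
  have eW : ∀ W, ⊤ ≤ locus (g ≫ chartMap b) W (leadVec b W) := fun W => by
    rw [locus_comp]
    exact g.preimage_mono (top_le_locus_leadVec b W)
  have key : ∀ (W : NZ k V) (v : W.1), coord (comp (g ≫ chartMap b) W) (leadVec b W) (eW W) v =
      ((Scheme.ΓSpecIso (.of (chartRing b))).inv ≫ g.appTop).hom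
        (chartFrac (le_filt_leadIndex b W v.2) (lead_leadVec b W)) := by
    intro W v
    rw [← appLE_coord _ _ W _ v (top_le_locus_leadVec b W) le_top, coord_leadVec]
    exact appLE_top_top_apply g le_top _
  rw [closedCond_iff, flagIdeal, Ideal.span_le]
  constructor
  · rintro H _ ⟨W'', W', h, hs, v, rfl⟩
    refine (key W' (Submodule.inclusion h v)).symm.trans ?_
    exact H W'' W' h hs _ v ⊤ (eW W')
  · intro H W'' W' h hs w' v U e'
    rw [coord_trans _ w' (leadVec b W') _ e' (le_top.trans (eW W')), ← coord_res _ _ _ (eW W') le_top,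
      key]
    have h1 := H ⟨W'', W', h, hs, v, rfl⟩
    refine (congrArg (fun a => _ * (S.presheaf.map (homOfLE le_top).op).hom a) h1).trans ?_
    rw [map_zero, mul_zero]

/-- The intersection of a chart with `B_F`. -/
abbrev flagChart : Scheme.{u} := Spec (.of (chartRing b ⧸ flagIdeal b F))

/-- The inclusion of the intersection of a chart with `B_F` into the chart. -/
def flagChartι : flagChart b F ⟶ chart b :=
  Spec.map (CommRingCat.ofHom (Ideal.Quotient.mk (flagIdeal b F)))

lemma closedCond_flagChartι : ClosedCond F (flagChartι b F ≫ chartMap b) := by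
  rw [closedCond_comp_chartMap]
  intro a ha
  rw [RingHom.mem_ker, flagChartι, ← Scheme.ΓSpecIso_inv_naturality]
  have : Ideal.Quotient.mk (flagIdeal b F) a = 0 := Ideal.Quotient.eq_zero_iff_mem.mpr ha
  exact (congrArg (Scheme.ΓSpecIso (.of (chartRing b ⧸ flagIdeal b F))).inv.hom this).trans
    (map_zero _)

/-- The closed condition on a chart is represented by the quotient by `flagIdeal`. -/
lemma exists_comp_flagChartι {S : Scheme.{u}} (g : S ⟶ chart b)
    (hg : ClosedCond F (g ≫ chartMap b)) : ∃ h : S ⟶ flagChart b F, h ≫ flagChartι b F = g := by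
  rw [closedCond_comp_chartMap] at hg
  let φ : CommRingCat.of (chartRing b ⧸ flagIdeal b F) ⟶ Γ(S, ⊤) :=
    CommRingCat.ofHom (Ideal.Quotient.lift (flagIdeal b F) _ hg)
  refine ⟨S.toSpecΓ ≫ Spec.map φ, hom_Spec_ext fun a => ?_⟩
  rw [flagChartι, Category.assoc, ← Spec.map_comp]
  exact congrArg (fun ψ => ψ.hom a) (toSpecΓ_comp_appTop
    (CommRingCat.ofHom (Ideal.Quotient.mk (flagIdeal b F)) ≫ φ))

/-- `B_F` represents the closed condition. -/
theorem exists_lift_BF_iff [Nontrivial V] {S : Scheme.{u}} (f : S ⟶ B k V) :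
    (∃ g : S ⟶ BF F, g ≫ BF.ι F = f) ↔ ClosedCond F (f ≫ B.ι k V) := by
  obtain ⟨n, hn⟩ : ∃ n, Module.finrank k V = n + 1 :=
    Nat.exists_eq_succ_of_ne_zero Module.finrank_pos.ne'
  let X : Module.Basis (Fin (n + 1)) k V → Scheme.{u} := fun b => flagChart b F
  let τ : ∐ X ⟶ B k V := Sigma.desc fun b => flagChartι b F ≫ B.chart b
  have hτ : ∀ b, Sigma.ι X b ≫ τ = flagChartι b F ≫ B.chart b := fun b => Sigma.ι_desc _ _
  refine exists_lift_sInf_iff (fun f => ClosedCond F (f ≫ B.ι k V)) ?_ ?_ τ ?_ ?_ f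
  · intro S T f g h
    rw [Category.assoc]
    exact h.precomp f
  · intro S T f g hf h
    rw [Category.assoc] at h
    exact h.of_comp f _ hf
  · have h1 : ∀ b, Sigma.ι X b ≫ τ ≫ B.ι k V = flagChartι b F ≫ chartMap b := fun b => by
      rw [reassoc_of% hτ, B.chart_ι]
    exact ClosedCond.of_cover _ (sigmaOpenCover X) fun b =>
      (h1 b).symm ▸ closedCond_flagChartι b F
  · intro S f hf x
    obtain ⟨b, y, hy⟩ := B.exists_mem_chart hn (f x)
    let U : S.Opens := f ⁻¹ᵁ (B.chart b).opensRange
    let g : U.toScheme ⟶ chart b := IsOpenImmersion.lift (B.chart b) (U.ι ≫ f) (by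
      rintro _ ⟨z, rfl⟩
      exact z.2)
    have hg : g ≫ B.chart b = U.ι ≫ f := IsOpenImmersion.lift_fac _ _ _
    have h2 : ClosedCond F (g ≫ chartMap b) := by
      rw [← B.chart_ι, ← Category.assoc, hg, Category.assoc]
      exact hf.precomp _
    obtain ⟨h, hh⟩ := exists_comp_flagChartι b F g h2
    exact ⟨U, ⟨y, hy⟩, h ≫ Sigma.ι X b, by rw [Category.assoc, hτ, reassoc_of% hh, hg]⟩

end ClosedStrata

variable {F : Set (Submodule k V)} {S : Scheme.{u}}

/-- The open condition says that only separated pairs `W'' ≤ W'` are such that the form on `W'`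
vanishes on `W''`. -/
lemma openCond_iff_vanishing (f : S ⟶ prodP k V) : OpenCond F f ↔
    ∀ x, ∀ (W'' W' : NZ k V), W''.1 ≤ W'.1 → W''.1 ≤ vanishing f x W'.1 →
      Separates F W''.1 W'.1 := by
  rw [openCond_iff]
  have key : ∀ (W'' W' : NZ k V) (h : W''.1 ≤ W'.1) x, (∃ v : W''.1,
      x ∈ locus f W' (Submodule.inclusion h v)) ↔ ¬ W''.1 ≤ vanishing f x W'.1 := by
    intro W'' W' h x
    rw [SetLike.not_le_iff_exists]
    constructor
    · rintro ⟨v, hv⟩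
      exact ⟨v, v.2, fun h' => (mem_vanishing f x W' (Submodule.inclusion h v)).mp h' hv⟩
    · rintro ⟨v, hv, h'⟩
      refine ⟨⟨v, hv⟩, ?_⟩
      by_contra hx
      exact h' ((mem_vanishing f x W' ⟨v, h hv⟩).mpr hx)
  constructor
  · intro H x W'' W' h h'
    by_contra hs
    exact (key W'' W' h x).mp (H W'' W' h hs x) h'
  · intro H W'' W' h hs x
    exact (key W'' W' h x).mpr fun h' => hs (H x W'' W' h h')

lemma vanishing_comp {T : Scheme.{u}} (f : S ⟶ T) (g : T ⟶ prodP k V) (x : S)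
    (W : Submodule k V) : vanishing (f ≫ g) x W = vanishing g (f x) W := by
  by_cases hW : W = ⊥
  · rw [vanishing, vanishing, dif_neg (not_not.mpr hW), dif_neg (not_not.mpr hW)]
  ext v
  by_cases hv : v ∈ W
  · rw [mem_vanishing (f ≫ g) x ⟨W, hW⟩ ⟨v, hv⟩, mem_vanishing g (f x) ⟨W, hW⟩ ⟨v, hv⟩, locus_comp]
    rfl
  · exact ⟨fun h => absurd (vanishing_le _ _ W h) hv, fun h => absurd (vanishing_le _ _ W h) hv⟩

lemma isOpen_le_vanishing (f : S ⟶ prodP k V) (W W' : Submodule k V) :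
    IsOpen {x | ¬ W ≤ vanishing f x W'} := by
  by_cases hW : W' = ⊥
  · have : ∀ x, vanishing f x W' = ⊥ := fun x => by rw [vanishing, dif_neg (not_not.mpr hW)]
    simp only [this]
    exact isOpen_const
  have : {x | ¬ W ≤ vanishing f x W'} = ⋃ v : W, {x | (v : V) ∉ vanishing f x W'} := by
    ext x
    simp [SetLike.not_le_iff_exists]
  rw [this]
  refine isOpen_iUnion fun v => ?_
  by_cases hv : (v : V) ∈ W'
  · have : {x | (v : V) ∉ vanishing f x W'} = locus f ⟨W', hW⟩ ⟨v, hv⟩ := by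
      ext x
      have := mem_vanishing f x ⟨W', hW⟩ ⟨v, hv⟩
      simp only [Set.mem_ofPred_eq]
      rw [this]
      exact not_not
    rw [this]
    exact (locus f _ _).isOpen
  · have : ∀ x, (v : V) ∉ vanishing f x W' := fun x h => hv (vanishing_le f x _ h)
    simp [this]

lemma mem_UF_iff {x : B k V} : x ∈ UF F ↔ ∀ (W'' W' : NZ k V), W''.1 ≤ W'.1 →
    W''.1 ≤ vanishing (B.ι k V) x W'.1 → Separates F W''.1 W'.1 := by
  constructor
  · intro h
    rw [UF, TopologicalSpace.Opens.mem_sSup] at h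
    obtain ⟨U : (B k V).Opens, hU, hx⟩ := h
    obtain ⟨y, rfl⟩ : ∃ y : Scheme.Opens.toScheme U, Scheme.Opens.ι U y = x := ⟨⟨x, hx⟩, rfl⟩
    intro W'' W' h hv
    refine (openCond_iff_vanishing _).mp hU y W'' W' h ?_
    rw [vanishing_comp]
    exact hv
  · intro h
    let U : (B k V).Opens := ⟨{x | ∀ (W'' W' : NZ k V), W''.1 ≤ W'.1 → ¬ Separates F W''.1 W'.1 →
      ¬ W''.1 ≤ vanishing (B.ι k V) x W'.1}, by
        simp only [Set.ofPred_forall]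
        exact isOpen_iInter_of_finite fun W'' => isOpen_iInter_of_finite fun W' =>
          isOpen_iInter_of_finite fun _ => isOpen_iInter_of_finite fun _ =>
          isOpen_le_vanishing _ _ _⟩
    rw [UF, TopologicalSpace.Opens.mem_sSup]
    refine ⟨U, ?_, fun W'' W' hW hs hv => hs (h W'' W' hW hv)⟩
    refine (openCond_iff_vanishing _).mpr fun y W'' W' hW hv => ?_
    rw [vanishing_comp] at hv
    by_contra hs
    exact y.2 W'' W' hW hs hv

/-- `U_F` represents the open condition. -/
theorem range_subset_UF_iff (f : S ⟶ B k V) :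
    Set.range f ⊆ (UF F : Set (B k V)) ↔ OpenCond F (f ≫ B.ι k V) := by
  rw [openCond_iff_vanishing, Set.range_subset_iff]
  refine forall_congr' fun x => ?_
  simp only [vanishing_comp]
  exact mem_UF_iff

lemma closedCond_le_vanishing {f : S ⟶ prodP k V} (hf : ClosedCond F f) (x : S) (W'' W' : NZ k V)
    (h : W''.1 ≤ W'.1) (hs : Separates F W''.1 W'.1) : W''.1 ≤ vanishing f x W'.1 := by
  intro v hv
  refine (mem_vanishing f x W' ⟨v, h hv⟩).mpr fun hx => ?_
  obtain ⟨w', hw'⟩ := P.iSup_chart (comp f W' x)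
  have h1 := (closedCond_iff f F).mp hf W'' W' h hs w' ⟨v, hv⟩ (locus f W' w') le_rfl
  have h2 := basicOpen_coord (comp f W') w' ⟨v, h hv⟩ (U := locus f W' w') le_rfl
  have h3 : x ∈ S.basicOpen (coord (comp f W') w' (U := locus f W' w') le_rfl ⟨v, h hv⟩) := by
    rw [h2]; exact ⟨hw', hx⟩
  have h4 : coord (comp f W') w' (U := locus f W' w') le_rfl ⟨v, h hv⟩ = 0 := h1
  rw [h4, Scheme.basicOpen_zero] at h3
  exact h3

/-- For reduced schemes the closed condition is a condition on points. -/
lemma closedCond_of_isReduced [IsReduced S] {f : S ⟶ prodP k V} (hf : ∀ x, ∀ (W'' W' : NZ k V),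
    W''.1 ≤ W'.1 → Separates F W''.1 W'.1 → W''.1 ≤ vanishing f x W'.1) : ClosedCond F f := by
  rw [closedCond_iff]
  intro W'' W' h hs w' v U e'
  rw [← basicOpen_eq_bot_iff, basicOpen_coord, eq_bot_iff]
  intro x hx
  exact (mem_vanishing f x W' (Submodule.inclusion h v)).mp (hf x W'' W' h hs v.2) hx.2

/-- The points of `B_F`. If a point satisfies the condition, then the closed condition holds over the
spectrum of its residue field, because this is reduced. -/
lemma mem_range_BF_iff [Nontrivial V] {x : B k V} : x ∈ Set.range (BF.ι F) ↔
    ∀ (W'' W' : NZ k V), W''.1 ≤ W'.1 → Separates F W''.1 W'.1 →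
      W''.1 ≤ vanishing (B.ι k V) x W'.1 := by
  constructor
  · rintro ⟨y, rfl⟩ W'' W' h hs
    have h1 : ClosedCond F (BF.ι F ≫ B.ι k V) :=
      (exists_lift_BF_iff F _).mp ⟨𝟙 _, Category.id_comp _⟩
    have h2 := closedCond_le_vanishing h1 y W'' W' h hs
    rwa [vanishing_comp] at h2
  · intro H
    have hpt : ∀ z, (B k V).fromSpecResidueField x z = x := fun z => by
      have := Set.mem_range_self (f := (B k V).fromSpecResidueField x) z
      rwa [Scheme.range_fromSpecResidueField] at this
    have h1 : ClosedCond F ((B k V).fromSpecResidueField x ≫ B.ι k V) := by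
      refine closedCond_of_isReduced fun z W'' W' h hs => ?_
      rw [vanishing_comp, hpt]
      exact H W'' W' h hs
    obtain ⟨g, hg⟩ := (exists_lift_BF_iff F _).mpr h1
    let z : Spec ((B k V).residueField x) := default
    exact ⟨g z, (congrArg (fun φ : Spec ((B k V).residueField x) ⟶ B k V => φ z) hg).trans (hpt z)⟩

/-- A point is in the stratum of `F` if and only if the pairs `W'' ≤ W'` for which the form on `W'`
vanishes on `W''` are those that are separated by `F`. -/
lemma mem_stratum_iff [Nontrivial V] {x : B k V} : x ∈ stratum F ↔
    ∀ (W'' W' : NZ k V), W''.1 ≤ W'.1 →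
      (Separates F W''.1 W'.1 ↔ W''.1 ≤ vanishing (B.ι k V) x W'.1) := by
  change _ ∧ _ ↔ _
  rw [mem_range_BF_iff]
  refine (and_congr Iff.rfl mem_UF_iff).trans ?_
  exact ⟨fun h W'' W' hW => ⟨h.1 W'' W' hW, h.2 W'' W' hW⟩,
    fun h => ⟨fun W'' W' hW => (h W'' W' hW).mp, fun W'' W' hW => (h W'' W' hW).mpr⟩⟩

end Strata

section Flags
variable {k V : Type u} [Field k] [AddCommGroup V] [Module k V] [Module.Finite k V]
  (N : Submodule k V → Submodule k V)

/-- The flag that belongs to a system of vanishing subspaces. -/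
def flagOf : Set (Submodule k V) := {W | ∀ W', W < W' → W ≤ N W'}

variable {N}

/-- The sum of two incomparable members would be contained in its own vanishing subspace. -/
lemma isFlag_flagOf (hN : ∀ W, W ≠ ⊥ → N W < W) : IsFlag (flagOf N) := by
  refine ⟨?_, fun _ _ => bot_le, fun W h => absurd le_top h.not_ge⟩
  intro W₁ h₁ W₂ h₂ _
  by_contra! H
  have h3 : W₁ ⊔ W₂ ≤ N (W₁ ⊔ W₂) :=
    sup_le (h₁ _ (left_lt_sup.mpr H.2)) (h₂ _ (right_lt_sup.mpr H.1))
  refine (hN (W₁ ⊔ W₂) ?_).not_ge h3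
  intro h
  exact H.1 ((sup_eq_bot_iff.mp h).1.trans_le bot_le)

/-- The separating member for `W'' ≤ N W'` is `N Y` for a maximal `Y ≥ W'` with `¬ W' ≤ N Y`. -/
lemma separates_flagOf (hN : ∀ W, W ≠ ⊥ → N W < W)
    (hN2 : ∀ W W', W ≤ W' → ¬ W ≤ N W' → N W = N W' ⊓ W) {W'' W' : Submodule k V} (hW' : W' ≠ ⊥) (h : W'' ≤ W') :
    Separates (flagOf N) W'' W' ↔ W'' ≤ N W' := by
  constructor
  · rintro ⟨W, hW, h1, h2⟩
    have h3 : W ≤ N (W ⊔ W') := hW _ (left_lt_sup.mpr h2)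
    have h4 : ¬ W' ≤ N (W ⊔ W') := fun h4 => by
      refine (hN (W ⊔ W') ?_).not_ge (sup_le h3 h4)
      intro h
      exact hW' (sup_eq_bot_iff.mp h).2
    rw [hN2 _ _ le_sup_right h4]
    exact le_inf (h1.trans h3) h
  · intro h1
    obtain ⟨Y, ⟨hY1, hY2⟩, hmax⟩ := WellFounded.has_min
      (wellFounded_gt (α := Submodule k V)) {Y | W' ≤ Y ∧ ¬ W' ≤ N Y}
      ⟨W', le_rfl, (hN W' hW').not_ge⟩
    refine ⟨N Y, fun Z hZ => ?_, ?_, hY2⟩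
    · have hYle : N Y ≤ Y := (hN Y fun h => hW' (le_bot_iff.mp (h ▸ hY1))).le
      by_cases hZY : Z ≤ Y
      · rw [hN2 Z Y hZY hZ.not_ge]
        exact le_inf le_rfl hZ.le
      · have h2 : W' ≤ N (Y ⊔ Z) := by
          by_contra h2
          exact hmax _ ⟨hY1.trans le_sup_left, h2⟩ (left_lt_sup.mpr hZY)
        have h3 : Y ≤ N (Y ⊔ Z) := by
          by_contra h3
          rw [hN2 Y _ le_sup_left h3] at hY2
          exact hY2 (le_inf h2 hY1)
        have h4 : ¬ Z ≤ N (Y ⊔ Z) := fun h4 => by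
          refine (hN (Y ⊔ Z) ?_).not_ge (sup_le h3 h4)
          intro h
          exact hZY ((sup_eq_bot_iff.mp h).2.trans_le bot_le)
        rw [hN2 Z _ le_sup_right h4]
        exact le_inf (hYle.trans h3) hZ.le
    · rw [hN2 W' Y hY1 hY2] at h1
      exact h1.trans inf_le_left

/-- A flag is determined by the pairs of subspaces that it separates. -/
lemma flag_le_of_separates {F F' : Set (Submodule k V)} (hF' : IsFlag F')
    (h : ∀ W'' W' : Submodule k V, W'' ≠ ⊥ → W'' ≤ W' → Separates F W'' W' → Separates F' W'' W') :
    F ⊆ F' := by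
  intro W hW
  by_cases hW0 : W = ⊥
  · rw [hW0]; exact hF'.2.1
  obtain ⟨M, ⟨hM1, hM2⟩, hmin⟩ := WellFounded.has_min
    (wellFounded_lt (α := Submodule k V)) {M | M ∈ F' ∧ W ≤ M} ⟨⊤, hF'.2.2, le_top⟩
  rcases hM2.lt_or_eq with hlt | rfl
  · obtain ⟨W₁, h1, h2, h3⟩ := h W M hW0 hM2 ⟨W, hW, le_rfl, hlt.not_ge⟩
    rcases hF'.1.total h1 hM1 with h4 | h4
    · exact absurd (lt_of_le_not_ge h4 h3) (hmin W₁ ⟨h1, h2⟩)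
    · exact absurd h4 h3
  · exact hM1

/-- `B_V` is the disjoint union of its strata. -/
theorem existsUnique_stratum [Finite k] [Nontrivial V] (x : B k V) :
    ∃! F : Set (Submodule k V), IsFlag F ∧ x ∈ stratum F := by
  have hN : ∀ W, W ≠ ⊥ → vanishing (B.ι k V) x W < W := fun W hW => vanishing_lt _ x hW
  have hN2 := fun W W' (h : W ≤ W') h' => vanishing_eq_inf x (incidence_B (k := k) (V := V)) h h'
  refine ⟨flagOf (vanishing (B.ι k V) x), ⟨isFlag_flagOf hN, mem_stratum_iff.mpr
    fun W'' W' h => separates_flagOf hN hN2 W'.2 h⟩, ?_⟩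
  rintro F ⟨hF, hx⟩
  rw [mem_stratum_iff] at hx
  have key : ∀ W'' W' : Submodule k V, W'' ≠ ⊥ → W'' ≤ W' →
      (Separates F W'' W' ↔ Separates (flagOf (vanishing (B.ι k V) x)) W'' W') := by
    intro W'' W' h0 h
    have h0' : W' ≠ ⊥ := fun h' => h0 (le_bot_iff.mp (h' ▸ h))
    rw [separates_flagOf hN hN2 h0' h]
    exact hx ⟨W'', h0⟩ ⟨W', h0'⟩ h
  exact (flag_le_of_separates (isFlag_flagOf hN) fun W'' W' h0 h => (key W'' W' h0 h).mp).antisymm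
    (flag_le_of_separates hF fun W'' W' h0 h => (key W'' W' h0 h).mpr)

end Flags

/-! ### The open immersion of `Ω_V` into `B_V` -/

section ofLinear
variable {k V : Type u} [Field k] [AddCommGroup V] [Module k V] {A A' : Type u} [CommRing A]
  [Algebra k A] [CommRing A'] [Algebra k A']

lemma P.ofLinear_preimage_of_isUnit (l : V →ₗ[k] A) (v₀ : V) (h : l v₀ = 1) {v : V}
    (hv : IsUnit (l v)) : ⊤ ≤ P.ofLinear l v₀ h ⁻¹ᵁ P.chart k V v := by
  have h1 := basicOpen_coord (P.ofLinear l v₀ h) v₀ v (P.ofLinear_preimage l v₀ h).ge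
  rw [P.coord_ofLinear, Scheme.basicOpen_of_isUnit _ (hv.map _), top_inf_eq] at h1
  exact h1.le

/-- Proportional linear maps define the same point of `P_V`. -/
lemma P.ofLinear_congr {l l' : V →ₗ[k] A} {v₀ v₁ : V} {h : l v₀ = 1} {h' : l' v₁ = 1}
    (H : ∀ v, l v = l v₁ * l' v) : P.ofLinear l v₀ h = P.ofLinear l' v₁ h' := by
  have hu : l v₁ * l' v₀ = 1 := (H v₀).symm.trans h
  have e : ⊤ ≤ P.ofLinear l v₀ h ⁻¹ᵁ P.chart k V v₁ :=
    P.ofLinear_preimage_of_isUnit l v₀ h (IsUnit.of_mul_eq_one _ hu)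
  have e₀ := (P.ofLinear_preimage l v₀ h).ge
  refine P.hom_ext_of_coord ?_ v₁ e (P.ofLinear_preimage l' v₁ h').ge fun v => ?_
  · rw [P.ofLinear_str, P.ofLinear_str]
  · rw [P.coord_ofLinear]
    have h1 := coord_trans (P.ofLinear l v₀ h) v₀ v₁ v e₀ e
    rw [P.coord_ofLinear, P.coord_ofLinear, H v, map_mul] at h1
    refine (((IsUnit.of_mul_eq_one _ hu).map _).mul_left_cancel h1).symm

lemma P.Spec_map_ofLinear (φ : A →ₐ[k] A') (l : V →ₗ[k] A) (v₀ : V) (h : l v₀ = 1) :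
    Spec.map (CommRingCat.ofHom φ.toRingHom) ≫ P.ofLinear l v₀ h =
      P.ofLinear (φ.toLinearMap ∘ₗ l) v₀ (by simp [h]) := by
  rw [P.ofLinear, P.ofLinear, ← Category.assoc, ← Spec.map_comp]
  congr 2
  ext1
  refine away_hom_ext v₀ (fun v => ?_) (fun c => ?_)
  · exact (congrArg φ (awayHomOfLinear_frac l v₀ h v)).trans
      (awayHomOfLinear_frac (φ.toLinearMap ∘ₗ l) v₀ (by simp [h]) v).symm
  · exact ((congrArg φ (awayHomOfLinear_algebraMap l v₀ h c)).trans (φ.commutes c)).trans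
      (awayHomOfLinear_algebraMap (φ.toLinearMap ∘ₗ l) v₀ (by simp [h]) c).symm

end ofLinear

section Omega
variable {n m : ℕ} {k V : Type u} [Field k] [AddCommGroup V] [Module k V] [Finite k]
  [Module.Finite k V] [Nontrivial V] (b : Module.Basis (Fin (n + 1)) k V)
  (b' : Module.Basis (Fin (m + 1)) k V)

/-- The open immersion of `Ω_V` into the chart of the basis `b`. -/
def chartΩ : Ω k V ⟶ chart b := Spec.map (CommRingCat.ofHom (chartIncl b).toRingHom)

instance : IsOpenImmersion (chartΩ b) := by
  let := (chartIncl b).toRingHom.toAlgebra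
  have := isLocalization_RSZero b
  exact IsOpenImmersion.of_isLocalization (chartBoundary b)

lemma chartΩ_str : chartΩ b ≫ Spec.map (CommRingCat.ofHom (algebraMap k (chartRing b))) =
    Ω.str k V := by
  refine (Spec.map_comp _ _).symm.trans (congrArg Spec.map ?_)
  ext c
  exact congrArg Subtype.val ((chartIncl b).commutes c)

lemma chartIncl_fracMap_leadVec (W : NZ k V) : ((chartIncl b).toLinearMap ∘ₗ
    fracMap b (le_filt_leadIndex b W) (lead_leadVec b W)) (leadVec b W) = 1 :=
  (congrArg _ (chartFrac_self b (lead_leadVec b W))).trans (map_one (chartIncl b))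

lemma chartΩ_comp_chartComp (W : NZ k V) : chartΩ b ≫ chartComp b W =
    P.ofLinear ((chartIncl b).toLinearMap ∘ₗ fracMap b (le_filt_leadIndex b W) (lead_leadVec b W))
      (leadVec b W) (chartIncl_fracMap_leadVec b W) :=
  P.Spec_map_ofLinear _ _ _ _

/-- On `Ω_V` the tuples of any two charts agree, as both are given by the inclusions of
the `W` in `K_V`, up to factors. -/
lemma chartΩ_comp_chartMap : chartΩ b ≫ chartMap b = chartΩ b' ≫ chartMap b' := by
  refine prodP.hom_ext ?_ fun W => ?_
  · rw [Category.assoc, Category.assoc, chartMap_str, chartMap_str, chartΩ_str, chartΩ_str]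
  · rw [comp, comp, Category.assoc, Category.assoc, ← comp, ← comp, comp_chartMap, comp_chartMap,
      chartΩ_comp_chartComp, chartΩ_comp_chartComp]
    refine P.ofLinear_congr fun v => Subtype.ext ?_
    have h1 := (lead_leadVec b' W).vec_ne_zero
    have key : ∀ {l : ℕ} (b : Module.Basis (Fin (l + 1)) k V) (v : W.1),
        (((chartIncl b).toLinearMap ∘ₗ fracMap b (le_filt_leadIndex b W) (lead_leadVec b W)) v : K k V) =
          vec k V v / vec k V (leadVec b W) := fun b v => coe_chartIncl b _
    rw [Subalgebra.coe_mul, key, key, key, mul_comm, div_mul_div_cancel₀ h1]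

lemma chartΩ_comp_chart : chartΩ b ≫ B.chart b = chartΩ b' ≫ B.chart b' := by
  rw [← cancel_mono (B.ι k V), Category.assoc, Category.assoc, B.chart_ι, B.chart_ι,
    chartΩ_comp_chartMap b b']

variable (k V) in
lemma exists_finrank : ∃ n, Module.finrank k V = n + 1 :=
  Nat.exists_eq_succ_of_ne_zero Module.finrank_pos.ne'

variable (k V) in
/-- The open immersion of `Ω_V` into `B_V`. -/
def Ω.toB : Ω k V ⟶ B k V :=
  chartΩ (Module.finBasisOfFinrankEq k V (exists_finrank k V).choose_spec) ≫ B.chart _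

instance : IsOpenImmersion (Ω.toB k V) := by unfold Ω.toB; infer_instance

lemma chartΩ_chart : chartΩ b ≫ B.chart b = Ω.toB k V := chartΩ_comp_chart _ _

lemma Ω.toB_str : Ω.toB k V ≫ B.str k V = Ω.str k V := by
  rw [Ω.toB, Category.assoc, B.chart_str, chartΩ_str]

/-- The open subset of a chart where a function is invertible. -/
def chartD (a : chartRing b) : (chart b).Opens :=
  (chart b).basicOpen ((Scheme.ΓSpecIso (.of (chartRing b))).inv.hom a)

lemma chartD_mul (a a' : chartRing b) : chartD b (a * a') = chartD b a ⊓ chartD b a' := by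
  rw [chartD, map_mul, Scheme.basicOpen_mul]
  rfl

lemma range_chartΩ : Set.range (chartΩ b) = chartD b (chartBoundary b) := by
  rw [chartD, basicOpen_eq_of_affine]
  let := (chartIncl b).toRingHom.toAlgebra
  have := isLocalization_RSZero b
  exact PrimeSpectrum.localization_away_comap_range (RSZero k V) (chartBoundary b)

lemma chart_mem_range_toB {y : chart b} : B.chart b y ∈ Set.range (Ω.toB k V) ↔
    y ∈ chartD b (chartBoundary b) := by
  rw [← SetLike.mem_coe, ← range_chartΩ, ← chartΩ_chart b]
  constructor
  · rintro ⟨z, hz⟩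
    exact ⟨z, (B.chart b).isOpenEmbedding.injective hz⟩
  · rintro ⟨z, rfl⟩
    exact ⟨z, rfl⟩

lemma separates_trivialFlag {W'' W' : Submodule k V} (h : W'' ≠ ⊥) :
    ¬ Separates (trivialFlag k V) W'' W' := by
  rintro ⟨W, rfl | rfl, h1, h2⟩
  · exact h (le_bot_iff.mp h1)
  · exact h2 le_top

lemma mem_UF_trivialFlag {x : B k V} : x ∈ UF (trivialFlag k V) ↔
    ∀ (W : NZ k V) (w : W.1), w ≠ 0 → x ∈ locus (B.ι k V) W w := by
  rw [mem_UF_iff]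
  constructor
  · intro H W w hw
    by_contra hx
    have h1 : (k ∙ (w : V)) ≠ ⊥ := by simpa using hw
    have h2 : (k ∙ (w : V)) ≤ vanishing (B.ι k V) x W.1 := by
      rw [Submodule.span_singleton_le_iff_mem]
      exact (mem_vanishing _ x W w).mpr hx
    exact separates_trivialFlag h1 (H ⟨_, h1⟩ W (h2.trans (vanishing_le _ x W.1)) h2)
  · intro H W'' W' h h'
    obtain ⟨w, hw, hw0⟩ := W''.1.exists_mem_ne_zero_of_ne_bot W''.2
    refine absurd (H W' ⟨w, h hw⟩ ?_) ((mem_vanishing _ x W' ⟨w, h hw⟩).mp (h' hw))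
    simpa using hw0

/-- `Ω_V` is the locus where no non-zero vector of any `W` vanishes. In a chart it suffices that the
product of the coordinates is invertible. -/
lemma range_toB : Set.range (Ω.toB k V) = (UF (trivialFlag k V) : Set (B k V)) := by
  obtain ⟨n, hn⟩ := exists_finrank k V
  ext x
  obtain ⟨b, y, rfl⟩ := B.exists_mem_chart hn x
  rw [SetLike.mem_coe, mem_UF_trivialFlag, chart_mem_range_toB]
  have hl : ∀ W w, B.chart b y ∈ locus (B.ι k V) W w ↔ y ∈ locus (chartMap b) W w := by
    intro W w
    rw [← B.chart_ι, locus_comp]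
    rfl
  simp only [hl]
  constructor
  · intro hy W w hw
    have h1 := basicOpen_coord (comp (chartMap b) W) (leadVec b W) w (top_le_locus_leadVec b W)
    rw [coord_leadVec, top_inf_eq] at h1
    refine h1.le ?_
    obtain ⟨j, hj⟩ := exists_lead_vector b (w := (w : V)) (by simpa using hw)
    have h2 : chartBoundary b = chartFrac (le_filt_leadIndex b W w.2) (lead_leadVec b W) *
        (lastFrac b hj * chartFrac ((filt_anti b (Fin.zero_le _)) (lead_leadVec b W).1)
          (lead_basis b 0)) := by
      refine Subtype.ext ?_
      rw [coe_chartBoundary, Subalgebra.coe_mul, Subalgebra.coe_mul, coe_chartFrac, lastFrac,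
        coe_chartFrac, coe_chartFrac]
      have := hj.vec_ne_zero
      have := (lead_leadVec b W).vec_ne_zero
      have := (lead_basis b 0).vec_ne_zero
      field_simp
    rw [h2, chartD_mul] at hy
    exact hy.1
  · intro H
    have h3 : (⊤ : Submodule k V) ≤ filt b 0 := fun v _ j hj => absurd hj (Fin.not_lt_zero j)
    have h1 := basicOpen_coord (comp (chartMap b) ⟨⊤, top_ne_bot⟩) ⟨b 0, trivial⟩
      ⟨b (Fin.last n), trivial⟩ (top_le_locus_chartMap h3 (lead_basis b 0))
    rw [coord_chartMap h3 (lead_basis b 0), top_inf_eq] at h1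
    refine h1.ge (H ⟨⊤, top_ne_bot⟩ ⟨b (Fin.last n), trivial⟩ ?_)
    intro h
    exact b.ne_zero (Fin.last n) (congrArg Subtype.val h)

/-- The trivial flag separates no pair `0 ≠ W'' ≤ W'`, so its closed condition is empty. -/
lemma stratum_trivialFlag : stratum (trivialFlag k V) = (UF (trivialFlag k V) : Set (B k V)) := by
  refine Set.inter_eq_right.mpr fun x _ => ?_
  rw [mem_range_BF_iff]
  exact fun W'' W' _ hs => absurd hs (separates_trivialFlag W''.2)

end Omega

/-! ### Smoothness, integrality and the boundary divisor -/

section Smoothness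
variable {n : ℕ} {k V : Type u} [Field k] [AddCommGroup V] [Module k V] [Finite k]
  [Module.Finite k V] [Nontrivial V] (b : Module.Basis (Fin (n + 1)) k V)

/-- The open immersion of the chart of `b` in an affine space, with the coordinate functions
`b (l + 1) / b l`. -/
def chartToAffine : chart b ⟶ 𝔸(ULift.{u} (Fin n); Spec (.of k)) :=
  AffineSpace.homOfVector (Spec.map (CommRingCat.ofHom (algebraMap k (chartRing b))))
    fun i => (Scheme.ΓSpecIso (.of (chartRing b))).inv.hom (chartCoord b i.down)

/-- `polyMap`, with the variables lifted to the universe of `k`. -/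
def liftedPolyMap : MvPolynomial (ULift.{u} (Fin n)) k →ₐ[k] chartRing b :=
  (polyMap b).comp (MvPolynomial.renameEquiv k Equiv.ulift).toAlgHom

lemma liftedPolyMap_X (i : ULift.{u} (Fin n)) :
    liftedPolyMap b (MvPolynomial.X i) = chartCoord b i.down := by
  simp [liftedPolyMap, polyMap]

lemma chartToAffine_eq : chartToAffine b =
    Spec.map (CommRingCat.ofHom (liftedPolyMap b).toRingHom) ≫
      (AffineSpace.SpecIso (ULift.{u} (Fin n)) (.of k)).inv := by
  refine AffineSpace.hom_ext ?_ fun i => ?_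
  · rw [chartToAffine, AffineSpace.homOfVector_over, Category.assoc, AffineSpace.SpecIso_inv_over,
      ← Spec.map_comp]
    congr 1
    ext c
    exact congrArg Subtype.val ((liftedPolyMap b).commutes c).symm
  · rw [chartToAffine, AffineSpace.homOfVector_appTop_coord, Scheme.Hom.comp_appTop]
    refine Eq.trans ?_ (congrArg (Spec.map (CommRingCat.ofHom (liftedPolyMap b).toRingHom)).appTop.hom
      (AffineSpace.SpecIso_inv_appTop_coord (.of k) i)).symm
    have h := congrArg (fun φ : CommRingCat.of (MvPolynomial (ULift.{u} (Fin n)) k) ⟶ _ =>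
      φ.hom (MvPolynomial.X i)) (Scheme.ΓSpecIso_inv_naturality
        (CommRingCat.ofHom (liftedPolyMap b).toRingHom))
    refine Eq.trans ?_ h
    exact congrArg (Scheme.ΓSpecIso (.of (chartRing b))).inv.hom (liftedPolyMap_X b i).symm

instance : IsOpenImmersion (chartToAffine b) := by
  have h1 : IsOpenImmersion (Spec.map (CommRingCat.ofHom (polyMap b).toRingHom)) := by
    let := (polyMap b).toRingHom.toAlgebra
    have := isLocalization_chartRing b
    exact IsOpenImmersion.of_isLocalization (chartDenom b)
  have h2 : IsIso (Spec.map (CommRingCat.ofHom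
      (MvPolynomial.renameEquiv k (Equiv.ulift.{u} (α := Fin n))).toAlgHom.toRingHom)) := by
    have : IsIso (CommRingCat.ofHom
      (MvPolynomial.renameEquiv k (Equiv.ulift.{u} (α := Fin n))).toAlgHom.toRingHom) :=
      inferInstanceAs (IsIso (RingEquiv.toCommRingCatIso
        (MvPolynomial.renameEquiv k (Equiv.ulift.{u} (α := Fin n))).toRingEquiv).hom)
    infer_instance
  have h3 : Spec.map (CommRingCat.ofHom (liftedPolyMap b).toRingHom) =
      Spec.map (CommRingCat.ofHom (polyMap b).toRingHom) ≫ Spec.map (CommRingCat.ofHom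
      (MvPolynomial.renameEquiv k (Equiv.ulift.{u} (α := Fin n))).toAlgHom.toRingHom) := by
    rw [← Spec.map_comp]
    rfl
  rw [chartToAffine_eq, h3]
  infer_instance

instance : Smooth (𝔸(ULift.{u} (Fin n); Spec (.of k)) ↘ Spec (.of k)) := by
  rw [← Iso.hom_inv_id_assoc (AffineSpace.SpecIso (ULift.{u} (Fin n)) (.of k))
    (𝔸(ULift.{u} (Fin n); Spec (.of k)) ↘ Spec (.of k)), AffineSpace.SpecIso_inv_over]
  have : Smooth (Spec.map (CommRingCat.ofHom
      (MvPolynomial.C (R := k) (σ := ULift.{u} (Fin n))))) := by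
    rw [HasRingHomProperty.Spec_iff (P := @Smooth)]
    exact RingHom.smooth_algebraMap.mpr
      (⟨inferInstance, inferInstance⟩ : Algebra.Smooth k (MvPolynomial (ULift.{u} (Fin n)) k))
  infer_instance

lemma chartToAffine_over : chartToAffine b ≫ (𝔸(ULift.{u} (Fin n); Spec (.of k)) ↘ Spec (.of k)) =
    Spec.map (CommRingCat.ofHom (algebraMap k (chartRing b))) :=
  AffineSpace.homOfVector_over _ _

lemma preimage_chartToAffine (i : ULift.{u} (Fin n)) :
    chartToAffine b ⁻¹ᵁ (𝔸(ULift.{u} (Fin n); Spec (.of k))).basicOpen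
      (AffineSpace.coord (Spec (.of k)) i) = chartD b (chartCoord b i.down) := by
  rw [Scheme.preimage_basicOpen_top, chartToAffine, AffineSpace.homOfVector_appTop_coord]
  rfl

lemma mem_chartD_prod {ι : Type*} (s : Finset ι) (a : ι → chartRing b) (y : chart b) :
    y ∈ chartD b (∏ i ∈ s, a i) ↔ ∀ i ∈ s, y ∈ chartD b (a i) := by
  classical
  induction s using Finset.induction_on with
  | empty =>
    simp only [Finset.prod_empty, Finset.notMem_empty, IsEmpty.forall_iff, implies_true, iff_true]
    rw [chartD, map_one, Scheme.basicOpen_of_isUnit _ isUnit_one]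
    trivial
  | insert i s hi ih =>
    rw [Finset.prod_insert hi, chartD_mul, Finset.forall_mem_insert, ← ih]
    exact Iff.rfl

lemma mem_chartD_chartBoundary (y : chart b) :
    y ∈ chartD b (chartBoundary b) ↔ ∀ l, y ∈ chartD b (chartCoord b l) := by
  rw [chartBoundary_eq, mem_chartD_prod]
  simp

variable (k V) in
/-- The open cover of `B_V` by the charts of all bases. -/
def B.cover : (B k V).OpenCover :=
  Scheme.Cover.mkOfCovers (Module.Basis (Fin ((exists_finrank k V).choose + 1)) k V) BV.chart B.chart
    (B.exists_mem_chart (exists_finrank k V).choose_spec)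

lemma smooth_chart_str : Smooth (B.chart b ≫ B.str k V) := by
  rw [B.chart_str, ← chartToAffine_over]
  infer_instance

instance B.smooth : Smooth (B.str k V) := by
  have : IsZariskiLocalAtSource (@Smooth.{u} : MorphismProperty Scheme.{u}) :=
    HasRingHomProperty.instIsZariskiLocalAtSource
  rw [IsZariskiLocalAtSource.iff_of_openCover (P := @Smooth.{u}) (B.cover k V)]
  exact fun b => smooth_chart_str b

instance B.isReduced : IsReduced (B k V) := by
  have (b : (B.cover k V).I₀) : IsReduced ((B.cover k V).X b) := by
    change AlgebraicGeometry.IsReduced (Spec (.of (chartRing (k := k) (V := V) (n := (exists_finrank k V).choose) b)))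
    infer_instance
  exact AlgebraicGeometry.IsReduced.of_openCover _ (B.cover k V)

/-- `Ω_V` is dense in `B_V`, as it is dense in each chart. -/
lemma dense_range_toB : Dense (Set.range (Ω.toB k V)) := by
  intro x
  obtain ⟨n, hn⟩ := exists_finrank k V
  obtain ⟨b, y, rfl⟩ := B.exists_mem_chart hn x
  have h1 : Dense (Set.range (chartΩ b)) := by
    refine (chartΩ b).isOpenEmbedding.isOpen_range.dense ?_
    have : Nonempty (Ω k V) := inferInstanceAs (Nonempty (Spec (.of (RSZero k V))))
    exact Set.range_nonempty _
  have h2 : B.chart b y ∈ closure (B.chart b '' Set.range (chartΩ b)) :=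
    image_closure_subset_closure_image (B.chart b).continuous ⟨y, h1 y, rfl⟩
  refine closure_mono ?_ h2
  rintro _ ⟨_, ⟨z, rfl⟩, rfl⟩
  refine ⟨z, ?_⟩
  rw [← chartΩ_chart b]
  rfl

instance : IsIntegral (Ω k V) := inferInstanceAs (IsIntegral (Spec (.of (RSZero k V))))

/-- `B_V` is reduced, and it is the closure of the irreducible set `Ω_V`. -/
instance B.isIntegral : IsIntegral (B k V) := by
  have h1 : PreirreducibleSpace (B k V) := by
    have h2 : IsPreirreducible (Set.range (Ω.toB k V)) := by
      rw [← Set.image_univ]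
      exact (PreirreducibleSpace.isPreirreducible_univ (X := Ω k V)).image _
        (Ω.toB k V).continuous.continuousOn
    exact ⟨by rw [← dense_range_toB.closure_eq]; exact h2.closure⟩
  have : IrreducibleSpace (B k V) := ⟨⟨Ω.toB k V (Classical.arbitrary _)⟩⟩
  exact isIntegral_of_irreducibleSpace_of_isReduced _

/-- The complement of `Ω_V` is given in each chart by the vanishing of the product of the
coordinate functions. -/
theorem isNormalCrossingsDivisor_compl_range_toB :
    IsNormalCrossingsDivisor (B.str k V) (Set.range (Ω.toB k V))ᶜ := by
  refine ⟨(Ω.toB k V).isOpenEmbedding.isOpen_range.isClosed_compl, fun x => ?_⟩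
  obtain ⟨n, hn⟩ := exists_finrank k V
  obtain ⟨b, z, rfl⟩ := B.exists_mem_chart hn x
  refine ⟨(B.chart b).opensRange, ⟨z, rfl⟩, ULift.{u} (Fin n), inferInstance,
    (B.chart b).isoOpensRange.inv ≫ chartToAffine b, Set.univ, inferInstance, ?_, fun y => ?_⟩
  · rw [Category.assoc, chartToAffine_over, ← B.chart_str, Scheme.Hom.isoOpensRange_inv_comp_assoc]
  · obtain ⟨z, rfl⟩ : ∃ z, (B.chart b).isoOpensRange.hom z = y :=
      ⟨(B.chart b).isoOpensRange.inv y, congrArg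
        (fun φ : (B.chart b).opensRange.toScheme ⟶ _ => φ y) (B.chart b).isoOpensRange.inv_hom_id⟩
    have h1 : (B.chart b).opensRange.ι ((B.chart b).isoOpensRange.hom z) = B.chart b z :=
      congrArg (fun φ : chart b ⟶ B k V => φ z) (B.chart b).isoOpensRange_hom_ι
    have h2 : ((B.chart b).isoOpensRange.inv ≫ chartToAffine b) ((B.chart b).isoOpensRange.hom z) =
        chartToAffine b z :=
      congrArg (fun φ : chart b ⟶ _ => φ z)
        ((B.chart b).isoOpensRange.hom_inv_id_assoc (chartToAffine b))
    rw [h1, h2, Set.mem_compl_iff, chart_mem_range_toB, mem_chartD_chartBoundary, not_forall]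
    have h3 : ∀ i, chartToAffine b z ∈ (𝔸(ULift.{u} (Fin n); Spec (.of k))).basicOpen
        (AffineSpace.coord (Spec (.of k)) i) ↔ z ∈ chartD b (chartCoord b i.down) := fun i => by
      rw [← preimage_chartToAffine]
      rfl
    simp only [h3, Set.mem_univ, true_and]
    exact ⟨fun ⟨l, hl⟩ => ⟨⟨l⟩, hl⟩, fun ⟨l, hl⟩ => ⟨l.down, hl⟩⟩

end Smoothness

/-! ### `Ω_V` as an open subscheme of `P_V` and `Q_V` -/

section ProjDomain
variable {k A : Type u} [Field k] [CommRing A] [IsDomain A] [Algebra k A]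
  (𝒜 : ℕ → Submodule k A) [GradedAlgebra 𝒜]

/-- A non-empty basic open subset of the homogeneous spectrum of a domain contains the generic
point. -/
lemma Proj.dense_basicOpen {f : A} {d : ℕ} (hf : f ∈ 𝒜 d) (hd : 0 < d) (h0 : f ≠ 0) :
    Dense (Proj.basicOpen 𝒜 f : Set (Proj 𝒜)) := by
  have hb : (⊥ : HomogeneousIdeal 𝒜).toIdeal = ⊥ := HomogeneousIdeal.toIdeal_bot
  let η : ProjectiveSpectrum 𝒜 := ⟨⊥, by rw [hb]; exact Ideal.isPrime_bot, fun h => h0 (by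
    have h' : f ∈ (⊥ : HomogeneousIdeal 𝒜).toIdeal :=
      h (HomogeneousIdeal.mem_irrelevant_of_mem 𝒜 hd hf)
    rwa [hb, Ideal.mem_bot] at h')⟩
  have h1 : closure {η} = (Set.univ : Set (ProjectiveSpectrum 𝒜)) := by
    rw [← ProjectiveSpectrum.zeroLocus_vanishingIdeal_eq_closure,
      ProjectiveSpectrum.vanishingIdeal_singleton]
    refine Set.eq_univ_of_forall fun x a ha => ?_
    have ha' : a ∈ (⊥ : HomogeneousIdeal 𝒜).toIdeal := ha
    rw [hb, Ideal.mem_bot] at ha'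
    rw [ha']
    exact zero_mem _
  have h2 : η ∈ (Proj.basicOpen 𝒜 f : Set (Proj 𝒜)) := fun h => h0 (by
    have ha' : f ∈ (⊥ : HomogeneousIdeal 𝒜).toIdeal := h
    rwa [hb, Ideal.mem_bot] at ha')
  refine dense_iff_closure_eq.mpr (Set.univ_subset_iff.mp ?_)
  exact h1.ge.trans (closure_mono (Set.singleton_subset_iff.mpr h2))

lemma awayToK_injective {V : Type u} [AddCommGroup V] [Module k V] (φ : A →ₐ[k] K k V)
    (hφ : Function.Injective φ) {f : A} (hf : φ f ≠ 0) {d : ℕ} (hd : f ∈ 𝒜 d) :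
    Function.Injective (awayToK k V 𝒜 φ f hf) := by
  rw [injective_iff_map_eq_zero]
  intro z hz
  obtain ⟨n, a, ha, rfl⟩ := z.mk_surjective _ hd
  rw [awayToK_mk, div_eq_zero_iff, or_iff_left (pow_ne_zero _ hf)] at hz
  obtain rfl : a = 0 := hφ (hz.trans (map_zero φ).symm)
  apply HomogeneousLocalization.val_injective
  rw [HomogeneousLocalization.Away.val_mk, HomogeneousLocalization.val_zero, Localization.mk_zero]

/-- The scalar `c` is the fraction `c / f ^ 0`. -/
lemma fromZero_eq_mk {A : Type u} [CommRing A] [Algebra k A] (𝒜 : ℕ → Submodule k A)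
    [GradedAlgebra 𝒜] {f : A} {d : ℕ} (hd : f ∈ 𝒜 d) (c : k) :
    HomogeneousLocalization.fromZeroRingHom 𝒜 (Submonoid.powers f) (algebraMap k (𝒜 0) c) =
      HomogeneousLocalization.Away.mk 𝒜 hd 0 (algebraMap k A c)
        (by rw [zero_smul]; exact SetLike.algebraMap_mem_graded 𝒜 c) := by
  apply HomogeneousLocalization.val_injective
  rw [HomogeneousLocalization.Away.val_mk]
  change Localization.mk _ _ = _
  congr 1
  exact Subtype.ext (pow_zero f).symm

lemma awayToK_algebraMap {V : Type u} [AddCommGroup V] [Module k V] (φ : A →ₐ[k] K k V)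
    {f : A} (hf : φ f ≠ 0) {d : ℕ} (hd : f ∈ 𝒜 d) (c : k) :
    awayToK k V 𝒜 φ f hf (HomogeneousLocalization.fromZeroRingHom 𝒜 _ (algebraMap k (𝒜 0) c)) =
      algebraMap k _ c := by
  rw [fromZero_eq_mk 𝒜 hd, awayToK_mk, pow_zero, div_one, AlgHom.commutes]

lemma awayι_str {f : A} {d : ℕ} (hd : f ∈ 𝒜 d) (h0 : 0 < d) :
    Proj.awayι 𝒜 f hd h0 ≫ Proj.toSpecZero 𝒜 ≫
      Spec.map (CommRingCat.ofHom (algebraMap k (𝒜 0))) =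
    Spec.map (CommRingCat.ofHom ((HomogeneousLocalization.fromZeroRingHom 𝒜 _).comp
      (algebraMap k (𝒜 0)))) := by
  rw [Proj.awayι_toSpecZero_assoc, ← Spec.map_comp]
  rfl

end ProjDomain

section Omega
variable {k V : Type u} [Field k] [AddCommGroup V] [Module k V] [Finite k] [Module.Finite k V]

lemma surjective_of_ratio_mem_range {A : Type u} [CommRing A] (φ : A →+* RSZero k V)
    (hk : ∀ c : k, algebraMap k _ c ∈ φ.range)
    (hr : ∀ v w (hw : w ≠ 0), v ≠ 0 → ratio k V v w hw ∈ φ.range) : Function.Surjective φ := by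
  rintro ⟨z, hz⟩
  rw [← RingHom.mem_range]
  induction hz using Algebra.adjoin_induction with
  | mem z hz =>
    obtain ⟨v, w, hw, rfl⟩ := hz
    by_cases hv : v = 0
    · have : (⟨vec k V v / vec k V w, Algebra.subset_adjoin ⟨v, w, hw, rfl⟩⟩ : RSZero k V) = 0 :=
        Subtype.ext (by simp [hv])
      rw [this]
      exact zero_mem _
    · exact hr v w hw hv
  | algebraMap c => exact hk c
  | add x y _ _ hx hy => exact add_mem hx hy
  | mul x y _ _ hx hy => exact mul_mem hx hy

lemma coe_toRSZeroOfSym (x) : (toRSZeroOfSym k V x : K k V) =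
    awayToK k V (symGrading k V) (IsScalarTower.toAlgHom k (SymmetricAlgebra k V) (K k V))
    (prodVec k V) (by
      rw [IsScalarTower.coe_toAlgHom', coe_prodVec]; exact prod_ne_zero k V) x := rfl

lemma coe_toRSZeroOfRecip (x) : (toRSZeroOfRecip k V x : K k V) =
    awayToK k V (recipGrading k V) (R k V).val (prodRecip k V) (by
      rw [Subalgebra.coe_val, coe_prodRecip]; exact inv_ne_zero (prod_ne_zero k V)) x := rfl

/-- `v / w` is the fraction with numerator `v ∏ u` over the `u ≠ w` and denominator `∏ u`. -/
lemma bijective_toRSZeroOfSym : Function.Bijective (toRSZeroOfSym k V) := by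
  classical
  refine ⟨fun x y hxy => awayToK_injective (symGrading k V) _
    (IsFractionRing.injective (SymmetricAlgebra k V) (K k V)) _ (prodVec_mem k V)
      (congrArg Subtype.val hxy), surjective_of_ratio_mem_range _ (fun c => ?_) fun v w hw hv => ?_⟩
  · exact ⟨_, Subtype.ext (awayToK_algebraMap (symGrading k V) _ _ (prodVec_mem k V) c)⟩
  · have hw' := (mem_nonzeroVectors k V).mpr hw
    have h1 := SetLike.mul_mem_graded (ι_mem k V v) (SetLike.prod_mem_graded
      (A := symGrading k V) (F := (nonzeroVectors k V).erase w) (i := fun _ => 1)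
      (g := SymmetricAlgebra.ι k V) (fun v _ => ι_mem k V v))
    have h2 : 1 + ∑ i ∈ (nonzeroVectors k V).erase w, 1 = 1 • (nonzeroVectors k V).card := by
      rw [← Finset.card_eq_sum_ones, Finset.card_erase_of_mem hw', one_smul,
        Nat.add_sub_cancel' (Finset.card_pos.mpr ⟨w, hw'⟩)]
    rw [h2] at h1
    refine ⟨HomogeneousLocalization.Away.mk _ (prodVec_mem k V) 1 _ h1, Subtype.ext ?_⟩
    rw [coe_toRSZeroOfSym, awayToK_mk, pow_one, coe_ratio, IsScalarTower.coe_toAlgHom', coe_prodVec,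
      map_mul, map_prod, ← Finset.mul_prod_erase _ _ hw']
    refine mul_div_mul_right _ _ (Finset.prod_ne_zero_iff.mpr fun u hu => ?_)
    exact vec_ne_zero k V ((mem_nonzeroVectors k V).mp (Finset.mem_of_mem_erase hu))

/-- `v / w` is the fraction with numerator `1 / w ∏ 1 / u` over the `u ≠ v` and denominator
`∏ 1 / u`. -/
lemma bijective_toRSZeroOfRecip : Function.Bijective (toRSZeroOfRecip k V) := by
  classical
  refine ⟨fun x y hxy => awayToK_injective (recipGrading k V) _ Subtype.val_injective _
    (prodRecip_mem k V) (congrArg Subtype.val hxy), surjective_of_ratio_mem_range _ (fun c => ?_)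
      fun v w hw hv => ?_⟩
  · exact ⟨_, Subtype.ext (awayToK_algebraMap (recipGrading k V) _ _ (prodRecip_mem k V) c)⟩
  · have hv' := (mem_nonzeroVectors k V).mpr hv
    let s := (nonzeroVectors k V).attach.erase ⟨v, hv'⟩
    have h1 := SetLike.mul_mem_graded (recip_mem k V w hw) (SetLike.prod_mem_graded
      (A := recipGrading k V) (F := s) (i := fun _ => 1)
      (g := fun v : nonzeroVectors k V => recip k V v.1 ((mem_nonzeroVectors k V).mp v.2))
      (fun v _ => recip_mem k V v.1 _))
    have h2 : 1 + ∑ i ∈ s, 1 = 1 • (nonzeroVectors k V).card := by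
      rw [← Finset.card_eq_sum_ones, Finset.card_erase_of_mem (Finset.mem_attach _ _), one_smul,
        Finset.card_attach, Nat.add_sub_cancel' (Finset.card_pos.mpr ⟨v, hv'⟩)]
    rw [h2] at h1
    refine ⟨HomogeneousLocalization.Away.mk _ (prodRecip_mem k V) 1 _ h1, Subtype.ext ?_⟩
    have h3 : prodRecip k V = recip k V v hv * ∏ u ∈ s, recip k V u.1 ((mem_nonzeroVectors k V).mp u.2) :=
      (Finset.mul_prod_erase _ _ (Finset.mem_attach _ ⟨v, hv'⟩)).symm
    rw [coe_toRSZeroOfRecip, awayToK_mk, pow_one, coe_ratio, h3, map_mul, map_mul]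
    rw [mul_div_mul_right, div_eq_inv_mul, div_eq_mul_inv]
    · congr 1
      exact inv_inv (vec k V v)
    · rw [map_prod]
      refine Finset.prod_ne_zero_iff.mpr fun u _ => ?_
      exact inv_ne_zero (vec_ne_zero k V ((mem_nonzeroVectors k V).mp u.2))

variable [Nontrivial V]

lemma isIso_Spec_map_of_bijective {A B : Type u} [CommRing A] [CommRing B] (φ : A →+* B)
    (h : Function.Bijective φ) : IsIso (Spec.map (CommRingCat.ofHom φ)) := by
  have : IsIso (CommRingCat.ofHom φ) :=
    inferInstanceAs (IsIso (RingEquiv.toCommRingCatIso (RingEquiv.ofBijective φ h)).hom)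
  infer_instance

instance : IsIso (Spec.map (CommRingCat.ofHom (toRSZeroOfSym k V))) :=
  isIso_Spec_map_of_bijective _ bijective_toRSZeroOfSym

instance : IsIso (Spec.map (CommRingCat.ofHom (toRSZeroOfRecip k V))) :=
  isIso_Spec_map_of_bijective _ bijective_toRSZeroOfRecip

instance : IsOpenImmersion (Ω.toP k V) :=
  inferInstanceAs (IsOpenImmersion (Spec.map (CommRingCat.ofHom (toRSZeroOfSym k V)) ≫
    Proj.awayι (symGrading k V) (prodVec k V) (prodVec_mem k V) (card_pos k V)))

instance : IsOpenImmersion (Ω.toQ k V) :=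
  inferInstanceAs (IsOpenImmersion (Spec.map (CommRingCat.ofHom (toRSZeroOfRecip k V)) ≫
    Proj.awayι (recipGrading k V) (prodRecip k V) (prodRecip_mem k V) (card_pos k V)))

variable (k V) in
/-- The open subscheme of `Q_V` where all `1 / v` are invertible. -/
def Q.boundaryCompl : (Q k V).Opens := Proj.basicOpen (recipGrading k V) (prodRecip k V)

lemma range_toP : Set.range (Ω.toP k V) = Proj.basicOpen (symGrading k V) (prodVec k V) := by
  rw [← Proj.opensRange_awayι _ _ (prodVec_mem k V) (card_pos k V)]
  exact congrArg (fun U : (P k V).Opens => (U : Set (P k V)))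
    (Scheme.Hom.opensRange_comp_of_isIso (Spec.map (CommRingCat.ofHom (toRSZeroOfSym k V)))
      (Proj.awayι (symGrading k V) (prodVec k V) (prodVec_mem k V) (card_pos k V)))

lemma opensRange_toQ : (Ω.toQ k V).opensRange = Q.boundaryCompl k V := by
  rw [Q.boundaryCompl, ← Proj.opensRange_awayι _ _ (prodRecip_mem k V) (card_pos k V)]
  exact (Scheme.Hom.opensRange_comp_of_isIso (Spec.map (CommRingCat.ofHom (toRSZeroOfRecip k V)))
      (Proj.awayι (recipGrading k V) (prodRecip k V) (prodRecip_mem k V) (card_pos k V)))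

instance : IsDominant (Ω.toP k V) := by
  refine ⟨?_⟩
  rw [DenseRange, range_toP]
  have : IsDomain (SymmetricAlgebra k V) :=
    (IsFractionRing.injective (SymmetricAlgebra k V) (K k V)).isDomain
  exact Proj.dense_basicOpen _ (prodVec_mem k V) (card_pos k V) fun h => prod_ne_zero k V
    (by rw [← coe_prodVec, h, map_zero])

lemma dense_boundaryCompl : Dense (Q.boundaryCompl k V : Set (Q k V)) :=
  Proj.dense_basicOpen _ (prodRecip_mem k V) (card_pos k V) fun h => prod_ne_zero k V
    (inv_eq_zero.mp (by rw [← coe_prodRecip, h]; rfl))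

instance : IsDominant (Ω.toQ k V) := by
  refine ⟨?_⟩
  have h := congrArg (fun U : (Q k V).Opens => (U : Set (Q k V))) opensRange_toQ
  exact (congrArg Dense h).mpr dense_boundaryCompl

end Omega

/-! ### The morphism from `B_V` to `P_V` -/

section Away
variable {k A : Type u} [Field k] [CommRing A] [Algebra k A]
  (𝒜 : ℕ → Submodule k A) [GradedAlgebra 𝒜]

/-- A criterion for morphisms to two nested basic open subsets to agree in the homogeneous spectrum. -/
lemma Spec_map_awayι {f g x : A} {d e m : ℕ} (hf : f ∈ 𝒜 d) (hd : 0 < d) (hg : g ∈ 𝒜 e)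
    (hx : x ∈ 𝒜 m) (hm : 0 < m) (h : x = f * g) {C : Type u} [CommRing C]
    (ψ : HomogeneousLocalization.Away 𝒜 x →+* C) (χ : HomogeneousLocalization.Away 𝒜 f →+* C)
    (H : ∀ z, ψ (HomogeneousLocalization.awayMap 𝒜 hg h z) = χ z) :
    Spec.map (CommRingCat.ofHom ψ) ≫ Proj.awayι 𝒜 x hx hm =
      Spec.map (CommRingCat.ofHom χ) ≫ Proj.awayι 𝒜 f hf hd := by
  have h1 : Proj.awayι 𝒜 x hx hm = Spec.map (CommRingCat.ofHom
      (HomogeneousLocalization.awayMap 𝒜 hg h)) ≫ Proj.awayι 𝒜 f hf hd :=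
    (Proj.SpecMap_awayMap_awayι 𝒜 hf hd hg h).symm
  rw [h1, ← Category.assoc, ← Spec.map_comp]
  congr 2
  ext z
  exact H z

/-- The embeddings of the coordinate rings of basic open subsets in `K_V` are compatible with
restriction. -/
lemma awayToK_awayMap {V : Type u} [AddCommGroup V] [Module k V] (φ : A →ₐ[k] K k V)
    {f g x : A} {d e : ℕ} (hf : f ∈ 𝒜 d) (hg : g ∈ 𝒜 e) (h : x = f * g)
    (h0 : φ f ≠ 0) (h0' : φ x ≠ 0) (z : HomogeneousLocalization.Away 𝒜 f) :
    awayToK k V 𝒜 φ x h0' (HomogeneousLocalization.awayMap 𝒜 hg h z) = awayToK k V 𝒜 φ f h0 z := by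
  obtain ⟨n, a, ha, rfl⟩ := z.mk_surjective _ hf
  have hg0 : φ g ≠ 0 := fun h1 => h0' (by rw [h, map_mul, h1, mul_zero])
  rw [HomogeneousLocalization.awayMap_mk, awayToK_mk, awayToK_mk, h, map_mul, map_mul, map_pow,
    mul_pow, mul_div_mul_right _ _ (pow_ne_zero _ hg0)]

end Away

section ToP
variable {k V : Type u} [Field k] [AddCommGroup V] [Module k V]

variable {W : Type u} [AddCommGroup W] [Module k W] (e : V ≃ₗ[k] W)

lemma symMap_algebraMap (c : k) : symMap e (algebraMap k _ c) = algebraMap k _ c :=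
  AlgHom.commutes (SymmetricAlgebra.lift (SymmetricAlgebra.ι k W ∘ₗ e.toLinearMap) :
    SymmetricAlgebra k V →ₐ[k] SymmetricAlgebra k W) c

/-- In the chart of `v₀` the isomorphism of projective spaces is `v / v₀ ↦ e v / e v₀`. -/
lemma P.exists_chartι_map (v₀ : V) : ∃ ψ : HomogeneousLocalization.Away (symGrading k V)
      (SymmetricAlgebra.ι k V v₀) →+* HomogeneousLocalization.Away (symGrading k W)
      (SymmetricAlgebra.ι k W (e v₀)),
    P.chartι (e v₀) ≫ P.map e = Spec.map (CommRingCat.ofHom ψ) ≫ P.chartι v₀ ∧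
    (∀ v, ψ (fracAway k V v₀ v) = fracAway k W (e v₀) (e v)) ∧
    ∀ c : k, ψ (HomogeneousLocalization.fromZeroRingHom (symGrading k V) _
      (algebraMap k (symGrading k V 0) c)) = HomogeneousLocalization.fromZeroRingHom (symGrading k W) _
      (algebraMap k (symGrading k W 0) c) := by
  have key : ∀ (s : SymmetricAlgebra k W) (hs : s ∈ symGrading k W 1)
      (h : symMap e (SymmetricAlgebra.ι k V v₀) = s),
      ∃ ψ : HomogeneousLocalization.Away (symGrading k V)
        (SymmetricAlgebra.ι k V v₀) →+* HomogeneousLocalization.Away (symGrading k W) s,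
      Proj.awayι (symGrading k W) s hs one_pos ≫ P.map e =
        Spec.map (CommRingCat.ofHom ψ) ≫ P.chartι v₀ ∧
      ∀ n a ha, ψ (HomogeneousLocalization.Away.mk (symGrading k V) (ι_mem k V v₀) n a ha) =
        HomogeneousLocalization.Away.mk (symGrading k W) hs n (symMap e a)
          ((symMap e).map_mem ha) := by
    rintro s hs rfl
    exact ⟨HomogeneousLocalization.Away.map (symMap e) _,
      Proj.awayι_comp_map (symMap e) (symMap_irrelevant e) one_pos _ (ι_mem k V v₀),
      fun n a ha => HomogeneousLocalization.Away.map_mk (symMap e) _ (ι_mem k V v₀) n a ha⟩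
  obtain ⟨ψ, h1, h2⟩ := key _ (ι_mem k W (e v₀)) (symMap_ι e v₀)
  refine ⟨ψ, h1, fun v => ?_, fun c => ?_⟩
  · rw [fracAway, h2]
    simp only [symMap_ι]
    rfl
  · rw [fromZero_eq_mk _ (ι_mem k V v₀), h2, fromZero_eq_mk _ (ι_mem k W (e v₀))]
    simp only [symMap_algebraMap]

lemma P.ofLinear_map {A : Type u} [CommRing A] [Algebra k A] (l : W →ₗ[k] A) (v₀ : V)
    (h : l (e v₀) = 1) : P.ofLinear l (e v₀) h ≫ P.map e =
      P.ofLinear (l ∘ₗ e.toLinearMap) v₀ h := by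
  obtain ⟨ψ, h1, h2, h3⟩ := P.exists_chartι_map e v₀
  rw [P.ofLinear, Category.assoc, h1, ← Category.assoc, ← Spec.map_comp, P.ofLinear]
  congr 2
  ext1
  refine away_hom_ext v₀ (fun v => ?_) (fun c => ?_)
  · exact (congrArg (awayHomOfLinear l (e v₀) h) (h2 v)).trans
      ((awayHomOfLinear_frac l (e v₀) h _).trans
        (awayHomOfLinear_frac (l ∘ₗ e.toLinearMap) v₀ h v).symm)
  · exact (congrArg (awayHomOfLinear l (e v₀) h) (h3 c)).trans
      ((awayHomOfLinear_algebraMap l (e v₀) h _).trans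
        (awayHomOfLinear_algebraMap (l ∘ₗ e.toLinearMap) v₀ h c).symm)

variable (k W) in
/-- The open cover of `P_W` by the affine charts. -/
def P.cover : (P k W).OpenCover :=
  Scheme.Cover.mkOfCovers W (fun w => Spec (.of (HomogeneousLocalization.Away (symGrading k W)
    (SymmetricAlgebra.ι k W w)))) (fun w => P.chartι w) fun x => by
      obtain ⟨w, hw⟩ := P.iSup_chart x
      rw [← P.opensRange_chartι] at hw
      exact ⟨w, hw⟩

lemma P.chartι_map_str (w : W) : P.chartι w ≫ P.map e ≫ P.str k V = P.chartι w ≫ P.str k W := by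
  obtain ⟨v₀, rfl⟩ := e.surjective w
  obtain ⟨ψ, h1, h2, h3⟩ := P.exists_chartι_map e v₀
  rw [← Category.assoc, h1, Category.assoc, P.chartι_str, P.chartι_str, ← Spec.map_comp]
  congr 1
  ext c
  exact congrArg HomogeneousLocalization.val (h3 c)

lemma P.map_str : P.map e ≫ P.str k V = P.str k W :=
  (P.cover k W).hom_ext _ _ fun w => P.chartι_map_str e w

variable [Finite k] [Module.Finite k V] [Nontrivial V]

lemma B.toP_str : B.toP k V ≫ P.str k V = B.str k V := by
  rw [B.toP, Category.assoc, Category.assoc, P.map_str, prodP.π_str, B.str]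

lemma toAlgHom_ι_eq_vec (v : V) : IsScalarTower.toAlgHom k (SymmetricAlgebra k V) (K k V)
    (SymmetricAlgebra.ι k V v) = vec k V v := by
  rw [IsScalarTower.coe_toAlgHom']
  rfl

lemma toAlgHom_ι_ne_zero {v : V} (h : v ≠ 0) : IsScalarTower.toAlgHom k (SymmetricAlgebra k V) (K k V)
    (SymmetricAlgebra.ι k V v) ≠ 0 := by
  rw [toAlgHom_ι_eq_vec]
  exact vec_ne_zero k V h

lemma exists_prodVec_eq (v₀ : V) (h : v₀ ≠ 0) : ∃ (d : ℕ) (g : SymmetricAlgebra k V),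
    g ∈ symGrading k V d ∧ prodVec k V = SymmetricAlgebra.ι k V v₀ * g := by
  classical
  exact ⟨_, _, SetLike.prod_mem_graded (A := symGrading k V) (F := (nonzeroVectors k V).erase v₀)
    (i := fun _ => 1) (g := SymmetricAlgebra.ι k V) (fun v _ => ι_mem k V v),
    (Finset.mul_prod_erase _ _ ((mem_nonzeroVectors k V).mpr h)).symm⟩

section
variable {A : Type u} [CommRing A] [Algebra k A] {ε : A →+* K k V}

lemma map_awayHomOfLinear
    (hε : ∀ c : k, ε (algebraMap k A c) = algebraMap k _ c) {l : V →ₗ[k] A} {v₀ : V} (h : l v₀ = 1)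
    (h₀ : v₀ ≠ 0) (hl : ∀ v, ε (l v) = vec k V v / vec k V v₀)
    (z : HomogeneousLocalization.Away (symGrading k V)
    (SymmetricAlgebra.ι k V v₀)) : ε (awayHomOfLinear l v₀ h z) =
      awayToK k V (symGrading k V) (IsScalarTower.toAlgHom k (SymmetricAlgebra k V) (K k V))
        (SymmetricAlgebra.ι k V v₀) (toAlgHom_ι_ne_zero h₀) z := by
  refine RingHom.congr_fun (f := ε.comp (awayHomOfLinear l v₀ h))
    (away_hom_ext v₀ (fun v => ?_) (fun c => ?_)) z
  · rw [RingHom.comp_apply, awayHomOfLinear_frac, hl, fracAway, awayToK_mk, pow_one,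
      toAlgHom_ι_eq_vec, toAlgHom_ι_eq_vec]
  · rw [RingHom.comp_apply, awayHomOfLinear_algebraMap, hε, awayToK_algebraMap _ _ _ (ι_mem k V v₀)]

lemma Spec_map_awayι_eq_ofLinear
    (hε : ∀ c : k, ε (algebraMap k A c) = algebraMap k _ c) {l : V →ₗ[k] A} {v₀ : V} (h : l v₀ = 1)
    (h₀ : v₀ ≠ 0) (hl : ∀ v, ε (l v) = vec k V v / vec k V v₀)
    (hinj : Function.Injective ε)
    (ψ : HomogeneousLocalization.Away (symGrading k V) (prodVec k V) →+* A)
    (h1 : IsScalarTower.toAlgHom k (SymmetricAlgebra k V) (K k V) (prodVec k V) ≠ 0)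
    (hψ : ∀ z, ε (ψ z) = awayToK k V (symGrading k V)
      (IsScalarTower.toAlgHom k (SymmetricAlgebra k V) (K k V)) (prodVec k V) h1 z) :
    Spec.map (CommRingCat.ofHom ψ) ≫
      Proj.awayι (symGrading k V) (prodVec k V) (prodVec_mem k V) (card_pos k V) =
    P.ofLinear l v₀ h := by
  obtain ⟨d, g, hg, hx⟩ := exists_prodVec_eq (k := k) v₀ h₀
  refine Spec_map_awayι (symGrading k V) (ι_mem k V v₀) one_pos hg _ _ hx _ _ fun z => hinj ?_
  rw [hψ, map_awayHomOfLinear hε h h₀ hl]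
  exact awayToK_awayMap (symGrading k V) _ (ι_mem k V v₀) hg hx (toAlgHom_ι_ne_zero (k := k) h₀) _ z

end

lemma toB_toP : Ω.toB k V ≫ B.toP k V = Ω.toP k V := by
  obtain ⟨n, hn⟩ := exists_finrank k V
  let b := Module.finBasisOfFinrankEq k V hn
  have h1 : B.chart b ≫ B.ι k V ≫ prodP.π k V ⟨⊤, top_ne_bot⟩ = chartComp b ⟨⊤, top_ne_bot⟩ := by
    rw [← Category.assoc, B.chart_ι]
    exact comp_chartMap b _
  have h0 : ((leadVec b ⟨⊤, top_ne_bot⟩ : (⊤ : Submodule k V)) : V) ≠ 0 :=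
    (lead_leadVec b ⟨⊤, top_ne_bot⟩).ne_zero
  have h2 := P.ofLinear_map (Submodule.topEquiv.symm : V ≃ₗ[k] (⊤ : Submodule k V))
    ((chartIncl b).toLinearMap ∘ₗ fracMap b (le_filt_leadIndex b ⟨⊤, top_ne_bot⟩)
      (lead_leadVec b ⟨⊤, top_ne_bot⟩)) (leadVec b ⟨⊤, top_ne_bot⟩ : (⊤ : Submodule k V)).1
    (chartIncl_fracMap_leadVec b ⟨⊤, top_ne_bot⟩)
  rw [← chartΩ_chart b, Category.assoc, B.toP, reassoc_of% h1, ← Category.assoc,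
    chartΩ_comp_chartComp]
  refine h2.trans (Spec_map_awayι_eq_ofLinear (ε := (RSZero k V).val.toRingHom) (fun c => rfl) _ h0
    (fun v => ?_) Subtype.val_injective (toRSZeroOfSym k V)
    (by rw [IsScalarTower.coe_toAlgHom', coe_prodVec]; exact prod_ne_zero k V) fun z => rfl).symm
  exact coe_chartIncl b _

end ToP

/-! ### The morphism from `B_V` to `Q_V` -/

section ToQ
variable {n : ℕ} {k V : Type u} [Field k] [AddCommGroup V] [Module k V]
  (b : Module.Basis (Fin (n + 1)) k V)

/-- The last basis vector divided by any non-zero vector lies in the chart ring. -/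
lemma mul_lastVec_pow_mem {m : ℕ} {y : K k V} (hy : y ∈ Submodule.span k (recips k V) ^ m) :
    y * vec k V (b (Fin.last n)) ^ m ∈ chartRing b := by
  have h1 : ∀ z ∈ Submodule.span k (recips k V), z * vec k V (b (Fin.last n)) ∈ chartRing b := by
    intro z hz
    induction hz using Submodule.span_induction with
    | mem z hz =>
      obtain ⟨v, hv, rfl⟩ := hz
      obtain ⟨i, hi⟩ := exists_lead_vector b hv
      rw [inv_mul_eq_div]
      exact (lastFrac b hi).2
    | zero => rw [zero_mul]; exact zero_mem _
    | add x y _ _ hx hy => rw [add_mul]; exact add_mem hx hy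
    | smul c x _ hx => rw [smul_mul_assoc]; exact (chartRing b).smul_mem hx c
  induction hy using Submodule.pow_induction_on_left' with
  | algebraMap r => rw [pow_zero, mul_one]; exact (chartRing b).algebraMap_mem r
  | add x y i _ _ hx hy => rw [add_mul]; exact add_mem hx hy
  | mem_mul m hm i x _ hx =>
    rw [Nat.succ_eq_add_one, pow_succ', mul_mul_mul_comm]
    exact mul_mem (h1 m hm) hx

/-- The reciprocal of the last basis vector. -/
def lastRecip : R k V := recip k V (b (Fin.last n)) (b.ne_zero _)

lemma val_lastRecip_ne_zero : (R k V).val (lastRecip b) ≠ 0 :=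
  inv_ne_zero (vec_ne_zero k V (b.ne_zero _))

lemma lastRecip_mem : lastRecip b ∈ recipGrading k V 1 := recip_mem k V _ _

/-- The coordinate ring of the chart of `Q_V` where the reciprocal of the last basis vector is
invertible maps to the chart ring. -/
def recipToChart :
    HomogeneousLocalization.Away (recipGrading k V) (lastRecip b) →+* chartRing b :=
  (awayToK k V (recipGrading k V) (R k V).val (lastRecip b) (val_lastRecip_ne_zero b)).codRestrict
    (chartRing b) fun x => by
      obtain ⟨m, a, ha, rfl⟩ := x.mk_surjective _ (lastRecip_mem b)
      rw [awayToK_mk, div_eq_mul_inv, ← inv_pow]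
      have h : ((R k V).val (lastRecip b))⁻¹ = vec k V (b (Fin.last n)) := inv_inv _
      rw [h]
      have ha' : (a : K k V) ∈ Submodule.span k (recips k V) ^ (m • 1) := ha
      rw [smul_eq_mul, mul_one] at ha'
      exact mul_lastVec_pow_mem b ha'

lemma coe_recipToChart (x) : Subtype.val (recipToChart b x) = awayToK k V (recipGrading k V)
    (R k V).val (lastRecip b) (val_lastRecip_ne_zero b) x := rfl

/-- The morphism from the chart of `b` to `Q_V`. -/
def chartToQ : chart b ⟶ Q k V :=
  Spec.map (CommRingCat.ofHom (recipToChart b)) ≫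
    Proj.awayι (recipGrading k V) (lastRecip b) (lastRecip_mem b) one_pos

lemma chartToQ_str : chartToQ b ≫ Q.str k V =
    Spec.map (CommRingCat.ofHom (algebraMap k (chartRing b))) := by
  refine (Category.assoc _ _ _).trans ((congrArg (Spec.map (CommRingCat.ofHom (recipToChart b)) ≫ ·)
    (awayι_str (recipGrading k V) (lastRecip_mem b) one_pos)).trans
      ((Spec.map_comp _ _).symm.trans (congrArg Spec.map ?_)))
  ext c
  exact awayToK_algebraMap (recipGrading k V) _ _ (lastRecip_mem b) c

variable [Finite k] [Module.Finite k V] [Nontrivial V]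

lemma exists_prodRecip_eq (v₀ : V) (h : v₀ ≠ 0) : ∃ (d : ℕ) (g : R k V),
    g ∈ recipGrading k V d ∧ prodRecip k V = recip k V v₀ h * g := by
  classical
  exact ⟨_, _, SetLike.prod_mem_graded (A := recipGrading k V)
    (F := (nonzeroVectors k V).attach.erase ⟨v₀, (mem_nonzeroVectors k V).mpr h⟩)
    (i := fun _ => 1)
    (g := fun v : nonzeroVectors k V => recip k V v.1 ((mem_nonzeroVectors k V).mp v.2))
    (fun v _ => recip_mem k V v.1 _),
    (Finset.mul_prod_erase _ _ (Finset.mem_attach _ ⟨v₀, _⟩)).symm⟩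

lemma chartΩ_chartToQ : chartΩ b ≫ chartToQ b = Ω.toQ k V := by
  obtain ⟨d, g, hg, hx⟩ := exists_prodRecip_eq (k := k) (b (Fin.last n)) (b.ne_zero _)
  have h0 : (R k V).val (prodRecip k V) ≠ 0 := by
    rw [Subalgebra.coe_val, coe_prodRecip]; exact inv_ne_zero (prod_ne_zero k V)
  have h1 := Spec_map_awayι (recipGrading k V) (lastRecip_mem b) one_pos hg (prodRecip_mem k V)
    (card_pos k V) hx (toRSZeroOfRecip k V) ((chartIncl b).toRingHom.comp (recipToChart b))
    fun z => Subtype.ext (by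
      rw [coe_toRSZeroOfRecip]
      exact awayToK_awayMap (recipGrading k V) (R k V).val (lastRecip_mem b) hg hx
        (val_lastRecip_ne_zero b) h0 z)
  refine Eq.trans ?_ h1.symm
  exact (Category.assoc _ _ _).symm.trans (congrArg (· ≫ Proj.awayι (recipGrading k V) (lastRecip b)
    (lastRecip_mem b) one_pos) (Spec.map_comp _ _).symm)

/-- The preimage of `Ω_V ⊆ Q_V` in a chart is `Ω_V`: the quotient of the last by the first basis
vector divides the product of all quotients of the last basis vector by non-zero vectors. -/
lemma chartToQ_preimage_le : chartToQ b ⁻¹ᵁ Q.boundaryCompl k V ≤ chartD b (chartBoundary b) := by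
  obtain ⟨z, hz⟩ : ∃ z, (R k V).val (prodRecip k V) * vec k V (b (Fin.last n)) ^
      (nonzeroVectors k V).card = (chartBoundary b * z : chartRing b) := by
    classical
    have h0 := (mem_nonzeroVectors k V).mpr (b.ne_zero 0)
    have h1 : ∀ s : Finset V, (∀ v ∈ s, v ≠ 0) →
        ∏ v ∈ s, (vec k V (b (Fin.last n)) / vec k V v) ∈ chartRing b := fun s hs =>
      (chartRing b).prod_mem fun v hv => by
        obtain ⟨i, hi⟩ := exists_lead_vector b (hs v hv)
        exact (lastFrac b hi).2
    refine ⟨⟨_, h1 ((nonzeroVectors k V).erase (b 0)) fun v hv =>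
      (mem_nonzeroVectors k V).mp (Finset.mem_of_mem_erase hv)⟩, ?_⟩
    rw [Subalgebra.coe_val, coe_prodRecip, Subalgebra.coe_mul, coe_chartBoundary]
    refine Eq.trans ?_ (Finset.mul_prod_erase _ (fun v => vec k V (b (Fin.last n)) / vec k V v)
      h0).symm
    rw [Finset.prod_div_distrib, Finset.prod_const, inv_mul_eq_div]
  have h2 : recipToChart b (HomogeneousLocalization.Away.isLocalizationElem (lastRecip_mem b)
      (prodRecip_mem k V)) = chartBoundary b * z := by
    refine Subtype.ext ?_
    rw [coe_recipToChart, awayToK_mk, ← hz, pow_one, div_eq_mul_inv, ← inv_pow]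
    congr 2
    exact inv_inv (vec k V (b (Fin.last n)))
  have h3 : chartToQ b ⁻¹ᵁ Q.boundaryCompl k V = chartD b (recipToChart b
      (HomogeneousLocalization.Away.isLocalizationElem (lastRecip_mem b) (prodRecip_mem k V))) := by
    refine (congrArg (Spec.map (CommRingCat.ofHom (recipToChart b)) ⁻¹ᵁ ·)
      (Proj.awayι_preimage_basicOpen (recipGrading k V) (lastRecip_mem b) one_pos
        (prodRecip_mem k V) (card_pos k V))).trans ?_
    rw [chartD, basicOpen_eq_of_affine]
    rfl
  rw [h3, h2, chartD_mul]
  exact inf_le_left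

/-- Two morphisms from charts to a separated scheme that agree on `Ω_V` agree on the intersection of the
charts. -/
lemma chart_overlap_ext {m : ℕ} (b' : Module.Basis (Fin (m + 1)) k V) {Y : Scheme.{u}}
    [Y.IsSeparated] (f : chart b ⟶ Y) (f' : chart b' ⟶ Y) (h : chartΩ b ≫ f = chartΩ b' ≫ f') :
    pullback.fst (B.chart b) (B.chart b') ≫ f = pullback.snd (B.chart b) (B.chart b') ≫ f' := by
  let ι : Ω k V ⟶ pullback (B.chart b) (B.chart b') :=
    pullback.lift (chartΩ b) (chartΩ b') (by rw [chartΩ_chart, chartΩ_chart])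
  let p : pullback (B.chart b) (B.chart b') ⟶ B k V := pullback.fst _ _ ≫ B.chart b
  have hp : ι ≫ p = Ω.toB k V := by rw [pullback.lift_fst_assoc, chartΩ_chart]
  have : IsReduced (pullback (B.chart b) (B.chart b')) := isReduced_of_isOpenImmersion p
  have : IsDominant ι := by
    refine ⟨?_⟩
    have h1 : Set.range ι = p ⁻¹' Set.range (Ω.toB k V) := by
      rw [← hp]
      ext x
      constructor
      · rintro ⟨y, rfl⟩
        exact ⟨y, rfl⟩
      · rintro ⟨y, hy⟩
        exact ⟨y, p.isOpenEmbedding.injective hy⟩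
    rw [DenseRange, h1]
    exact dense_range_toB.preimage p.isOpenEmbedding.isOpenMap
  refine ext_of_isDominant ι ?_
  rw [pullback.lift_fst_assoc, pullback.lift_snd_assoc, h]

instance : Scheme.IsSeparated (Q k V) := inferInstanceAs (Scheme.IsSeparated (Proj (recipGrading k V)))

variable (k V) in
/-- The morphism from `B_V` to `Q_V`. -/
def B.toQ : B k V ⟶ Q k V :=
  Scheme.Cover.glueMorphisms (B.cover k V) chartToQ fun b b' =>
    chart_overlap_ext b b' _ _ ((chartΩ_chartToQ b).trans (chartΩ_chartToQ b').symm)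

end ToQ

/-! ### `B_V` as a desingularization of `Q_V` -/

section ToQ
variable {k V : Type u} [Field k] [AddCommGroup V] [Module k V]
  [Finite k] [Module.Finite k V] [Nontrivial V]

lemma B.chart_toQ (b : Module.Basis (Fin ((exists_finrank k V).choose + 1)) k V) :
    B.chart b ≫ B.toQ k V = chartToQ b :=
  Scheme.Cover.ι_glueMorphisms (B.cover k V) chartToQ _ b

lemma toB_toQ : Ω.toB k V ≫ B.toQ k V = Ω.toQ k V := by
  rw [Ω.toB, Category.assoc, B.chart_toQ, chartΩ_chartToQ]

lemma B.toQ_str : B.toQ k V ≫ Q.str k V = B.str k V := by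
  refine (B.cover k V).hom_ext _ _ fun b => ?_
  refine (Category.assoc _ _ _).symm.trans ((congrArg (· ≫ Q.str k V) (B.chart_toQ b)).trans ?_)
  exact (chartToQ_str b).trans (B.chart_str b).symm

/-- The inverse image of `Ω_V ⊆ Q_V` in `B_V` is `Ω_V`. -/
lemma B.toQ_preimage : (B.toQ k V ⁻¹ᵁ Q.boundaryCompl k V : Set (B k V)) = Set.range (Ω.toB k V) := by
  refine Set.Subset.antisymm (fun x hx => ?_) ?_
  · obtain ⟨b, y, rfl⟩ := B.exists_mem_chart (exists_finrank k V).choose_spec x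
    rw [chart_mem_range_toB]
    refine chartToQ_preimage_le b ?_
    rw [← B.chart_toQ]
    exact hx
  · rintro _ ⟨y, rfl⟩
    have h1 : Ω.toQ k V y ∈ Q.boundaryCompl k V := by
      rw [← opensRange_toQ]
      exact ⟨y, rfl⟩
    rw [← toB_toQ] at h1
    exact h1

instance : IsSeparated (Q.str k V) :=
  inferInstanceAs (IsSeparated (Proj.toSpecZero (recipGrading k V) ≫
    Spec.map (CommRingCat.ofHom (algebraMap k (recipGrading k V 0)))))

instance : IsProper (B.toQ k V) := by
  have : IsProper (B.toQ k V ≫ Q.str k V) := by rw [B.toQ_str]; infer_instance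
  exact IsProper.of_comp _ (Q.str k V)

instance : IsIso (B.toQ k V ∣_ Q.boundaryCompl k V) := by
  let c : Ω k V ≅ (B.toQ k V ⁻¹ᵁ Q.boundaryCompl k V).toScheme :=
    IsOpenImmersion.isoOfRangeEq (Ω.toB k V) (B.toQ k V ⁻¹ᵁ Q.boundaryCompl k V).ι
      (by rw [Scheme.Opens.range_ι, B.toQ_preimage])
  have hc : c.hom ≫ (B.toQ k V ⁻¹ᵁ Q.boundaryCompl k V).ι = Ω.toB k V :=
    IsOpenImmersion.isoOfRangeEq_hom_fac _ _ _
  let d : Ω k V ≅ (Q.boundaryCompl k V).toScheme :=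
    IsOpenImmersion.isoOfRangeEq (Ω.toQ k V) (Q.boundaryCompl k V).ι
      (by rw [Scheme.Opens.range_ι, ← opensRange_toQ]; rfl)
  have hd : d.hom ≫ (Q.boundaryCompl k V).ι = Ω.toQ k V :=
    IsOpenImmersion.isoOfRangeEq_hom_fac _ _ _
  have h : B.toQ k V ∣_ Q.boundaryCompl k V = c.inv ≫ d.hom := by
    rw [Iso.eq_inv_comp, ← cancel_mono (Q.boundaryCompl k V).ι, Category.assoc, morphismRestrict_ι,
      reassoc_of% hc, toB_toQ, hd]
  rw [h]
  infer_instance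

/-- Over the open subset `Ω_V` of `Q_V` the morphism is an isomorphism, and it is proper since `B_V` is
proper and `Q_V` is separated. -/
theorem isDesingularization_toQ : IsDesingularization (B.str k V) (B.toQ k V) :=
  ⟨inferInstance, inferInstance, Q.boundaryCompl k V, dense_boundaryCompl,
    by rw [B.toQ_preimage]; exact dense_range_toB, inferInstance⟩

end ToQ

/-! ### The Segre morphism -/

section Segre
variable (k V : Type u) [Field k] [AddCommGroup V] [Module k V] [Finite k] [Module.Finite k V]

instance : Fintype (NZ k V) := Fintype.ofFinite _

/-- The choices of one vector in each non-zero subspace. -/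
abbrev Selection := ∀ W : NZ k V, W.1

instance : Finite (Selection k V) := by
  have : Finite V := Module.finite_of_finite k
  infer_instance

lemma exists_selection_equiv : ∃ N, Nonempty (Selection k V ≃ Fin (N + 1)) := by
  obtain ⟨N, ⟨e⟩⟩ := Finite.exists_equiv_fin (Selection k V)
  cases N with
  | zero => exact (e fun _ => 0).elim0
  | succ N => exact ⟨N, ⟨e⟩⟩

/-- The dimension of the projective space in which `B_V` is embedded. -/
def segreDim : ℕ := (exists_selection_equiv k V).choose

/-- A numbering of the selections. -/
def selectionEquiv : Selection k V ≃ Fin (segreDim k V + 1) :=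
  (exists_selection_equiv k V).choose_spec.some

variable {k V}

/-- The homogeneous coordinate `∏ σ_W` of the Segre embedding that belongs to the selection `σ`. -/
def segreVec (σ : Selection k V) : Fin (segreDim k V + 1) → k := Pi.single (selectionEquiv k V σ) 1

section Algebra
variable {A A' : Type u} [CommRing A] [Algebra k A] [CommRing A'] [Algebra k A']

/-- The linear map sending the coordinate of the selection `σ` to the product of the values
of the given linear maps at all `σ_W`. -/
def segreLin (l : ∀ W : NZ k V, W.1 →ₗ[k] A) : (Fin (segreDim k V + 1) → k) →ₗ[k] A :=
  Fintype.linearCombination k fun j => ∏ W, l W ((selectionEquiv k V).symm j W)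

lemma segreLin_segreVec (l : ∀ W : NZ k V, W.1 →ₗ[k] A) (σ : Selection k V) :
    segreLin l (segreVec σ) = ∏ W, l W (σ W) := by
  rw [segreLin, segreVec, Fintype.linearCombination_apply_single, one_smul, Equiv.symm_apply_apply]

lemma segreLin_self {l : ∀ W : NZ k V, W.1 →ₗ[k] A} {σ : Selection k V} (h : ∀ W, l W (σ W) = 1) :
    segreLin l (segreVec σ) = 1 := by
  rw [segreLin_segreVec, Finset.prod_eq_one fun W _ => h W]

lemma segreLin_comp (φ : A →ₐ[k] A') (l : ∀ W : NZ k V, W.1 →ₗ[k] A) :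
    φ.toLinearMap ∘ₗ segreLin l = segreLin fun W => φ.toLinearMap ∘ₗ l W := by
  refine LinearMap.pi_ext' fun j => LinearMap.ext_ring ?_
  obtain ⟨σ, rfl⟩ := (selectionEquiv k V).surjective j
  refine (congrArg φ (segreLin_segreVec l σ)).trans ((map_prod φ _ _).trans ?_)
  exact (segreLin_segreVec (fun W => φ.toLinearMap ∘ₗ l W) σ).symm

/-- Rescaling the linear maps by scalars rescales their product. -/
lemma segreLin_eq_mul {l l' : ∀ W : NZ k V, W.1 →ₗ[k] A} {c : NZ k V → A}
    (h : ∀ W w, l W w = c W * l' W w) (v : Fin (segreDim k V + 1) → k) :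
    segreLin l v = (∏ W, c W) * segreLin l' v := by
  have : segreLin l = LinearMap.mulLeft k (∏ W, c W) ∘ₗ segreLin l' := by
    refine LinearMap.pi_ext' fun j => LinearMap.ext_ring ?_
    obtain ⟨σ, rfl⟩ := (selectionEquiv k V).surjective j
    refine (segreLin_segreVec l σ).trans (Eq.trans ?_ (congrArg ((∏ W, c W) * ·)
      (segreLin_segreVec l' σ)).symm)
    rw [← Finset.prod_mul_distrib]
    exact Finset.prod_congr rfl fun W _ => h W _
  rw [this]
  rfl

/-- Tuples of proportional linear maps have the same image under the Segre morphism. -/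
lemma P.ofLinear_segre_congr {l l' : ∀ W : NZ k V, W.1 →ₗ[k] A} {σ σ' : Selection k V}
    (h : ∀ W, l W (σ W) = 1) (h' : ∀ W, l' W (σ' W) = 1)
    (H : ∀ W w, l W w = l W (σ' W) * l' W w) :
    P.ofLinear (segreLin l) (segreVec σ) (segreLin_self h) =
      P.ofLinear (segreLin l') (segreVec σ') (segreLin_self h') :=
  P.ofLinear_congr fun v => by rw [segreLin_eq_mul H, segreLin_segreVec l σ']

end Algebra

section Charts
variable {n m : ℕ} (b : Module.Basis (Fin (n + 1)) k V) (b' : Module.Basis (Fin (m + 1)) k V)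

/-- The linear map `w ↦ w / w₀` for a vector `w₀` of `W` of minimal leading index. -/
abbrev leadMap (W : NZ k V) : W.1 →ₗ[k] chartRing b :=
  fracMap b (le_filt_leadIndex b W) (lead_leadVec b W)

lemma leadMap_self (W : NZ k V) : leadMap b W (leadVec b W) = 1 :=
  chartFrac_self b (lead_leadVec b W)

/-- The Segre morphism on the chart of `b`. -/
def chartSegre : chart b ⟶ P k (Fin (segreDim k V + 1) → k) :=
  P.ofLinear (segreLin (leadMap b)) (segreVec (leadVec b)) (segreLin_self (leadMap_self b))

lemma chartSegre_str : chartSegre b ≫ P.str k _ =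
    Spec.map (CommRingCat.ofHom (algebraMap k (chartRing b))) :=
  P.ofLinear_str _ _ _

lemma top_le_preimage_chartSegre :
    ⊤ ≤ chartSegre b ⁻¹ᵁ P.chart k _ (segreVec (leadVec b)) := (P.ofLinear_preimage _ _ _).ge

lemma coord_chartSegre (σ : Selection k V) :
    coord (chartSegre b) (segreVec (leadVec b)) (top_le_preimage_chartSegre b) (segreVec σ) =
      ∏ W, coord (comp (chartMap b) W) (leadVec b W) (top_le_locus_leadVec b W) (σ W) := by
  simp only [coord_leadVec]
  refine (P.coord_ofLinear _ _ _ _ _).trans ?_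
  rw [segreLin_segreVec, map_prod]
  rfl

/-- The product of the `σ_W` is invertible exactly where all `σ_W` are. -/
lemma mem_preimage_chartSegre (σ : Selection k V) (y : chart b) :
    y ∈ chartSegre b ⁻¹ᵁ P.chart k _ (segreVec σ) ↔ ∀ W, y ∈ locus (chartMap b) W (σ W) := by
  have h1 := basicOpen_coord (chartSegre b) (segreVec (leadVec b)) (segreVec σ)
    (top_le_preimage_chartSegre b)
  have h2 := fun W => basicOpen_coord (comp (chartMap b) W) (leadVec b W) (σ W)
    (top_le_locus_leadVec b W)
  rw [top_inf_eq] at h1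
  simp only [top_inf_eq] at h2
  have h3 : ∀ (s : Finset (NZ k V)) (a : NZ k V → Γ(chart b, ⊤)),
      y ∈ (chart b).basicOpen (∏ W ∈ s, a W) ↔ ∀ W ∈ s, y ∈ (chart b).basicOpen (a W) := by
    intro s a
    classical
    induction s using Finset.induction_on with
    | empty =>
      simp only [Finset.prod_empty, Finset.notMem_empty, IsEmpty.forall_iff, implies_true, iff_true]
      rw [Scheme.basicOpen_of_isUnit _ isUnit_one]
      trivial
    | insert i s hi ih =>
      rw [Finset.prod_insert hi, Scheme.basicOpen_mul, Finset.forall_mem_insert, ← ih]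
      exact Iff.rfl
  rw [← h1, coord_chartSegre, h3]
  simp only [h2, Finset.mem_univ, true_implies]

/-- On the open set where all `τ_W` are invertible, the Segre coordinates relative to `τ` are the
products of the coordinates relative to the `τ_W`. -/
lemma coord_comp_chartSegre {T : Scheme.{u}} (h : T ⟶ chart b) (τ σ : Selection k V)
    (e : ⊤ ≤ (h ≫ chartSegre b) ⁻¹ᵁ P.chart k _ (segreVec τ))
    (e' : ∀ W, ⊤ ≤ locus (h ≫ chartMap b) W (τ W)) :
    coord (h ≫ chartSegre b) (segreVec τ) e (segreVec σ) =
      ∏ W, coord (comp (h ≫ chartMap b) W) (τ W) (e' W) (σ W) := by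
  have e₀ : ⊤ ≤ (h ≫ chartSegre b) ⁻¹ᵁ P.chart k _ (segreVec (leadVec b)) :=
    h.preimage_mono (top_le_preimage_chartSegre b)
  have e₀' : ∀ W, ⊤ ≤ locus (h ≫ chartMap b) W (leadVec b W) := fun W => by
    rw [locus_comp]
    exact h.preimage_mono (top_le_locus_leadVec b W)
  have h0 : ∀ σ, coord (h ≫ chartSegre b) (segreVec (leadVec b)) e₀ (segreVec σ) =
      ∏ W, coord (comp (h ≫ chartMap b) W) (leadVec b W) (e₀' W) (σ W) := by
    intro σ
    rw [← coord_comp _ _ _ (top_le_preimage_chartSegre b) h le_top e₀, coord_chartSegre, map_prod]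
    exact Finset.prod_congr rfl fun W _ => appLE_coord h (chartMap b) W _ _ _ le_top _
  have h1 := coord_trans (h ≫ chartSegre b) (segreVec (leadVec b)) (segreVec τ) (segreVec σ) e₀ e
  have h2 := fun W => coord_trans (comp (h ≫ chartMap b) W) (leadVec b W) (τ W) (σ W) (e₀' W) (e' W)
  refine (isUnit_coord (h ≫ chartSegre b) (segreVec (leadVec b)) (segreVec τ) e₀ e).mul_left_cancel ?_
  rw [← h1, h0, h0, ← Finset.prod_mul_distrib]
  exact Finset.prod_congr rfl fun W _ => h2 W

variable [Nontrivial V]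

lemma chartΩ_chartSegre : chartΩ b ≫ chartSegre b = chartΩ b' ≫ chartSegre b' := by
  have key : ∀ {l : ℕ} (b : Module.Basis (Fin (l + 1)) k V), chartΩ b ≫ chartSegre b =
      P.ofLinear (segreLin fun W => (chartIncl b).toLinearMap ∘ₗ leadMap b W) (segreVec (leadVec b))
        (segreLin_self fun W => chartIncl_fracMap_leadVec b W) := by
    intro l b
    refine (P.Spec_map_ofLinear (chartIncl b) _ _ _).trans ?_
    congr 1
    exact segreLin_comp (chartIncl b) (leadMap b)
  rw [key, key]
  refine P.ofLinear_segre_congr (fun W => chartIncl_fracMap_leadVec b W)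
    (fun W => chartIncl_fracMap_leadVec b' W) fun W w => Subtype.ext ?_
  have h1 := (lead_leadVec b' W).vec_ne_zero
  have key : ∀ {l : ℕ} (b : Module.Basis (Fin (l + 1)) k V) (v : W.1),
      (((chartIncl b).toLinearMap ∘ₗ fracMap b (le_filt_leadIndex b W) (lead_leadVec b W)) v : K k V) =
        vec k V v / vec k V (leadVec b W) := fun b v => coe_chartIncl b _
  rw [Subalgebra.coe_mul, key, key, key, mul_comm, div_mul_div_cancel₀ h1]

end Charts

variable [Nontrivial V]

variable (k V) in
/-- The restriction to `B_V` of the Segre embedding of `∏ P_W`. -/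
def B.segre : B k V ⟶ P k (Fin (segreDim k V + 1) → k) :=
  Scheme.Cover.glueMorphisms (B.cover k V) chartSegre fun b b' =>
    chart_overlap_ext b b' _ _ (chartΩ_chartSegre b b')

lemma B.chart_segre (b : Module.Basis (Fin ((exists_finrank k V).choose + 1)) k V) :
    B.chart b ≫ B.segre k V = chartSegre b :=
  Scheme.Cover.ι_glueMorphisms (B.cover k V) chartSegre _ b

lemma B.segre_str : B.segre k V ≫ P.str k _ = B.str k V := by
  refine (B.cover k V).hom_ext _ _ fun b => ?_
  refine (Category.assoc _ _ _).symm.trans ((congrArg (· ≫ P.str k _) (B.chart_segre b)).trans ?_)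
  exact (chartSegre_str b).trans (B.chart_str b).symm

/-- The product of the `σ_W` is invertible exactly where all `σ_W` are. -/
lemma B.mem_preimage_segre (σ : Selection k V) (x : B k V) :
    x ∈ B.segre k V ⁻¹ᵁ P.chart k _ (segreVec σ) ↔ ∀ W, x ∈ locus (B.ι k V) W (σ W) := by
  obtain ⟨b, y, rfl⟩ := B.exists_mem_chart (exists_finrank k V).choose_spec x
  have h := mem_preimage_chartSegre b σ y
  simp only [← B.chart_segre, ← B.chart_ι, locus_comp] at h
  exact h

end Segre

/-! ### Projectivity of `B_V` -/

section Projective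
variable {k V : Type u} [Field k] [AddCommGroup V] [Module k V] [Finite k] [Module.Finite k V]
  [Nontrivial V]

/-- The component in `P_W` of a morphism to a chart can be recovered from the Segre
morphism. -/
lemma chartMap_eq_of_chartSegre_eq {n m : ℕ} (b : Module.Basis (Fin (n + 1)) k V)
    (b' : Module.Basis (Fin (m + 1)) k V) {T : Scheme.{u}} (h : T ⟶ chart b) (h' : T ⟶ chart b')
    (H : h ≫ chartSegre b = h' ≫ chartSegre b') (τ : Selection k V)
    (e : ∀ W, ⊤ ≤ locus (h ≫ chartMap b) W (τ W)) : h ≫ chartMap b = h' ≫ chartMap b' := by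
  classical
  have e₁ : ⊤ ≤ (h ≫ chartSegre b) ⁻¹ᵁ P.chart k _ (segreVec τ) := fun y hy => by
    refine (mem_preimage_chartSegre b τ (h y)).mpr fun W => ?_
    have := e W hy
    rw [locus_comp] at this
    exact this
  have e₁' : ⊤ ≤ (h' ≫ chartSegre b') ⁻¹ᵁ P.chart k _ (segreVec τ) := H ▸ e₁
  have e' : ∀ W, ⊤ ≤ locus (h' ≫ chartMap b') W (τ W) := fun W y hy => by
    rw [locus_comp]
    exact (mem_preimage_chartSegre b' τ (h' y)).mp (e₁' hy) W
  have hs := congrArg (· ≫ P.str k _) H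
  simp only [Category.assoc, chartSegre_str] at hs
  refine prodP.hom_ext ?_ fun W => ?_
  · rw [Category.assoc, Category.assoc, chartMap_str, chartMap_str, hs]
  · refine P.hom_ext_of_coord ?_ (τ W) (e W) (e' W) fun v => ?_
    · rw [comp_str, comp_str, strOf, strOf, Category.assoc, Category.assoc, chartMap_str,
        chartMap_str, hs]
    · have h1 := coord_comp_chartSegre b h τ (Function.update τ W v) e₁ e
      have h2 := coord_comp_chartSegre b' h' τ (Function.update τ W v) e₁' e'
      have h3 : ∀ (c : ∀ W : NZ k V, W.1 → Γ(T, ⊤)), (∀ W, c W (τ W) = 1) →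
          ∏ W', c W' (Function.update τ W v W') = c W v := by
        intro c hc
        rw [Finset.prod_eq_single W, Function.update_self]
        · intro W' _ hW
          rw [Function.update_of_ne hW, hc]
        · exact fun h => absurd (Finset.mem_univ W) h
      rw [h3 (fun W => coord (comp (h ≫ chartMap b) W) (τ W) (e W)) fun W => coord_self _ _ _] at h1
      rw [h3 (fun W => coord (comp (h' ≫ chartMap b') W) (τ W) (e' W)) fun W => coord_self _ _ _]
        at h2
      rw [← h1, ← h2]
      exact coord_congr H _ _ _ _

/-- The components of a point of `B_V` can be recovered locally from its Segre coordinates. -/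
instance : Mono (B.segre k V) := by
  refine ⟨fun {S} g g' H => ?_⟩
  rw [← cancel_mono (B.ι k V)]
  refine hom_ext_of_locally fun x => ?_
  obtain ⟨b, y, hy⟩ := B.exists_mem_chart (exists_finrank k V).choose_spec (g x)
  obtain ⟨b', y', hy'⟩ := B.exists_mem_chart (exists_finrank k V).choose_spec (g' x)
  choose τ hτ using fun W : NZ k V => P.iSup_chart (comp (B.ι k V) W (g x))
  let U : S.Opens := g ⁻¹ᵁ (B.chart b).opensRange ⊓ g' ⁻¹ᵁ (B.chart b').opensRange ⊓
    (g ≫ B.segre k V) ⁻¹ᵁ P.chart k _ (segreVec τ)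
  have hU : ∀ z ∈ U, ∀ W, g z ∈ locus (B.ι k V) W (τ W) := fun z hz =>
    (B.mem_preimage_segre τ (g z)).mp hz.2
  refine ⟨U, ⟨⟨⟨y, hy⟩, ⟨y', hy'⟩⟩, (B.mem_preimage_segre τ (g x)).mpr hτ⟩, ?_⟩
  have h1 : Set.range (U.ι ≫ g) ⊆ Set.range (B.chart b) := by
    rintro _ ⟨z, rfl⟩
    exact z.2.1.1
  have h1' : Set.range (U.ι ≫ g') ⊆ Set.range (B.chart b') := by
    rintro _ ⟨z, rfl⟩
    exact z.2.1.2
  have h2 := IsOpenImmersion.lift_fac (B.chart b) (U.ι ≫ g) h1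
  have h2' := IsOpenImmersion.lift_fac (B.chart b') (U.ι ≫ g') h1'
  have h3 : IsOpenImmersion.lift (B.chart b) (U.ι ≫ g) h1 ≫ chartMap b = U.ι ≫ g ≫ B.ι k V := by
    rw [← B.chart_ι, ← Category.assoc, h2, Category.assoc]
  have h3' : IsOpenImmersion.lift (B.chart b') (U.ι ≫ g') h1' ≫ chartMap b' =
      U.ι ≫ g' ≫ B.ι k V := by
    rw [← B.chart_ι, ← Category.assoc, h2', Category.assoc]
  rw [← h3, ← h3']
  refine chartMap_eq_of_chartSegre_eq b b' _ _ ?_ τ fun W z _ => ?_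
  · rw [← B.chart_segre, ← B.chart_segre, ← Category.assoc, h2, ← Category.assoc, h2',
      Category.assoc, Category.assoc, H]
  · rw [h3, ← Category.assoc, locus_comp]
    exact hU _ z.2 W

/-- The Segre morphism is proper, as `B_V` is proper, and a monomorphism, hence a closed immersion. -/
theorem isProjectiveOver_B : IsProjectiveOver (B.str k V) := by
  refine ⟨segreDim k V, B.segre k V, ?_, B.segre_str⟩
  have : IsProper (B.segre k V ≫ P.str k _) := by rw [B.segre_str]; infer_instance
  have : IsProper (B.segre k V) := IsProper.of_comp _ (P.str k _)
  exact (IsClosedImmersion.iff_isProper_and_mono _).mpr ⟨inferInstance, inferInstance⟩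

end Projective

end BV

end

theorem theorem9p16 (k V : Type u) [Field k] [Finite k] [AddCommGroup V] [Module k V]
    [Module.Finite k V] [Nontrivial V] :
    -- `B_V` represents the tuples `E_•` with `E_{W''} ⊆ E_{W'}` for all `0 ≠ W'' ⊆ W' ⊆ V`
    (∀ {S : Scheme.{u}} (f : S ⟶ BV.prodP k V),
      (∃ g : S ⟶ BV.B k V, g ≫ BV.B.ι k V = f) ↔ BV.Incidence f) ∧
    -- `B_F` and `U_F` represent the closed and the open condition belonging to a flag `F`
    (∀ F : Set (Submodule k V), BV.IsFlag F → ∀ {S : Scheme.{u}} (f : S ⟶ BV.B k V),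
      ((∃ g : S ⟶ BV.BF F, g ≫ BV.BF.ι F = f) ↔ BV.ClosedCond F (f ≫ BV.B.ι k V)) ∧
      (Set.range f ⊆ (BV.UF F : Set (BV.B k V)) ↔ BV.OpenCond F (f ≫ BV.B.ι k V))) ∧
    -- as a set, `B_V` is the disjoint union of the strata `Ω_F = B_F ∩ U_F`
    (∀ x : BV.B k V, ∃! F : Set (Submodule k V), BV.IsFlag F ∧ x ∈ BV.stratum F) ∧
    -- `B_V` is an irreducible smooth projective variety
    IsIntegral (BV.B k V) ∧ Smooth (BV.B.str k V) ∧ BV.IsProjectiveOver (BV.B.str k V) ∧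
    -- `Ω_V` is a dense open subscheme of `P_V` and of `Q_V`
    IsOpenImmersion (BV.Ω.toP k V) ∧ IsDominant (BV.Ω.toP k V) ∧
    IsOpenImmersion (BV.Ω.toQ k V) ∧ IsDominant (BV.Ω.toQ k V) ∧
    -- `Ω_V` is the open stratum of `B_V`, and its complement is a normal crossings divisor; `B_V`
    -- has morphisms to `P_V` and `Q_V` over `k` that extend the inclusions of `Ω_V`
    ∃ j : BV.Ω k V ⟶ BV.B k V,
      IsOpenImmersion j ∧ j ≫ BV.B.str k V = BV.Ω.str k V ∧
      Set.range j = BV.stratum (BV.trivialFlag k V) ∧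
      Set.range j = (BV.UF (BV.trivialFlag k V) : Set (BV.B k V)) ∧
      BV.IsNormalCrossingsDivisor (BV.B.str k V) (Set.range j)ᶜ ∧
      BV.B.toP k V ≫ BV.P.str k V = BV.B.str k V ∧ j ≫ BV.B.toP k V = BV.Ω.toP k V ∧
      ∃ πQ : BV.B k V ⟶ BV.Q k V,
        πQ ≫ BV.Q.str k V = BV.B.str k V ∧ j ≫ πQ = BV.Ω.toQ k V ∧
        BV.IsDesingularization (BV.B.str k V) πQ := by
  exact ⟨BV.exists_lift_B_iff, fun F _ S f => ⟨BV.exists_lift_BF_iff F f, BV.range_subset_UF_iff f⟩,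
    BV.existsUnique_stratum, inferInstance, inferInstance, BV.isProjectiveOver_B, inferInstance,
    inferInstance, inferInstance, inferInstance, BV.Ω.toB k V, inferInstance, BV.Ω.toB_str,
    BV.range_toB.trans BV.stratum_trivialFlag.symm, BV.range_toB,
    BV.isNormalCrossingsDivisor_compl_range_toB, BV.B.toP_str, BV.toB_toP, BV.B.toQ k V,
    BV.B.toQ_str, BV.toB_toQ, BV.isDesingularization_toQ⟩
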